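/- Conventions. A virtual link diagram is a smooth immersion of $n\ge 1$ oriented circles in the plane $\mathbb{C}$ whose only multiple points are finitely many transverse double points, each of them either classical (with over- and under-strand) or virtual; it is a virtual knot diagram if $n=1$. Its Gauss code consists of one cyclic word for each component, which records the classical crossings met along the component as letters $O_i^{\pm}$ or $U_i^{\pm}$ (over or under, number and sign of the crossing); it is determined up to the numbering of the crossings, the basepoints and the order of the components. Two diagrams are regarded as the same if they have the same Gauss code in this sense. Two virtual link diagrams are virtually isotopic, and then represent the same virtual knot or link, if their Gauss codes are related by Reidemeister moves of Gauss diagrams. Let $q\ge 1$. A diagram is (geometrically) invariant with period $q$ if it misses the origin and is invariant, with its orientation and its crossing information, under the rotation of the plane by $2\pi/q$ about the origin. A virtual link diagram $K$ is called $q$-periodic if it is the same (in the above sense) as a diagram that is invariant with period $q$; a virtual knot or link is called $q$-periodic if it has a diagram that is invariant with period $q$. The Gauss code $u$ of a knot is $q$-periodic if it consists of $q$ blocks of the same length $m$ and there is a map $f$ of the crossing numbers such that the cyclic shift of $u$ by $m$ letters is obtained from $u$ by replacing each crossing number $i$ by $f(i)$ (so that the $O/U$ and $\pm$ patterns repeat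 with period $q$, and if $O_i$ goes to $O_j$ in the next period, then $U_i$ goes to $U_j$). The closure $\widehat{\beta^q}$ of the $q$-th power of a virtual braid $\beta\in VB_k$ is the closure of the diagram obtained by stacking $q$ copies of a word for $\beta$ in the generators $\sigma_i^{\pm1},\tau_i^{\pm1}$ of $VB_k$. Theorem. Let $q\ge 1$. (i) A virtual knot diagram $K$ is $q$-periodic if and only if it has a $q$-periodic Gauss code. (ii) A virtual knot or link diagram $K$ is $q$-periodic if and only if there are $k$, $\beta\in VB_k$ and a word for $\beta$ such that $K$ is the same, as a diagram, as the closure $\widehat{\beta^q}$, that is, has the same Gauss code. Both statements also hold up to virtual isotopy: a virtual knot is $q$-periodic if and only if it is represented by a $q$-periodic Gauss code (one in which each crossing that occurs does so exactly twice, once as $O$ and once as $U$, with the same sign); and a virtual knot or link is $q$-periodic if and only if it is represented by the closure $\widehat{\beta^q}$ for some $k$ and some $\beta\in VB_k$. In particular, every periodic virtual knot or link has a periodic virtual braid representative. -/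

import Mathlib

open scoped ContDiff

/-! ### Gauss codes -/

/-- A letter of a Gauss code: `O` (`isOver = true`) or `U` (`isOver = false`), followed by the number
of the crossing and its sign (`pos = true` for `+`). -/
structure GaussLetter where
  isOver : Bool
  label : ℕ
  pos : Bool

/-- A Gauss code of a link: one (cyclic) word for each component.  A component without classical
crossings contributes the empty word. -/
abbrev GaussCode := List (List GaussLetter)

namespace GaussCode

/-- Every crossing number that occurs at all occurs exactly twice, once as `O` and once as `U`,
with the same sign. -/
def Valid (C : GaussCode) : Prop :=
  ∀ x ∈ C.flatten, ∃ s : Bool,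
    (C.flatten.filter (fun y => y.label = x.label)).Perm
      [⟨true, x.label, s⟩, ⟨false, x.label, s⟩]

/-- Renumbering a crossing. -/
def relabel (f : ℕ → ℕ) (x : GaussLetter) : GaussLetter := ⟨x.isOver, f x.label, x.pos⟩

/-- Change of the basepoint on each component, and of the order of the components. -/
def Rearranged (C C' : GaussCode) : Prop :=
  ∃ C₁ : GaussCode, List.Forall₂ List.IsRotated C C₁ ∧ C₁.Perm C'

/-- Change of the numbering of the crossings, of the basepoints, and of the order of the
components. -/
def Same (C C' : GaussCode) : Prop :=
  ∃ f : Equiv.Perm ℕ, Rearranged (C.map (List.map (relabel f))) C'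

/-- The crossing number `i` is not used in `C`. -/
def Fresh (i : ℕ) (C : GaussCode) : Prop := ∀ u ∈ C, ∀ x ∈ u, x.label ≠ i

/-- First Reidemeister move: insertion of an isolated chord. -/
inductive R1 : GaussCode → GaussCode → Prop
  | mk (C : GaussCode) (u : List GaussLetter) (i : ℕ) (o s : Bool) :
      Fresh i (u :: C) → R1 (u :: C) ((⟨o, i, s⟩ :: ⟨!o, i, s⟩ :: u) :: C)

/-- The two letters met by the lower strand in a second Reidemeister move; `d` records whether the
two strands run in the same direction. -/
def underPair (i j : ℕ) (s d : Bool) : List GaussLetter :=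
  if d then [⟨false, i, s⟩, ⟨false, j, !s⟩] else [⟨false, j, !s⟩, ⟨false, i, s⟩]

/-- Second Reidemeister move: an arc is pushed over another arc, of the same or of another
component; this creates two crossings of opposite signs. -/
inductive R2 : GaussCode → GaussCode → Prop
  | one (C : GaussCode) (u v : List GaussLetter) (i j : ℕ) (s d : Bool) :
      i ≠ j → Fresh i ((u ++ v) :: C) → Fresh j ((u ++ v) :: C) →
      R2 ((u ++ v) :: C)
        (([⟨true, i, s⟩, ⟨true, j, !s⟩] ++ u ++ underPair i j s d ++ v) :: C)
  | two (C : GaussCode) (u v : List GaussLetter) (i j : ℕ) (s d : Bool) :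
      i ≠ j → Fresh i (u :: v :: C) → Fresh j (u :: v :: C) →
      R2 (u :: v :: C)
        (([⟨true, i, s⟩, ⟨true, j, !s⟩] ++ u) :: (underPair i j s d ++ v) :: C)

/-- `C'` arises from `C` by exchanging two letters that are adjacent in `C` in the order `x y` if
`d = true`, in the order `y x` if `d = false`. -/
def Exchange (d : Bool) (x y : GaussLetter) (C C' : GaussCode) : Prop :=
  ∃ (u : List GaussLetter) (B : GaussCode),
    Rearranged C (((if d then [x, y] else [y, x]) ++ u) :: B) ∧
    Rearranged C' (((if d then [y, x] else [x, y]) ++ u) :: B)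

/-- Third Reidemeister move.  Three strands (top, middle, bottom) cross pairwise: `a` is the
crossing of top and middle, `b` that of top and bottom, `c` that of middle and bottom.  Each strand
meets its two crossings consecutively, and the move reverses the order on all three strands.
For three directed lines in the plane the order on each strand is, up to a common sign `d`, the
sign of the crossing of the other two strands; this is the compatibility that is required here. -/
def R3 (C C' : GaussCode) : Prop :=
  ∃ (a b c : ℕ) (sa sb sc d : Bool), a ≠ b ∧ a ≠ c ∧ b ≠ c ∧
    ∃ C₁ C₂ : GaussCode,
      Exchange (d == sc) ⟨true, a, sa⟩ ⟨true, b, sb⟩ C C₁ ∧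
      Exchange (d == sb) ⟨false, a, sa⟩ ⟨true, c, sc⟩ C₁ C₂ ∧
      Exchange (d == sa) ⟨false, b, sb⟩ ⟨false, c, sc⟩ C₂ C'

/-- Virtual isotopy of links given by Gauss codes: the equivalence relation generated by the
Reidemeister moves on Gauss diagrams.  (Virtual crossings are invisible in the Gauss diagram, so
detour moves and planar isotopies do not change it.) -/
def VirtuallyIsotopic : GaussCode → GaussCode → Prop :=
  Relation.EqvGen fun C C' => Same C C' ∨ R1 C C' ∨ R2 C C' ∨ R3 C C'

/-- The Gauss code `u` of a knot is `q`-periodic: it is made of `q` blocks of the same length `m`,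
the `O`/`U` and `+`/`-` patterns repeat from block to block, and going from each letter to the
corresponding letter of the next block (cyclically) is a well-defined map `f` on the crossings. -/
def IsPeriodicWord (q : ℕ) (u : List GaussLetter) : Prop :=
  ∃ (m : ℕ) (f : ℕ → ℕ), u.length = q * m ∧ u.rotate m = u.map (relabel f)

end GaussCode

/-! ### Virtual link diagrams in the plane -/

/-- The four kinds of points of the source of a virtual link diagram. -/
inductive Mark
  | regular
  | overpass
  | underpass
  | virt

/-- `z × w`, positive if `(z, w)` is a positively oriented basis of the plane. -/
def planeCross (z w : ℂ) : ℝ := z.re * w.im - z.im * w.re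

/-- A smooth oriented virtual link diagram with `n ≥ 1` components, parametrized by circles
`ℝ / ℤ`: an immersion of the circles in the plane whose only multiple points are transverse double
points, each of which is either classical (one strand is over, the other is under) or virtual. -/
structure VirtualLinkDiagram where
  /-- the number of components -/
  n : ℕ
  n_pos : 0 < n
  /-- the components -/
  γ : Fin n → ℝ → ℂ
  /-- the crossing information -/
  mark : Fin n → ℝ → Mark
  γ_periodic : ∀ c, Function.Periodic (γ c) 1
  mark_periodic : ∀ c, Function.Periodic (mark c) 1
  smooth : ∀ c, ContDiff ℝ ∞ (γ c)
  immersion : ∀ c t, deriv (γ c) t ≠ 0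
  /-- among three points of the source with the same image, two coincide -/
  double : ∀ c₁ t₁ c₂ t₂ c₃ t₃, γ c₁ t₁ = γ c₂ t₂ → γ c₂ t₂ = γ c₃ t₃ →
    (c₁ = c₂ ∧ ∃ m : ℤ, t₂ = t₁ + m) ∨ (c₁ = c₃ ∧ ∃ m : ℤ, t₃ = t₁ + m) ∨
      (c₂ = c₃ ∧ ∃ m : ℤ, t₃ = t₂ + m)
  transverse : ∀ c t c' t', γ c t = γ c' t' → ¬ (c = c' ∧ ∃ m : ℤ, t' = t + m) →
    planeCross (deriv (γ c) t) (deriv (γ c') t') ≠ 0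
  regular_iff : ∀ c t, mark c t = Mark.regular ↔
    ∀ c' t', γ c t = γ c' t' → c = c' ∧ ∃ m : ℤ, t' = t + m
  mark_crossing : ∀ c t c' t', γ c t = γ c' t' → ¬ (c = c' ∧ ∃ m : ℤ, t' = t + m) →
    (mark c t = Mark.overpass ∧ mark c' t' = Mark.underpass) ∨
      (mark c t = Mark.underpass ∧ mark c' t' = Mark.overpass) ∨
      (mark c t = Mark.virt ∧ mark c' t' = Mark.virt)
  finite_crossings : ∀ c, {t | t ∈ Set.Ico (0 : ℝ) 1 ∧ mark c t ≠ Mark.regular}.Finite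

namespace VirtualLinkDiagram

/-- A virtual knot diagram is a virtual link diagram with one component. -/
def IsKnot (D : VirtualLinkDiagram) : Prop := D.n = 1

/-- The point `t` of the component `c` lies at a classical crossing. -/
def IsClassical (D : VirtualLinkDiagram) (c : Fin D.n) (t : ℝ) : Prop :=
  D.mark c t = Mark.overpass ∨ D.mark c t = Mark.underpass

/-- The point `t` of the component `c` lies at a positive (right-handed) crossing. -/
def IsPositive (D : VirtualLinkDiagram) (c : Fin D.n) (t : ℝ) : Prop :=
  ∃ c' t', D.γ c t = D.γ c' t' ∧
    ((D.mark c t = Mark.overpass ∧ D.mark c' t' = Mark.underpass ∧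
        0 < planeCross (deriv (D.γ c) t) (deriv (D.γ c') t')) ∨
      (D.mark c t = Mark.underpass ∧ D.mark c' t' = Mark.overpass ∧
        0 < planeCross (deriv (D.γ c') t') (deriv (D.γ c) t)))

open Classical in
/-- The letter recorded at the point `t` of the component `c`, the crossings being numbered
by `ν`. -/
noncomputable def letterAt (D : VirtualLinkDiagram) (ν : Fin D.n → ℝ → ℕ) (c : Fin D.n) (t : ℝ) :
    GaussLetter :=
  ⟨decide (D.mark c t = Mark.overpass), ν c t, decide (D.IsPositive c t)⟩

/-- `C` is a Gauss code of `D`: for some numbering `ν` of the classical crossings, some basepoint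
`b c` on each component, and some order of the components, `C` records the classical crossings in
the order `ts c` in which they are met when the component `c` is traversed once from `b c`. -/
def HasGaussCode (D : VirtualLinkDiagram) (C : GaussCode) : Prop :=
  ∃ (ν : Fin D.n → ℝ → ℕ) (b : Fin D.n → ℝ) (ts : Fin D.n → List ℝ),
    (∀ c t c' t', D.IsClassical c t → D.IsClassical c' t' →
      (ν c t = ν c' t' ↔ D.γ c t = D.γ c' t')) ∧
    (∀ c, (ts c).Pairwise (· < ·)) ∧
    (∀ c t, t ∈ ts c ↔ t ∈ Set.Ico (b c) (b c + 1) ∧ D.IsClassical c t) ∧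
    C.Perm (List.ofFn fun c => (ts c).map (D.letterAt ν c))

/-- `D` misses the origin and is invariant under the rotation of the plane by the angle `2π/q`
about the origin: after the rotation, `D` differs only by an orientation preserving diffeomorphism
of its source, given by a permutation `π` of the components and by the lifts
`φ c : ℝ → ℝ` of orientation preserving diffeomorphisms between circles. -/
def IsPeriodic (D : VirtualLinkDiagram) (q : ℕ) : Prop :=
  (∀ c t, D.γ c t ≠ 0) ∧
  ∃ (π : Equiv.Perm (Fin D.n)) (φ : Fin D.n → ℝ → ℝ),
    (∀ c, ContDiff ℝ ∞ (φ c) ∧ (∀ t, 0 < deriv (φ c) t) ∧ ∀ t, φ c (t + 1) = φ c t + 1) ∧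
    ∀ c t, D.γ (π c) (φ c t) = Complex.exp (2 * Real.pi * Complex.I / q) * D.γ c t ∧
      D.mark (π c) (φ c t) = D.mark c t

/-- `D` and `D'` are the same virtual link diagram, in the sense that they determine the same Gauss
diagram. -/
def SameGaussDiagram (D D' : VirtualLinkDiagram) : Prop :=
  ∃ C, D.HasGaussCode C ∧ D'.HasGaussCode C

/-- The Gauss code `C` represents the virtual link given by `D`. -/
def RepresentedBy (D : VirtualLinkDiagram) (C : GaussCode) : Prop :=
  ∃ C', D.HasGaussCode C' ∧ C'.VirtuallyIsotopic C

/-- `D` and `D'` are diagrams of the same virtual link. -/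
def VirtuallyIsotopic (D D' : VirtualLinkDiagram) : Prop :=
  ∃ C, D.RepresentedBy C ∧ D'.HasGaussCode C

end VirtualLinkDiagram

/-! ### Virtual braids -/

/-- The generators of the virtual braid group on `k` strands; `i : Fin (k - 1)` refers to the
strands in the positions `i` and `i + 1`, the positions being counted from `0`. -/
inductive VBGen (k : ℕ)
  | sigma (i : Fin (k - 1))
  | tau (i : Fin (k - 1))

namespace VBGen

open FreeGroup in
/-- The defining relators of the virtual braid group. -/
inductive Rel (k : ℕ) : FreeGroup (VBGen k) → Prop
  | sigma_comm (i j : Fin (k - 1)) : i.val + 1 < j.val ∨ j.val + 1 < i.val →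
      Rel k (of (sigma i) * of (sigma j) * (of (sigma j) * of (sigma i))⁻¹)
  | sigma_braid (i j : Fin (k - 1)) : i.val + 1 = j.val →
      Rel k (of (sigma i) * of (sigma j) * of (sigma i) *
        (of (sigma j) * of (sigma i) * of (sigma j))⁻¹)
  | tau_comm (i j : Fin (k - 1)) : i.val + 1 < j.val ∨ j.val + 1 < i.val →
      Rel k (of (tau i) * of (tau j) * (of (tau j) * of (tau i))⁻¹)
  | tau_braid (i j : Fin (k - 1)) : i.val + 1 = j.val →
      Rel k (of (tau i) * of (tau j) * of (tau i) * (of (tau j) * of (tau i) * of (tau j))⁻¹)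
  | tau_sq (i : Fin (k - 1)) : Rel k (of (tau i) ^ 2)
  | mixed_comm (i j : Fin (k - 1)) : i.val + 1 < j.val ∨ j.val + 1 < i.val →
      Rel k (of (sigma i) * of (tau j) * (of (tau j) * of (sigma i))⁻¹)
  | mixed_braid (i j : Fin (k - 1)) : i.val + 1 = j.val →
      Rel k (of (tau i) * of (sigma j) * of (tau i) * (of (tau j) * of (sigma i) * of (tau j))⁻¹)

/-- The index of a generator. -/
def idx {k : ℕ} : VBGen k → Fin (k - 1)
  | sigma i => i
  | tau i => i

/-- The left one of the two positions that a generator exchanges. -/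
def left {k : ℕ} (g : VBGen k) : Fin k := ⟨g.idx.val, by have := g.idx.isLt; omega⟩

/-- The right one of the two positions that a generator exchanges. -/
def right {k : ℕ} (g : VBGen k) : Fin k := ⟨g.idx.val + 1, by have := g.idx.isLt; omega⟩

/-- The effect of a generator on the positions of the strands, from top to bottom. -/
def move {k : ℕ} (g : VBGen k) : Equiv.Perm (Fin k) := Equiv.swap g.left g.right

end VBGen

/-- The virtual braid group on `k` strands. -/
abbrev VB (k : ℕ) : Type := PresentedGroup {r | VBGen.Rel k r}

/-- A virtual braid diagram with `k` strands: a word in the generators (`(g, true)` stands for `g`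
and `(g, false)` for `g⁻¹`), drawn from top to bottom. -/
abbrev BraidWord (k : ℕ) := List (VBGen k × Bool)

namespace BraidWord

/-- The virtual braid given by a word. -/
def toVB {k : ℕ} (w : BraidWord k) : VB k := PresentedGroup.mk _ (FreeGroup.mk w)

/-- The diagram made of `q` copies of `w`, stacked. -/
def power {k : ℕ} (w : BraidWord k) (q : ℕ) : BraidWord k := (List.replicate q w).flatten

/-- The position at the bottom of the strand that starts at a given position at the top. -/
def exitPerm {k : ℕ} : BraidWord k → Equiv.Perm (Fin k)
  | [] => 1
  | (g, _) :: w => exitPerm w * g.move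

/-- The letters met by the strand that enters `w` at position `p`, the crossings being numbered
consecutively from top to bottom, starting with `a`.  All strands are oriented downwards; in
`σ i` the left strand passes over the right one (a negative crossing), in `(σ i)⁻¹` the right
strand passes over the left one (a positive crossing). -/
def strandWord {k : ℕ} : BraidWord k → ℕ → Fin k → List GaussLetter
  | [], _, _ => []
  | (g, e) :: w, a, p =>
      (match g with
        | VBGen.tau _ => []
        | VBGen.sigma i =>
            if p = (VBGen.sigma i).left then [⟨e, a, !e⟩]
            else if p = (VBGen.sigma i).right then [⟨!e, a, !e⟩] else []) ++
        strandWord w (a + 1) (g.move p)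

/-- The word read along the component of the closure of `w` through the top position `p`. -/
noncomputable def componentWord {k : ℕ} (w : BraidWord k) (p : Fin k) : List GaussLetter :=
  (List.range (Function.minimalPeriod (exitPerm w) p)).flatMap
    fun j => strandWord w 0 ((exitPerm w ^ j) p)

open Classical in
/-- The Gauss code of the closure of `w`.  There is one component for each cycle of the
permutation of `w`, read from the least position in the cycle. -/
noncomputable def closureCode {k : ℕ} (w : BraidWord k) : GaussCode :=
  ((List.finRange k).filter fun p => ∀ x, (exitPerm w).SameCycle p x → p ≤ x).map (componentWord w)

end BraidWord

open GaussCode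


/-! ### Lists indexed by ranges -/

/-! The proof closes a circle: a periodic plane diagram gives a Gauss diagram with a free action of
ℤ/q, this gives the closure of a q-th power of a virtual braid, and that closure can be drawn
periodically in the plane. Periodic words enter in the middle of the circle.

Of the geometry only a `PeriodicGaussDiagram` is kept: finitely many points on circles, the
commuting permutations `next` and `turn`, and a map `sheet` to ℤ/q that `turn` raises by one and
that takes the same value at both ends of a chord. For a plane diagram, `turn` is the rotation and
the sheet is one of q sectors around the origin (`IsPeriodic.exists_braidWord`). For a periodic
word, `turn` is the shift by one block and the sheet is the block that contains the overpass of the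
crossing (`ofWord`); referring to the overpass makes the two ends of a chord agree.

Braiding is easy because virtual crossings are invisible in a Gauss code. After insertion of points
without letters, `next` raises the sheet by exactly one (`suspension`). The points of sheet 0 then
become the strands. Each chord in sheet 0 is one classical crossing, made inside a pure braid word
after virtual crossings have brought its two strands side by side; further virtual crossings produce
the permutation that leads to the next sheet. This is a word `w` for one sheet. By symmetry the
other sheets repeat it, and the closure of its q-th power reads the given words
(`exists_braidWord_of_sheet_next`, `PeriodicGaussDiagram.exists_braidWord`).

Conversely, `closureDiagram` draws the closure of the q-th power in an annulus by the exponential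
map, with time as angle and position as negative logarithm of the radius. Moving on by one copy of
`w` is the rotation by 2π/q (`isPeriodic_closureDiagram`), and the code is the expected one
(`hasGaussCode_closureDiagram`). If the closure is a knot, its word is periodic by a computation
with permutations (`isPeriodicWord_of_closureCode_power`).

The codes of one diagram form exactly one class of `Same` (`HasGaussCode.same`,
`HasGaussCode.of_same`), so diagrams can be replaced by codes throughout. The statements up to
isotopy follow because isotopy is an equivalence relation on codes that contains `Same` and
preserves the number of components. -/

theorem List.flatMap_range_mul {α : Type*} (a b : ℕ) (f : ℕ → List α) :
    (List.range (a * b)).flatMap f =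
      (List.range a).flatMap fun i => (List.range b).flatMap fun j => f (i * b + j) := by
  induction a with
  | zero => simp
  | succ a ih =>
    rw [Nat.succ_mul, List.range_add, List.flatMap_append, ih, List.range_succ,
      List.flatMap_append, List.flatMap_map]
    simp

theorem List.flatMap_range_succ {α : Type*} (a : ℕ) (f : ℕ → List α) :
    (List.range (a + 1)).flatMap f = f 0 ++ (List.range a).flatMap fun i => f (i + 1) := by
  rw [List.range_succ_eq_map, List.flatMap_cons, List.flatMap_map]

namespace GaussCode

/-- Raising all crossing numbers by `a`. -/
abbrev shiftLabel (a : ℕ) : GaussLetter → GaussLetter := relabel (· + a)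

end GaussCode


/-! ### Braid words, their stacked powers, and the letters read along strands. -/

namespace BraidWord

variable {k : ℕ}

theorem exitPerm_append (w w' : BraidWord k) :
    exitPerm (w ++ w') = exitPerm w' * exitPerm w := by
  induction w with
  | nil => simp [exitPerm]
  | cons x w ih => obtain ⟨g, e⟩ := x; simp [exitPerm, ih, mul_assoc]

theorem power_succ (w : BraidWord k) (q : ℕ) : w.power (q + 1) = w ++ w.power q := by
  simp [power, List.replicate_succ]

theorem power_zero (w : BraidWord k) : w.power 0 = [] := rfl

theorem exitPerm_power (w : BraidWord k) (q : ℕ) : exitPerm (w.power q) = exitPerm w ^ q := by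
  induction q with
  | zero => simp [power_zero, exitPerm]
  | succ q ih => rw [power_succ, exitPerm_append, ih, pow_succ]

theorem strandWord_append (w w' : BraidWord k) (a : ℕ) (p : Fin k) :
    strandWord (w ++ w') a p = strandWord w a p ++ strandWord w' (a + w.length) (exitPerm w p) := by
  induction w generalizing a p with
  | nil => simp [strandWord, exitPerm]
  | cons x w ih =>
    obtain ⟨g, e⟩ := x
    simp only [List.cons_append, strandWord, ih, exitPerm, List.append_assoc, List.length_cons,
      Equiv.Perm.mul_apply]
    rw [show a + 1 + w.length = a + (w.length + 1) by omega]

theorem strandWord_add (w : BraidWord k) (a b : ℕ) (p : Fin k) :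
    strandWord w (a + b) p = (strandWord w a p).map (shiftLabel b) := by
  induction w generalizing a p with
  | nil => rfl
  | cons x w ih =>
    obtain ⟨g, e⟩ := x
    cases g with
    | tau i => simp only [strandWord, List.nil_append, ← ih, show a + b + 1 = a + 1 + b by omega]
    | sigma i =>
      simp only [strandWord, List.map_append, ← ih, show a + b + 1 = a + 1 + b by omega]
      congr 1
      split_ifs <;> rfl

theorem strandWord_label (w : BraidWord k) (a : ℕ) (p : Fin k) :
    ∀ x ∈ strandWord w a p, a ≤ x.label ∧ x.label < a + w.length := by
  induction w generalizing a p with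
  | nil => simp [strandWord]
  | cons x w ih =>
    obtain ⟨g, e⟩ := x
    intro y hy
    rw [List.length_cons]
    cases g with
    | tau i =>
      have := ih _ _ _ (show y ∈ strandWord w (a + 1) _ from hy)
      omega
    | sigma i =>
      simp only [strandWord, List.mem_append] at hy
      rcases hy with hy | hy
      · split_ifs at hy <;> simp at hy <;> subst hy <;> simp
      · have := ih _ _ _ hy
        omega

/-- Each copy of `w` is entered where the previous one was left, and its crossings are numbered
`w.length` higher. -/
theorem strandWord_power (w : BraidWord k) (q a : ℕ) (p : Fin k) :
    strandWord (w.power q) a p =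
      (List.range q).flatMap fun j => strandWord w (a + j * w.length) ((exitPerm w ^ j) p) := by
  induction q generalizing a p with
  | zero => rfl
  | succ q ih =>
    rw [power_succ, strandWord_append, ih, List.flatMap_range_succ]
    congr 1
    · simp
    · refine List.flatMap_congr fun j _ => ?_
      rw [pow_succ, Equiv.Perm.mul_apply]
      congr 1
      ring

/-- The word read along a component of the closure of a power. -/
theorem componentWord_power (w : BraidWord k) (q : ℕ) (p : Fin k) :
    componentWord (w.power q) p =
      (List.range (Function.minimalPeriod (exitPerm w ^ q : Equiv.Perm (Fin k)) p * q)).flatMap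
        fun i => strandWord w (i % q * w.length) ((exitPerm w ^ i) p) := by
  -- The passage through copy `i` during turn `j` gets the single index `j * q + i`; the copy is
  -- recovered as its remainder modulo `q`.
  rw [List.flatMap_range_mul, componentWord, exitPerm_power]
  refine List.flatMap_congr fun j _ => ?_
  rw [strandWord_power]
  refine List.flatMap_congr fun i hi => ?_
  rw [← pow_mul, ← Equiv.Perm.mul_apply, ← pow_add, mul_comm j q, add_comm (q * j) i,
    Nat.add_mul_mod_self_left, Nat.mod_eq_of_lt (List.mem_range.1 hi), zero_add]

/-! ### Words without classical crossings, and words with a single one -/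

theorem strandWord_of_tau (w : BraidWord k) (h : ∀ x ∈ w, ∃ i, x.1 = VBGen.tau i) (a : ℕ)
    (p : Fin k) : strandWord w a p = [] := by
  induction w generalizing a p with
  | nil => rfl
  | cons x w ih =>
    obtain ⟨g, e⟩ := x
    obtain ⟨i, hi⟩ := h _ List.mem_cons_self
    dsimp only at hi
    subst hi
    rw [strandWord, ih fun y hy => h y (List.mem_cons_of_mem _ hy)]
    rfl

/-- Every permutation is realized by virtual crossings only. -/
theorem exists_virtual_word (π : Equiv.Perm (Fin k)) :
    ∃ w : BraidWord k, exitPerm w = π ∧ ∀ x ∈ w, ∃ i, x.1 = VBGen.tau i := by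
  rcases k with _ | n
  · exact ⟨[], Subsingleton.elim _ _, by simp⟩
  · have hπ : π ∈ Submonoid.closure
        (Set.range fun i : Fin n => Equiv.swap i.castSucc i.succ) := by
      rw [Equiv.Perm.mclosure_swap_castSucc_succ]; trivial
    induction hπ using Submonoid.closure_induction with
    | mem x hx =>
      obtain ⟨i, rfl⟩ := hx
      refine ⟨[(VBGen.tau i, true)], ?_, by simp⟩
      simp only [exitPerm, one_mul]
      rfl
    | one => exact ⟨[], rfl, by simp⟩
    | mul x y _ _ hx hy =>
      obtain ⟨u, rfl, hu⟩ := hx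
      obtain ⟨v, rfl, hv⟩ := hy
      refine ⟨v ++ u, exitPerm_append _ _, fun z hz => ?_⟩
      rcases List.mem_append.1 hz with h | h
      exacts [hv z h, hu z h]

theorem exists_perm_two {α : Type*} [DecidableEq α] {a b c d : α} (hab : a ≠ b) (hcd : c ≠ d) :
    ∃ P : Equiv.Perm α, P a = c ∧ P b = d := by
  refine ⟨(Equiv.swap a c).trans (Equiv.swap (Equiv.swap a c b) d), ?_, by simp⟩
  simp only [Equiv.trans_apply, Equiv.swap_apply_left]
  refine Equiv.swap_apply_of_ne_of_ne (fun h => hab ?_) hcd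
  have := congrArg (Equiv.swap a c) h
  simpa using this

/-- A pure braid word with a single classical crossing, of prescribed sign, at which a given strand
passes over another one. -/
theorem exists_crossing_word {o u : Fin k} (hou : o ≠ u) (s : Bool) :
    ∃ (w : BraidWord k) (m : ℕ), m < w.length ∧ exitPerm w = 1 ∧ ∀ a p, strandWord w a p =
      if p = o then [⟨true, a + m, s⟩] else if p = u then [⟨false, a + m, s⟩] else [] := by
  have hk : 0 < k - 1 := by
    have := o.isLt; have := u.isLt
    have : o.val ≠ u.val := fun h => hou (Fin.ext h)
    omega
  set i : Fin (k - 1) := ⟨0, hk⟩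
  have hne : (VBGen.sigma i).left ≠ (VBGen.sigma i).right := by
    intro h; have := congrArg Fin.val h; simp [VBGen.left, VBGen.right] at this
  -- In `σ` the left strand is over and the sign is negative, in `σ⁻¹` the right one is over and the
  -- sign is positive; so the sign decides on which side the over-strand must arrive.
  obtain ⟨P, hP⟩ : ∃ P : Equiv.Perm (Fin k),
      if s then P o = (VBGen.sigma i).right ∧ P u = (VBGen.sigma i).left
      else P o = (VBGen.sigma i).left ∧ P u = (VBGen.sigma i).right := by
    cases s
    · simpa using exists_perm_two hou hne
    · simpa using exists_perm_two hou hne.symm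
  obtain ⟨w₁, h₁, h₁'⟩ := exists_virtual_word P
  obtain ⟨w₂, h₂, h₂'⟩ := exists_virtual_word P⁻¹
  -- A conjugate: `w₁` makes the two strands adjacent, `τ` undoes the exchange made by `σ`, and `w₂`
  -- undoes `w₁`.
  refine ⟨w₁ ++ ([(VBGen.sigma i, !s)] ++ ((VBGen.tau i, true) :: w₂)), w₁.length, by simp, ?_, ?_⟩
  · have : (VBGen.tau i).move * (VBGen.sigma i).move = 1 := Equiv.swap_mul_self _ _
    simp only [exitPerm_append, exitPerm, h₁, h₂, one_mul]
    rw [mul_assoc P⁻¹, this]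
    simp
  · intro a p
    have h3 : ∀ x ∈ ((VBGen.tau i, true) :: w₂ : BraidWord k), ∃ i, x.1 = VBGen.tau i := by
      intro x hx
      rcases List.mem_cons.1 hx with rfl | hx
      exacts [⟨i, rfl⟩, h₂' x hx]
    rw [strandWord_append, strandWord_append, strandWord_of_tau _ h₁', strandWord_of_tau _ h3, h₁]
    simp only [strandWord, List.append_nil, List.nil_append]
    cases s
    · obtain ⟨ho, hu⟩ := hP
      simp [← ho, ← hu]
    · obtain ⟨ho, hu⟩ : _ ∧ _ := hP
      rw [← ho, ← hu]
      simp only [EmbeddingLike.apply_eq_iff_eq]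
      by_cases h1 : p = o
      · subst h1; simp [hou]
      · simp [h1]

/-- A pure braid word with prescribed classical crossings between disjoint pairs of strands. -/
theorem exists_crossings_word (I : Finset ℕ) (o u : ℕ → Fin k) (s : ℕ → Bool)
    (ho : Set.InjOn o I) (hu : Set.InjOn u I) (hou : ∀ i ∈ I, ∀ j ∈ I, o i ≠ u j) :
    ∃ (w : BraidWord k) (pos : ℕ → ℕ), (∀ i ∈ I, pos i < w.length) ∧ Set.InjOn pos I ∧
      exitPerm w = 1 ∧ ∀ a,
        (∀ i ∈ I, strandWord w a (o i) = [⟨true, a + pos i, s i⟩]) ∧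
        (∀ i ∈ I, strandWord w a (u i) = [⟨false, a + pos i, s i⟩]) ∧
        ∀ p, (∀ i ∈ I, p ≠ o i ∧ p ≠ u i) → strandWord w a p = [] := by
  classical
  induction I using Finset.induction_on with
  | empty => exact ⟨[], fun _ => 0, by simp, by simp, rfl, by simp [strandWord]⟩
  | insert i I hi ih =>
    rw [Finset.coe_insert] at ho hu
    obtain ⟨w, pos, h1, h2, h3, h4⟩ := ih (ho.mono (Set.subset_insert _ _))
      (hu.mono (Set.subset_insert _ _))
      fun x hx y hy => hou x (Finset.mem_insert_of_mem hx) y (Finset.mem_insert_of_mem hy)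
    obtain ⟨v, m, hm, hv, hw⟩ := exists_crossing_word
      (hou i (Finset.mem_insert_self _ _) i (Finset.mem_insert_self _ _)) (s i)
    have hne : ∀ j ∈ I, j ≠ i := fun j hj h => hi (h ▸ hj)
    have hoi : ∀ j ∈ I, o j ≠ o i := fun j hj h =>
      hne j hj (ho (Or.inr hj) (Or.inl rfl) h)
    have hui : ∀ j ∈ I, u j ≠ u i := fun j hj h =>
      hne j hj (hu (Or.inr hj) (Or.inl rfl) h)
    refine ⟨w ++ v, fun j => if j = i then w.length + m else pos j, ?_, ?_, ?_, ?_⟩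
    · intro j hj
      rw [List.length_append]
      rcases Finset.mem_insert.1 hj with rfl | hj
      · simpa using hm
      · have := h1 j hj
        simp only [hne j hj, if_false]; omega
    · intro x hx y hy hxy
      simp only [Finset.coe_insert, Set.mem_insert_iff, Finset.mem_coe] at hx hy
      dsimp only at hxy
      rcases hx with rfl | hx <;> rcases hy with rfl | hy
      · rfl
      · have := h1 y hy
        rw [if_pos rfl, if_neg (hne y hy)] at hxy; omega
      · have := h1 x hx
        rw [if_pos rfl, if_neg (hne x hx)] at hxy; omega
      · rw [if_neg (hne x hx), if_neg (hne y hy)] at hxy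
        exact h2 hx hy hxy
    · rw [exitPerm_append, h3, hv, one_mul]
    · intro a
      obtain ⟨h5, h6, h7⟩ := h4 a
      simp only [strandWord_append, h3, hw, Equiv.Perm.one_apply, Finset.forall_mem_insert]
      refine ⟨⟨?_, fun j hj => ?_⟩, ⟨?_, fun j hj => ?_⟩, fun p hp => ?_⟩
      · rw [h7 _ fun j hj => ⟨(hoi j hj).symm,
          hou i (Finset.mem_insert_self _ _) j (Finset.mem_insert_of_mem hj)⟩]
        simp [add_assoc]
      · rw [h5 j hj, if_neg (hoi j hj), if_neg (hou j (Finset.mem_insert_of_mem hj) i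
          (Finset.mem_insert_self _ _)), if_neg (hne j hj)]
        simp
      · rw [h7 _ fun j hj => ⟨(hou j (Finset.mem_insert_of_mem hj) i
          (Finset.mem_insert_self _ _)).symm, (hui j hj).symm⟩, if_neg (hou i
          (Finset.mem_insert_self _ _) i (Finset.mem_insert_self _ _)).symm]
        simp [add_assoc]
      · rw [h6 j hj, if_neg (hui j hj), if_neg (hou i (Finset.mem_insert_self _ _) j
          (Finset.mem_insert_of_mem hj)).symm, if_neg (hne j hj)]
        simp
      · rw [h7 p hp.2, if_neg hp.1.1, if_neg hp.1.2]
        rfl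

/-! ### Knots that are closures of powers -/

/-- The closure of `w`, if it is a knot, is read from the position `p`, and all positions lie on
it. -/
theorem closureCode_eq_singleton {w : BraidWord k} {u : List GaussLetter}
    (h : closureCode w = [u]) :
    ∃ p, u = componentWord w p ∧ ∀ x, (exitPerm w).SameCycle p x := by
  classical
  unfold closureCode at h
  obtain ⟨p, hp, rfl⟩ := List.map_eq_singleton_iff.1 h
  refine ⟨p, rfl, fun x => ?_⟩
  obtain ⟨y, hy, hmin⟩ := Finset.exists_min_image
    (Finset.univ.filter fun y => (exitPerm w).SameCycle x y) id ⟨x, by simp [Equiv.Perm.SameCycle.refl]⟩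
  simp only [Finset.mem_filter, Finset.mem_univ, true_and, id] at hy hmin
  have : y ∈ [p] := by
    rw [← hp]
    simp only [List.mem_filter, List.mem_finRange, true_and, decide_eq_true_eq]
    exact fun z hz => hmin z (hy.trans hz)
  rw [List.mem_singleton] at this
  exact this ▸ hy.symm

/-- Let π be the permutation of `w`. For a knot, π^q has a single cycle, of length m, and then π^m
fixes the starting position as well. Hence m copies of `w` further along the knot the same strand of
`w` is met again, in the copy whose index is larger by m modulo q. The knot passes through m * q
copies in all, so this is a shift by one of q blocks, and it only renumbers crossings. -/
theorem isPeriodicWord_of_closureCode_power {w : BraidWord k} {q : ℕ} (hq : 1 ≤ q)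
    {u : List GaussLetter} (h : (w.power q).closureCode = [u]) : IsPeriodicWord q u := by
  obtain ⟨p, rfl, hp⟩ := closureCode_eq_singleton h
  rw [exitPerm_power] at hp
  rw [componentWord_power]
  set π := exitPerm w with hπ
  set m := Function.minimalPeriod (π ^ q : Equiv.Perm (Fin k)) p with hm
  set L := w.length
  have hfix : (π ^ m) p = p := by
    -- On the orbit of `p`, π agrees with a power of π^q, because the two commute and π^q is
    -- transitive; so the m-th power of π fixes `p` too.
    obtain ⟨a, ha⟩ := hp (π p)
    have hc : Commute π ((π ^ q) ^ a) := ((Commute.refl π).pow_right q).zpow_right a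
    have h1 : ∀ j : ℕ, (π ^ j) p = (((π ^ q) ^ a) ^ j) p := by
      intro j
      induction j with
      | zero => rfl
      | succ j ih =>
        rw [pow_succ, Equiv.Perm.mul_apply, ← ha, ← Equiv.Perm.mul_apply,
          (hc.pow_left j).eq, Equiv.Perm.mul_apply, ih, ← Equiv.Perm.mul_apply, ← pow_succ']
    rw [h1, ← zpow_natCast, ← zpow_mul, mul_comm, zpow_mul, zpow_natCast]
    have h2 : ((π ^ q) ^ m) p = p := by
      have := Function.iterate_minimalPeriod (f := (π ^ q : Equiv.Perm (Fin k))) (x := p)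
      rwa [← Equiv.Perm.coe_pow] at this
    exact (Equiv.Perm.zpow_apply_eq_self_of_apply_eq_self h2 a)
  set B : ℕ → List GaussLetter := fun i => strandWord w (i % q * L) ((π ^ i) p) with hB
  -- A crossing number is the index of a copy times `L` plus a place inside `w`; the copy moves by
  -- `m` modulo `q`, the place stays.
  set f : ℕ → ℕ := fun x => (x / L + m) % q * L + x % L with hf
  have hBf : ∀ i, B (i + m) = (B i).map (relabel f) := by
    intro i
    have e1 : ∀ a y, strandWord w (a * L) y = (strandWord w 0 y).map (shiftLabel (a * L)) := by
      intro a y; rw [← strandWord_add, zero_add]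
    simp only [hB]
    rw [pow_add, Equiv.Perm.mul_apply, hfix, e1, e1, List.map_map]
    refine List.map_congr_left fun x hx => ?_
    have hx' := (strandWord_label w 0 _ x hx).2
    rw [zero_add] at hx'
    simp only [shiftLabel, Function.comp, relabel, hf, GaussLetter.mk.injEq, true_and, and_true]
    rw [Nat.add_mul_div_right _ _ (by omega), Nat.div_eq_of_lt hx', Nat.add_mul_mod_self_right,
      Nat.mod_eq_of_lt hx', zero_add, Nat.mod_add_mod, add_comm]
  have hBq : ∀ i, B (i + q * m) = B i := by
    intro i
    simp only [hB]
    rw [Nat.add_mul_mod_self_left, pow_add, Equiv.Perm.mul_apply, mul_comm q m, pow_mul,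
      Equiv.Perm.pow_apply_eq_self_of_apply_eq_self hfix]
  obtain ⟨q, rfl⟩ : ∃ r, q = r + 1 := ⟨q - 1, by omega⟩
  set c : ℕ → List GaussLetter := fun i => (List.range m).flatMap fun j => B (i * m + j) with hc
  have hcf : ∀ i, c (i + 1) = (c i).map (relabel f) := by
    intro i
    simp only [hc, List.map_flatMap]
    refine List.flatMap_congr fun j _ => ?_
    rw [← hBf]; congr 1; ring
  have hcq : c (q + 1) = c 0 := by
    simp only [hc]
    refine List.flatMap_congr fun j _ => ?_
    rw [← hBq (0 * m + j)]; congr 1; ring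
  have hlen : ∀ i, (c i).length = (c 0).length := by
    intro i
    induction i with
    | zero => rfl
    | succ i ih => rw [hcf, List.length_map, ih]
  refine ⟨(c 0).length, f, ?_, ?_⟩
  · rw [mul_comm m, List.flatMap_range_mul, List.length_flatMap]
    rw [show (List.map (fun a => (c a).length) (List.range (q + 1))) =
      List.map (fun _ => (c 0).length) (List.range (q + 1)) from
      List.map_congr_left fun i _ => hlen i]
    simp
  · rw [mul_comm m, List.flatMap_range_mul]
    change ((List.range (q + 1)).flatMap c).rotate _ = List.map _ ((List.range (q + 1)).flatMap c)
    rw [List.map_flatMap, List.flatMap_range_succ, List.rotate_append_length_eq, List.range_succ,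
      List.flatMap_append]
    rw [← List.flatMap_congr fun i _ => hcf i, List.flatMap_singleton, ← hcf, hcq]

end BraidWord

/-! ### Gauss codes: renumbering and rearrangement -/

/-- An injective map on a finite set extends to a permutation. -/
theorem exists_perm_eqOn {α : Type*} {s : Set α} (hs : s.Finite) {f : α → α} (hf : Set.InjOn f s) :
    ∃ σ : Equiv.Perm α, Set.EqOn σ f s := by
  have := hs.to_subtype
  obtain ⟨σ, hσ⟩ := Equiv.Perm.exists_smul_eq_embedding
    (Function.Embedding.subtype (· ∈ s)) ⟨fun x : s => f x, fun x y h => Subtype.ext (hf x.2 y.2 h)⟩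
  exact ⟨σ, fun x hx => DFunLike.congr_fun hσ ⟨x, hx⟩⟩

namespace GaussCode

theorem Rearranged.length_eq {C C' : GaussCode} (h : Rearranged C C') : C.length = C'.length := by
  obtain ⟨C₁, h1, h2⟩ := h
  rw [h1.length_eq, h2.length_eq]

theorem Same.length_eq {C C' : GaussCode} (h : Same C C') : C.length = C'.length := by
  obtain ⟨f, h⟩ := h
  simpa using h.length_eq

theorem Exchange.length_eq {d x y} {C C' : GaussCode} (h : Exchange d x y C C') :
    C.length = C'.length := by
  obtain ⟨u, B, h1, h2⟩ := h
  rw [h1.length_eq, h2.length_eq]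
  rfl

/-- Every move acts inside existing components. The invariance shows that a code isotopic to that of
a knot has one word, and that a closure representing a link is not empty. -/
theorem VirtuallyIsotopic.length_eq {C C' : GaussCode} (h : VirtuallyIsotopic C C') :
    C.length = C'.length := by
  induction h with
  | rel C C' h =>
    rcases h with h | h | h | h
    · exact h.length_eq
    · cases h; rfl
    · cases h <;> rfl
    · obtain ⟨_, _, _, _, _, _, _, _, _, _, _, _, h1, h2, h3⟩ := h
      rw [h1.length_eq, h2.length_eq, h3.length_eq]
  | refl => rfl
  | symm _ _ _ ih => exact ih.symm
  | trans _ _ _ _ _ h1 h2 => exact h1.trans h2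

theorem forall₂_isRotated_refl (C : GaussCode) : List.Forall₂ List.IsRotated C C :=
  List.forall₂_same.2 fun _ _ => List.IsRotated.refl _

theorem Rearranged.of_perm {C C' : GaussCode} (h : C.Perm C') : Rearranged C C' :=
  ⟨C, forall₂_isRotated_refl C, h⟩

theorem forall₂_isRotated_trans {C C' C'' : GaussCode} (h : List.Forall₂ List.IsRotated C C')
    (h' : List.Forall₂ List.IsRotated C' C'') : List.Forall₂ List.IsRotated C C'' := by
  induction h generalizing C'' with
  | nil => exact h'
  | cons h _ ih => cases h' with | cons h1 h2 => exact .cons (h.trans h1) (ih h2)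

theorem Rearranged.trans {C C' C'' : GaussCode} (h : Rearranged C C') (h' : Rearranged C' C'') :
    Rearranged C C'' := by
  obtain ⟨C₁, h1, h2⟩ := h
  obtain ⟨C₂, h3, h4⟩ := h'
  obtain ⟨C₃, h5, h6⟩ := List.perm_comp_forall₂ h2 h3
  exact ⟨C₃, forall₂_isRotated_trans h1 h5, h6.trans h4⟩

end GaussCode

/-! ### Points on a circle, listed from a basepoint -/

/-- `l` lists the elements of `S` in `[b, b + 1)` in increasing order. -/
def ListsFrom (S : Set ℝ) (b : ℝ) (l : List ℝ) : Prop :=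
  l.Pairwise (· < ·) ∧ ∀ t, t ∈ l ↔ t ∈ Set.Ico b (b + 1) ∧ t ∈ S

namespace ListsFrom

variable {S : Set ℝ} {b b' : ℝ} {l l' : List ℝ} {α : Type*} {g : ℝ → α}

theorem mem_add_int (hS : ∀ t, t + 1 ∈ S ↔ t ∈ S) (n : ℤ) (t : ℝ) : t + n ∈ S ↔ t ∈ S := by
  induction n using Int.induction_on generalizing t with
  | zero => simp
  | succ n ih => rw [← ih t, ← hS (t + (n : ℤ))]; push_cast; rw [add_assoc]
  | pred n ih =>
    rw [← ih t, ← hS (t + _)]; push_cast; rw [show t + (-(n : ℝ) - 1) + 1 = t + -n by ring]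

theorem apply_add_int (hS : ∀ t, t + 1 ∈ S ↔ t ∈ S) (hg : ∀ t ∈ S, g (t + 1) = g t) (n : ℤ) (t : ℝ)
    (ht : t ∈ S) : g (t + n) = g t := by
  induction n using Int.induction_on generalizing t with
  | zero => simp
  | succ n ih =>
    rw [← ih t ht, ← hg (t + (n : ℤ)) ((mem_add_int hS _ _).2 ht)]; push_cast; rw [add_assoc]
  | pred n ih =>
    rw [← ih t ht, ← hg (t + ((-(n : ℤ) - 1 : ℤ) : ℝ)) ((mem_add_int hS _ _).2 ht)]; push_cast
    rw [show t + (-(n : ℝ) - 1) + 1 = t + -n by ring]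

theorem shift (hS : ∀ t, t + 1 ∈ S ↔ t ∈ S) (h : ListsFrom S b l) (n : ℤ) :
    ListsFrom S (b + n) (l.map (· + (n : ℝ))) := by
  refine ⟨?_, fun t => ?_⟩
  · rw [List.pairwise_map]
    exact h.1.imp fun h => by linarith
  · simp only [List.mem_map, h.2, Set.mem_Ico]
    constructor
    · rintro ⟨s, ⟨⟨h1, h2⟩, h3⟩, rfl⟩
      exact ⟨⟨by linarith, by linarith⟩, (mem_add_int hS _ _).2 h3⟩
    · rintro ⟨⟨h1, h2⟩, h3⟩
      refine ⟨t - n, ⟨⟨by linarith, by linarith⟩, ?_⟩, by ring⟩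
      rw [← mem_add_int hS n]
      simpa using h3

/-- The points of `[b, b')` reappear, translated by 1, at the end of the list from `b'`; the others
keep their places. -/
theorem isRotated_aux (hS : ∀ t, t + 1 ∈ S ↔ t ∈ S) (hg : ∀ t ∈ S, g (t + 1) = g t)
    (h : ListsFrom S b l) (h' : ListsFrom S b' l') (h1 : b ≤ b') (h2 : b' < b + 1) :
    l.map g ~r l'.map g := by
  classical
  set A := l.filter (· < b')
  set B := l.filter (b' ≤ ·)
  have hl : l = A ++ B := by
    refine h.1.eq_of_mem_iff ?_ fun t => ?_
    · rw [List.pairwise_append]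
      refine ⟨h.1.filter _, h.1.filter _, fun x hx y hy => ?_⟩
      simp only [A, B, List.mem_filter, decide_eq_true_eq] at hx hy
      linarith
    · simp only [A, B, List.mem_append, List.mem_filter, decide_eq_true_eq, ← and_or_left]
      simp [lt_or_ge]
  have hl' : l' = B ++ A.map (· + 1) := by
    refine h'.1.eq_of_mem_iff ?_ fun t => ?_
    · rw [List.pairwise_append, List.pairwise_map]
      refine ⟨h.1.filter _, (h.1.filter _).imp fun h => by linarith, fun x hx y hy => ?_⟩
      simp only [List.mem_map] at hy
      obtain ⟨y, hy, rfl⟩ := hy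
      simp only [A, B, List.mem_filter, decide_eq_true_eq, h.2, Set.mem_Ico] at hx hy
      linarith
    · simp only [A, B, List.mem_append, List.mem_map, List.mem_filter, decide_eq_true_eq, h.2, h'.2,
        Set.mem_Ico]
      constructor
      · rintro ⟨⟨h3, h4⟩, h5⟩
        by_cases h6 : t < b + 1
        · exact Or.inl ⟨⟨⟨by linarith, h6⟩, h5⟩, h3⟩
        · refine Or.inr ⟨t - 1, ⟨⟨⟨by linarith, by linarith⟩, ?_⟩, by linarith⟩, by ring⟩
          rw [← hS]; simpa using h5
      · rintro (⟨⟨⟨h3, h4⟩, h5⟩, h6⟩ | ⟨s, ⟨⟨⟨h3, h4⟩, h5⟩, h6⟩, rfl⟩)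
        · exact ⟨⟨h6, by linarith⟩, h5⟩
        · exact ⟨⟨by linarith, by linarith⟩, (hS s).2 h5⟩
  have hA : (A.map (· + 1)).map g = A.map g := by
    rw [List.map_map]
    refine List.map_congr_left fun t ht => hg t ?_
    exact ((h.2 t).1 (List.mem_of_mem_filter ht)).2
  rw [hl, hl', List.map_append, List.map_append, hA]
  exact List.isRotated_append

theorem isRotated (hS : ∀ t, t + 1 ∈ S ↔ t ∈ S) (hg : ∀ t ∈ S, g (t + 1) = g t)
    (h : ListsFrom S b l) (h' : ListsFrom S b' l') : l.map g ~r l'.map g := by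
  have h'' := h'.shift hS (-⌊b' - b⌋)
  have : (l'.map (· + ((-⌊b' - b⌋ : ℤ) : ℝ))).map g = l'.map g := by
    rw [List.map_map]
    exact List.map_congr_left fun t ht => apply_add_int hS hg _ t ((h'.2 t).1 ht).2
  rw [← this]
  have h1 := Int.floor_le (b' - b)
  have h2 := Int.lt_floor_add_one (b' - b)
  exact isRotated_aux hS hg h h'' (by push_cast; linarith) (by push_cast; linarith)

/-- Moving the basepoint just past the first listed point rotates the word by one letter. -/
theorem exists_rotate (hS : ∀ t, t + 1 ∈ S ↔ t ∈ S) (hg : ∀ t ∈ S, g (t + 1) = g t)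
    (h : ListsFrom S b l) (n : ℕ) :
    ∃ b' l', ListsFrom S b' l' ∧ l'.map g = (l.map g).rotate n := by
  induction n with
  | zero => exact ⟨b, l, h, by simp⟩
  | succ n ih =>
    obtain ⟨b, l, h, hl⟩ := ih
    rw [← List.rotate_rotate, ← hl]
    rcases l with _ | ⟨x, l⟩
    · exact ⟨b, [], h, by simp⟩
    have hx := (h.2 x).1 List.mem_cons_self
    have hp := List.pairwise_cons.1 h.1
    -- The new basepoint is the second listed point, or `x + 1` if `x` is the only one; the window
    -- is half open, so a basepoint may itself be listed.
    obtain ⟨c, hc1, hc2, hc3⟩ : ∃ c, x < c ∧ (∀ y ∈ l, c ≤ y) ∧ c ≤ x + 1 := by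
      rcases l with _ | ⟨y, l⟩
      · exact ⟨x + 1, by linarith, by simp, le_rfl⟩
      · have hy := ((h.2 y).1 (by simp)).1.2
        refine ⟨y, hp.1 y (by simp), ?_, by linarith [hx.1.1]⟩
        intro z hz
        rcases List.mem_cons.1 hz with rfl | hz
        · exact le_rfl
        · exact ((List.pairwise_cons.1 hp.2).1 z hz).le
    refine ⟨c, l ++ [x + 1], ⟨?_, fun t => ?_⟩, ?_⟩
    · rw [List.pairwise_append]
      refine ⟨hp.2, by simp, fun y hy z hz => ?_⟩
      rw [List.mem_singleton.1 hz]
      linarith [hx.1.1, ((h.2 y).1 (List.mem_cons_of_mem _ hy)).1.2]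
    · rw [List.mem_append, List.mem_singleton, Set.mem_Ico]
      constructor
      · rintro (ht | rfl)
        · have := (h.2 t).1 (List.mem_cons_of_mem _ ht)
          exact ⟨⟨hc2 t ht, by linarith [hx.1.1, this.1.2]⟩, this.2⟩
        · exact ⟨⟨hc3, by linarith⟩, (hS x).2 hx.2⟩
      · rintro ⟨⟨h1, h2⟩, h3⟩
        by_cases h4 : t < b + 1
        · have := (h.2 t).2 ⟨⟨by linarith [hx.1.1], h4⟩, h3⟩
          rcases List.mem_cons.1 this with rfl | h5
          · linarith
          · exact Or.inl h5
        · have h6 : t - 1 ∈ S := by rw [← hS]; simpa using h3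
          have h7 : t - 1 < b + 1 := by
            by_contra h7
            have := (h.2 (t - 1 - 1)).2 ⟨⟨by linarith, by linarith [hx.1.2]⟩,
              by rw [← hS]; simpa using h6⟩
            rcases List.mem_cons.1 this with h5 | h5
            · linarith
            · linarith [hp.1 _ h5]
          have := (h.2 (t - 1)).2 ⟨⟨by linarith, h7⟩, h6⟩
          rcases List.mem_cons.1 this with h5 | h5
          · right; linarith
          · have := hc2 _ h5; linarith
    · simp only [List.map_append, List.map_cons, List.map_nil, List.rotate_cons_succ,
        List.rotate_zero, hg x hx.2]

end ListsFrom

/-! ### Gauss codes of diagrams -/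

namespace VirtualLinkDiagram

variable (D : VirtualLinkDiagram)

/-- `ν` numbers the classical crossings. -/
def IsNumbering (ν : Fin D.n → ℝ → ℕ) : Prop :=
  ∀ c t c' t', D.IsClassical c t → D.IsClassical c' t' → (ν c t = ν c' t' ↔ D.γ c t = D.γ c' t')

variable {D}

theorem hasGaussCode_iff {C : GaussCode} : D.HasGaussCode C ↔
    ∃ (ν : Fin D.n → ℝ → ℕ) (b : Fin D.n → ℝ) (ts : Fin D.n → List ℝ), D.IsNumbering ν ∧
      (∀ c, ListsFrom {t | D.IsClassical c t} (b c) (ts c)) ∧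
      C.Perm (List.ofFn fun c => (ts c).map (D.letterAt ν c)) := by
  simp only [HasGaussCode, IsNumbering, ListsFrom, forall_and, and_assoc, Set.mem_ofPred_eq]

theorem isClassical_add_one (c : Fin D.n) (t : ℝ) :
    D.IsClassical c (t + 1) ↔ D.IsClassical c t := by
  simp only [IsClassical, D.mark_periodic c t]

theorem deriv_add_one (c : Fin D.n) (t : ℝ) : deriv (D.γ c) (t + 1) = deriv (D.γ c) t := by
  rw [← deriv_comp_add_const (D.γ c) 1 t]
  congr 1
  ext s
  exact D.γ_periodic c s

theorem isPositive_add_one (c : Fin D.n) (t : ℝ) :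
    D.IsPositive c (t + 1) ↔ D.IsPositive c t := by
  simp only [IsPositive, D.mark_periodic c t, D.γ_periodic c t, deriv_add_one]

theorem letterAt_add_one {ν : Fin D.n → ℝ → ℕ} (hν : D.IsNumbering ν) (c : Fin D.n) (t : ℝ)
    (ht : D.IsClassical c t) : D.letterAt ν c (t + 1) = D.letterAt ν c t := by
  simp only [letterAt, GaussLetter.mk.injEq, decide_eq_decide, D.mark_periodic c t,
    isPositive_add_one, true_and, and_true]
  exact (hν c (t + 1) c t ((isClassical_add_one c t).2 ht) ht).2 (D.γ_periodic c t)

/-- A rotation of a word is realized by another basepoint, and the order of the components is free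
in the definition of a Gauss code. -/
theorem HasGaussCode.of_rearranged {C C' : GaussCode} (h : D.HasGaussCode C)
    (h' : Rearranged C C') : D.HasGaussCode C' := by
  rw [hasGaussCode_iff] at h ⊢
  obtain ⟨ν, b, ts, h1, h2, h3⟩ := h
  obtain ⟨C₁, h4, h5⟩ := h'
  obtain ⟨C₂, h6, h7⟩ := List.perm_comp_forall₂ h3.symm h4
  have hlen : C₂.length = D.n := by rw [← h6.length_eq, List.length_ofFn]
  have key : ∀ c : Fin D.n, ∃ b' l', ListsFrom {t | D.IsClassical c t} b' l' ∧
      l'.map (D.letterAt ν c) = C₂[c.val]'(by rw [hlen]; exact c.isLt) := by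
    intro c
    have h8 := List.Forall₂.get h6 (i := c.val) (by simp) (by rw [hlen]; exact c.isLt)
    simp only [List.get_eq_getElem, List.getElem_ofFn] at h8
    obtain ⟨n, hn⟩ := h8
    obtain ⟨b', l', h9, h10⟩ := (h2 c).exists_rotate (isClassical_add_one c)
      (fun t ht => letterAt_add_one h1 c t ht) n
    exact ⟨b', l', h9, h10.trans hn⟩
  choose b' l' h8 h9 using key
  refine ⟨ν, b', l', h1, h8, ?_⟩
  have : C₂ = List.ofFn fun c => (l' c).map (D.letterAt ν c) := by
    apply List.ext_getElem
    · simp [hlen]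
    · intro i hi hi'
      simp [h9]
  exact this ▸ (h7.trans h5).symm

theorem HasGaussCode.relabel {C : GaussCode} (h : D.HasGaussCode C) {f : ℕ → ℕ}
    (hf : f.Injective) : D.HasGaussCode (C.map (List.map (relabel f))) := by
  rw [hasGaussCode_iff] at h ⊢
  obtain ⟨ν, b, ts, h1, h2, h3⟩ := h
  refine ⟨fun c t => f (ν c t), b, ts, fun c t c' t' hc hc' => ?_, h2, ?_⟩
  · rw [hf.eq_iff]; exact h1 c t c' t' hc hc'
  · refine (h3.map _).trans ?_
    rw [List.map_ofFn]
    simp only [Function.comp_def, List.map_map]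
    rfl

theorem HasGaussCode.of_same {C C' : GaussCode} (h : D.HasGaussCode C) (h' : Same C C') :
    D.HasGaussCode C' := by
  obtain ⟨f, hf⟩ := h'
  exact (h.relabel f.injective).of_rearranged hf

theorem HasGaussCode.length_eq {C : GaussCode} (h : D.HasGaussCode C) : C.length = D.n := by
  obtain ⟨ν, b, ts, -, -, -, h⟩ := h
  simpa using h.length_eq

/-- Two numberings separate the same crossings, so one is an injective function of the other on the
finitely many numbers in use, and this function extends to a permutation of ℕ. Different basepoints
only rotate the words. -/
theorem HasGaussCode.same {C C' : GaussCode} (h : D.HasGaussCode C) (h' : D.HasGaussCode C') :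
    Same C C' := by
  classical
  rw [hasGaussCode_iff] at h h'
  obtain ⟨ν, b, ts, h1, h2, h3⟩ := h
  obtain ⟨ν', b', ts', h1', h2', h3'⟩ := h'
  set s : Set ℕ := {i | ∃ c t, t ∈ ts c ∧ ν c t = i} with hs
  have hfin : s.Finite := by
    have : s ⊆ ⋃ c, (ν c) '' {t | t ∈ ts c} := by
      rintro i ⟨c, t, ht, rfl⟩
      exact Set.mem_iUnion.2 ⟨c, t, ht, rfl⟩
    exact (Set.finite_iUnion fun c => (List.finite_toSet _).image _).subset this
  have : Nonempty (Fin D.n) := ⟨⟨0, D.n_pos⟩⟩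
  choose! cc tt htt hcc using fun i (hi : i ∈ s) => hi
  have hcl : ∀ c, ∀ t ∈ ts c, D.IsClassical c t := fun c t ht => (((h2 c).2 t).1 ht).2
  obtain ⟨σ, hσ⟩ := exists_perm_eqOn hfin (f := fun i => ν' (cc i) (tt i)) (by
    intro i hi j hj hij
    dsimp only at hij
    rw [h1' _ _ _ _ (hcl _ _ (htt i hi)) (hcl _ _ (htt j hj)),
      ← h1 _ _ _ _ (hcl _ _ (htt i hi)) (hcl _ _ (htt j hj)), hcc i hi, hcc j hj] at hij
    exact hij)
  have hσν : ∀ c, ∀ t ∈ ts c, σ (ν c t) = ν' c t := by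
    intro c t ht
    have hi : ν c t ∈ s := ⟨c, t, ht, rfl⟩
    rw [hσ hi]
    dsimp only
    rw [h1' _ _ _ _ (hcl _ _ (htt _ hi)) (hcl _ _ ht), ← h1 _ _ _ _ (hcl _ _ (htt _ hi))
      (hcl _ _ ht), hcc _ hi]
  refine ⟨σ, ((Rearranged.of_perm (h3.map _)).trans ⟨_, ?_, h3'.symm⟩)⟩
  rw [List.map_ofFn, List.forall₂_iff_get]
  refine ⟨by simp, fun i hi hi' => ?_⟩
  simp only [List.get_eq_getElem, List.getElem_ofFn, Function.comp, List.map_map]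
  set c : Fin D.n := ⟨i, by simpa using hi⟩
  have : (ts c).map (GaussCode.relabel σ ∘ D.letterAt ν c) = (ts c).map (D.letterAt ν' c) :=
    List.map_congr_left fun t ht => by
      simp only [Function.comp, GaussCode.relabel, letterAt, hσν c t ht]
  rw [this]
  exact (h2 c).isRotated (isClassical_add_one c) (fun t ht => letterAt_add_one h1' c t ht) (h2' c)

end VirtualLinkDiagram

/-! ### The two source points of a classical crossing, and validity of the codes of diagrams. -/

namespace VirtualLinkDiagram

variable {D : VirtualLinkDiagram}

theorem γ_add_int (c : Fin D.n) (t : ℝ) (m : ℤ) : D.γ c (t + m) = D.γ c t := by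
  simpa using (D.γ_periodic c).int_mul m t

theorem mark_add_int (c : Fin D.n) (t : ℝ) (m : ℤ) : D.mark c (t + m) = D.mark c t := by
  simpa using (D.mark_periodic c).int_mul m t

theorem isClassical_add_int (c : Fin D.n) (t : ℝ) (m : ℤ) :
    D.IsClassical c (t + m) ↔ D.IsClassical c t := by
  simp only [IsClassical, mark_add_int]

/-- A classical point has a partner on the other strand of the crossing. -/
theorem IsClassical.exists_partner {c : Fin D.n} {t : ℝ} (h : D.IsClassical c t) :
    ∃ c' t', D.γ c t = D.γ c' t' ∧ ¬ (c = c' ∧ ∃ m : ℤ, t' = t + m) ∧ D.IsClassical c' t' ∧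
      ((D.mark c t = Mark.overpass ∧ D.mark c' t' = Mark.underpass) ∨
        (D.mark c t = Mark.underpass ∧ D.mark c' t' = Mark.overpass)) := by
  have hr : ¬ D.mark c t = Mark.regular := by
    intro h'; rcases h with h | h <;> rw [h] at h' <;> cases h'
  rw [D.regular_iff] at hr
  push Not at hr
  obtain ⟨c', t', h1, h2⟩ := hr
  have h2' : ¬ (c = c' ∧ ∃ m : ℤ, t' = t + m) := by
    rintro ⟨h3, m, hm⟩; exact h2 h3 m hm
  refine ⟨c', t', h1, h2', ?_⟩
  rcases D.mark_crossing c t c' t' h1 h2' with h3 | h3 | h3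
  · exact ⟨Or.inr h3.2, Or.inl h3⟩
  · exact ⟨Or.inl h3.2, Or.inr h3⟩
  · rcases h with h | h <;> rw [h] at h3 <;> cases h3.1

/-- Points at the same crossing with the same mark, not virtual, coincide. -/
theorem eq_of_mark_eq {c c' : Fin D.n} {t t' : ℝ} (h : D.γ c t = D.γ c' t')
    (hm : D.mark c t = D.mark c' t') (hv : D.mark c t ≠ Mark.virt) :
    c = c' ∧ ∃ m : ℤ, t' = t + m := by
  by_contra hne
  rcases D.mark_crossing c t c' t' h hne with h3 | h3 | h3
  · rw [h3.1, h3.2] at hm; cases hm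
  · rw [h3.1, h3.2] at hm; cases hm
  · exact hv h3.1

/-- Since there are no triple points, the point that witnesses positivity is the given partner up to
a period, and the condition is symmetric in the two strands. -/
theorem isPositive_of_partner {c c' : Fin D.n} {t t' : ℝ} (h : D.γ c t = D.γ c' t')
    (hp : D.IsPositive c t)
    (hne : ¬ (c = c' ∧ ∃ m : ℤ, t' = t + m)) : D.IsPositive c' t' := by
  obtain ⟨c₂, t₂, h1, h2⟩ := hp
  have hne₂ : ¬ (c = c₂ ∧ ∃ m : ℤ, t₂ = t + m) := by
    rintro ⟨rfl, m, rfl⟩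
    rw [mark_add_int] at h2
    rcases h2 with h2 | h2 <;> · have := h2.1.symm.trans h2.2.1; cases this
  obtain ⟨rfl, m, rfl⟩ : c' = c₂ ∧ ∃ m : ℤ, t₂ = t' + m := by
    rcases D.double c t c' t' c₂ t₂ h (h.symm.trans h1) with h3 | h3 | h3
    exacts [(hne h3).elim, (hne₂ h3).elim, h3]
  have hd : deriv (D.γ c') (t' + m) = deriv (D.γ c') t' := by
    rw [← deriv_comp_add_const (D.γ c') (m : ℝ) t']
    congr 1
    ext s
    exact γ_add_int c' s m
  rw [mark_add_int, hd] at h2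
  refine ⟨c, t, h.symm, ?_⟩
  rcases h2 with ⟨h3, h4, h5⟩ | ⟨h3, h4, h5⟩
  · exact Or.inr ⟨h4, h3, h5⟩
  · exact Or.inl ⟨h4, h3, h5⟩

/-- The two letters of a classical crossing. -/
theorem letterAt_partner {ν : Fin D.n → ℝ → ℕ} (hν : D.IsNumbering ν) {c c' : Fin D.n} {t t' : ℝ}
    (h : D.γ c t = D.γ c' t') (hcl : D.IsClassical c t) (hcl' : D.IsClassical c' t')
    (hne : ¬ (c = c' ∧ ∃ m : ℤ, t' = t + m)) :
    D.letterAt ν c' t' = ⟨!(D.letterAt ν c t).isOver, (D.letterAt ν c t).label,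
      (D.letterAt ν c t).pos⟩ := by
  have hne' : ¬ (c' = c ∧ ∃ m : ℤ, t = t' + m) := by
    rintro ⟨h1, m, h2⟩
    exact hne ⟨h1.symm, -m, by rw [h2]; push_cast; ring⟩
  simp only [letterAt, GaussLetter.mk.injEq]
  refine ⟨?_, (hν _ _ _ _ hcl' hcl).2 h.symm, decide_eq_decide.2
    ⟨fun hp => isPositive_of_partner h.symm hp hne',
      fun hp => isPositive_of_partner h hp hne⟩⟩
  rcases D.mark_crossing c t c' t' h hne with h3 | h3 | h3
  · simp [h3.1, h3.2]
  · simp [h3.1, h3.2]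
  · rcases hcl with h | h <;> rw [h] at h3 <;> cases h3.1

/-- The letters with a given number come from the listed source points over one double point. There
are exactly two of these, one over and one under, with a common sign. -/
theorem HasGaussCode.valid {C : GaussCode} (h : D.HasGaussCode C) : C.Valid := by
  classical
  rw [hasGaussCode_iff] at h
  obtain ⟨ν, b, ts, hν, hts, hC⟩ := h
  set f : Fin D.n × ℝ → GaussLetter := fun x => D.letterAt ν x.1 x.2 with hf
  set pts : List (Fin D.n × ℝ) := (List.finRange D.n).flatMap fun c => (ts c).map (c, ·) with hpts
  have hmem : ∀ c t, (c, t) ∈ pts ↔ t ∈ ts c := by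
    intro c t
    simp [hpts]
  have hnd : pts.Nodup := by
    rw [hpts, List.nodup_flatMap]
    refine ⟨fun c _ => ((hts c).1.nodup).map fun x y h => (Prod.ext_iff.1 h).2, ?_⟩
    refine (List.nodup_finRange _).pairwise_of_forall_ne fun c _ c' _ hne => ?_
    rw [Function.onFun, List.disjoint_left]
    simp only [List.mem_map]
    rintro _ ⟨t, _, rfl⟩ ⟨t', _, h⟩
    exact hne (Prod.ext_iff.1 h).1.symm
  have hflat : C.flatten.Perm (pts.map f) := by
    refine hC.flatten.trans (List.Perm.of_eq ?_)
    rw [List.ofFn_eq_map, hpts, List.map_flatMap, List.flatMap_def]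
    simp [List.map_map, Function.comp_def, hf]
  have hcl : ∀ c, ∀ t ∈ ts c, D.IsClassical c t := fun c t ht => (((hts c).2 t).1 ht).2
  -- two points of the list at the same place of the source coincide
  have huniq : ∀ c, ∀ t ∈ ts c, ∀ t' ∈ ts c, ∀ m : ℤ, t' = t + m → t' = t := by
    intro c t ht t' ht' m hm
    have h1 := (((hts c).2 t).1 ht).1
    have h2 := (((hts c).2 t').1 ht').1
    simp only [Set.mem_Ico] at h1 h2
    have h3 : (m : ℝ) < 1 := by linarith
    have h4 : (-1 : ℝ) < m := by linarith
    have : m = 0 := by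
      have : m < 1 := by exact_mod_cast h3
      have : -1 < m := by exact_mod_cast h4
      omega
    simp [hm, this]
  intro x hx
  rw [hflat.mem_iff, List.mem_map] at hx
  obtain ⟨⟨c, t⟩, ht, rfl⟩ := hx
  rw [hmem] at ht
  obtain ⟨c', t₁, h1, h2, h3, -⟩ := (hcl c t ht).exists_partner
  -- The partner is translated by an integer into the window that starts at the basepoint of its
  -- component.
  obtain ⟨m, t', htt', ht'⟩ : ∃ (m : ℤ) (t' : ℝ), t' = t₁ + m ∧ t' ∈ ts c' := by
    refine ⟨-⌊t₁ - b c'⌋, _, rfl, ((hts c').2 _).2 ⟨⟨?_, ?_⟩, (isClassical_add_int _ _ _).2 h3⟩⟩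
    · have := Int.floor_le (t₁ - b c'); push_cast; linarith
    · have := Int.lt_floor_add_one (t₁ - b c'); push_cast; linarith
  have hγ : D.γ c t = D.γ c' t' := by rw [h1, htt', γ_add_int]
  have hne : ¬ (c = c' ∧ ∃ m : ℤ, t' = t + m) := by
    rintro ⟨h4, n, h5⟩
    exact h2 ⟨h4, n - m, by push_cast; linarith⟩
  have hl := letterAt_partner hν hγ (hcl c t ht) (hcl c' t' ht') hne
  have hmemp : ∀ y, y ∈ pts.filter (fun y => (f y).label = (f (c, t)).label) ↔
      y ∈ [(c, t), (c', t')] := by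
    rintro ⟨c₂, t₂⟩
    simp only [List.mem_filter, hmem, decide_eq_true_eq, List.mem_cons, List.not_mem_nil, or_false,
      Prod.mk.injEq]
    constructor
    · rintro ⟨h4, h5⟩
      have h6 : D.γ c₂ t₂ = D.γ c t := (hν _ _ _ _ (hcl _ _ h4) (hcl _ _ ht)).1 h5
      rcases D.double c t c' t' c₂ t₂ hγ (hγ.symm.trans h6.symm) with h7 | ⟨rfl, m, h7⟩ |
        ⟨rfl, m, h7⟩
      · exact (hne h7).elim
      · exact Or.inl ⟨rfl, huniq _ _ ht _ h4 m h7⟩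
      · exact Or.inr ⟨rfl, huniq _ _ ht' _ h4 m h7⟩
    · rintro (⟨rfl, rfl⟩ | ⟨rfl, rfl⟩)
      · exact ⟨ht, rfl⟩
      · exact ⟨ht', by rw [show f (c₂, t₂) = _ from hl]⟩
  have hperm : (pts.filter (fun y => (f y).label = (f (c, t)).label)).Perm [(c, t), (c', t')] := by
    refine (List.perm_ext_iff_of_nodup (hnd.filter _) ?_).2 hmemp
    rw [List.nodup_cons, List.mem_singleton, Prod.mk.injEq]
    refine ⟨?_, by simp⟩
    rintro ⟨rfl, rfl⟩
    exact hne ⟨rfl, 0, by simp⟩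
  refine ⟨(f (c, t)).pos, ((hflat.filter _).trans ?_)⟩
  rw [List.filter_map]
  refine (hperm.map f).trans ?_
  have hl' : f (c', t') = ⟨!(f (c, t)).isOver, (f (c, t)).label, (f (c, t)).pos⟩ := hl
  rw [List.map_cons, List.map_cons, List.map_nil, hl']
  rcases f (c, t) with ⟨o, i, s⟩
  cases o
  · exact List.Perm.swap _ _ _
  · exact List.Perm.refl _

end VirtualLinkDiagram

/-! ### Words along the cycles of a permutation -/

namespace Equiv.Perm

variable {E : Type*} (N : Equiv.Perm E)

/-- The word read along the cycle of `N` through `e`, if `f` is read at each point. -/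
noncomputable def cycleWord {α : Type*} (f : E → List α) (e : E) : List α :=
  (List.range (Function.minimalPeriod N e)).flatMap fun i => f ((N ^ i) e)

/-- `R` contains exactly one point of each cycle of `N`. -/
def IsTransversal (R : List E) : Prop :=
  (∀ e, ∃ r ∈ R, N.SameCycle r e) ∧ R.Pairwise fun r r' => ¬ N.SameCycle r r'

variable {N}

theorem minimalPeriod_pos_of_finite [Finite E] (e : E) : 0 < Function.minimalPeriod N e :=
  Function.minimalPeriod_pos_of_mem_periodicPts (N.injective.mem_periodicPts e)

theorem map_cycleWord {α β : Type*} (f : E → List α) (g : α → β) (e : E) :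
    (N.cycleWord f e).map g = N.cycleWord (fun e => (f e).map g) e := List.map_flatMap

theorem pow_minimalPeriod (e : E) : (N ^ Function.minimalPeriod N e) e = e := by
  rw [Equiv.Perm.coe_pow]
  exact Function.iterate_minimalPeriod

theorem isRotated_cycleWord_apply [Finite E] {α : Type*} (f : E → List α) (e : E) :
    N.cycleWord f (N e) ~r N.cycleWord f e := by
  rw [cycleWord, cycleWord, Function.minimalPeriod_apply (N.injective.mem_periodicPts e)]
  obtain ⟨m, hm⟩ : ∃ m, Function.minimalPeriod N e = m + 1 :=
    ⟨_, (Nat.succ_pred_eq_of_pos (minimalPeriod_pos_of_finite e)).symm⟩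
  have h := pow_minimalPeriod (N := N) e
  rw [hm] at h ⊢
  have h' : ∀ i : ℕ, f ((N ^ i) (N e)) = f ((N ^ (i + 1)) e) := fun i => by
    rw [← Equiv.Perm.mul_apply, ← pow_succ]
  simp only [h']
  rw [List.range_succ, List.flatMap_append, List.flatMap_singleton, h, ← List.range_succ,
    List.flatMap_range_succ]
  exact List.isRotated_append

theorem SameCycle.isRotated_cycleWord [Finite E] {α : Type*} (f : E → List α) {e e' : E}
    (h : N.SameCycle e e') : N.cycleWord f e ~r N.cycleWord f e' := by
  obtain ⟨i, -, -, rfl⟩ := h.exists_pow_eq''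
  clear h
  induction i with
  | zero => exact List.IsRotated.refl _
  | succ i ih =>
    rw [pow_succ', Equiv.Perm.mul_apply]
    exact ih.trans (isRotated_cycleWord_apply f _).symm

/-- Each point of `R` is matched with the representative of its cycle in `R'`; moving along a cycle
rotates the word. -/
theorem IsTransversal.rearranged [Finite E] {R R' : List E} (h : N.IsTransversal R)
    (h' : N.IsTransversal R') (f : E → List GaussLetter) :
    Rearranged (R.map (N.cycleWord f)) (R'.map (N.cycleWord f)) := by
  classical
  choose σ hσ hσ' using h'.1
  have huniq : ∀ {R : List E}, N.IsTransversal R → ∀ a ∈ R, ∀ b ∈ R, N.SameCycle a b → a = b := by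
    intro R h a ha b hb hab
    by_contra hne
    have : Std.Symm fun r r' => ¬ N.SameCycle r r' := ⟨fun _ _ h1 h2 => h1 h2.symm⟩
    exact h.2.forall ha hb hne hab
  refine ⟨(R.map σ).map (N.cycleWord f), ?_, List.Perm.map _ ?_⟩
  · rw [List.map_map, List.forall₂_map_left_iff, List.forall₂_map_right_iff, List.forall₂_same]
    exact fun r _ => ((hσ' r).symm).isRotated_cycleWord f
  · have hirr : ∀ {R : List E}, N.IsTransversal R → R.Nodup := by
      intro R h
      refine h.2.imp ?_
      rintro a _ h1 rfl
      exact h1 (SameCycle.refl _ _)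
    refine (List.perm_ext_iff_of_nodup ?_ (hirr h')).2 fun a => ?_
    · refine (hirr h).map_on fun a ha b hb hab => huniq h a ha b hb ?_
      exact (hσ' a).symm.trans (hab ▸ hσ' b)
    · rw [List.mem_map]
      constructor
      · rintro ⟨r, _, rfl⟩
        exact hσ r
      · intro ha
        obtain ⟨r, hr, hra⟩ := h.1 a
        exact ⟨r, hr, huniq h' _ (hσ r) _ ha ((hσ' r).trans hra)⟩

end Equiv.Perm

/-- The least positions of the cycles form a transversal. -/
theorem BraidWord.isTransversal_least {k : ℕ} (ρ : Equiv.Perm (Fin k))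
    [DecidablePred fun p => ∀ x, ρ.SameCycle p x → p ≤ x] :
    ρ.IsTransversal ((List.finRange k).filter fun p => ∀ x, ρ.SameCycle p x → p ≤ x) := by
  classical
  constructor
  · intro x
    obtain ⟨y, hy, hmin⟩ := Finset.exists_min_image
      (Finset.univ.filter fun y => ρ.SameCycle x y) id ⟨x, by simp [Equiv.Perm.SameCycle.refl]⟩
    simp only [Finset.mem_filter, Finset.mem_univ, true_and, id] at hy hmin
    refine ⟨y, ?_, hy.symm⟩
    simp only [List.mem_filter, List.mem_finRange, true_and, decide_eq_true_eq]
    exact fun z hz => hmin z (hy.trans hz)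
  · refine ((List.nodup_finRange k).filter _).pairwise_of_forall_ne fun p hp p' hp' hne h => hne ?_
    simp only [List.mem_filter, List.mem_finRange, true_and, decide_eq_true_eq] at hp hp'
    exact le_antisymm (hp _ h) (hp' _ h.symm)

/-! ### Periodic Gauss diagrams -/

/-- A Gauss diagram with a free action of `ℤ/q`, given by the set `E` of marked points of its
circles: the endpoints of the chords, which carry a letter, and possibly further points.  The
`sheet` of a point is its position with respect to a fundamental domain. -/
structure PeriodicGaussDiagram (q : ℕ) (E : Type*) where
  next : Equiv.Perm E
  turn : Equiv.Perm E
  sheet : E → ZMod q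
  letter : E → Option GaussLetter
  commute : Commute next turn
  turn_pow : turn ^ q = 1
  sheet_turn : ∀ e, sheet (turn e) = sheet e + 1
  partner : ∀ e x, letter e = some x → ∃ e', letter e' = some ⟨!x.isOver, x.label, x.pos⟩
  letter_inj : ∀ e e' x y, letter e = some x → letter e' = some y → x.isOver = y.isOver →
    x.label = y.label → e = e'
  sheet_eq : ∀ e e' x y, letter e = some x → letter e' = some y → x.label = y.label →
    sheet e = sheet e'
  turn_letter : ∀ e x, letter e = some x → ∃ i, letter (turn e) = some ⟨x.isOver, i, x.pos⟩
  turn_label : ∀ e e' x y x' y', letter e = some x → letter e' = some y → x.label = y.label →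
    letter (turn e) = some x' → letter (turn e') = some y' → x'.label = y'.label

namespace PeriodicGaussDiagram

variable {q : ℕ} {E : Type*} (X : PeriodicGaussDiagram q E)

/-- The crossing numbers that occur. -/
def labels : Set ℕ := {i | ∃ e x, X.letter e = some x ∧ x.label = i}

/-- The word read along the circle through `e`. -/
noncomputable def word (e : E) : List GaussLetter :=
  X.next.cycleWord (fun e => (X.letter e).toList) e

variable {X}

theorem turn_pow_letter (j : ℕ) {e : E} {x : GaussLetter} (h : X.letter e = some x) :
    ∃ i, X.letter ((X.turn ^ j) e) = some ⟨x.isOver, i, x.pos⟩ := by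
  induction j with
  | zero => exact ⟨x.label, h⟩
  | succ j ih =>
    obtain ⟨i, hi⟩ := ih
    rw [pow_succ', Equiv.Perm.mul_apply]
    obtain ⟨i', hi'⟩ := X.turn_letter _ _ hi
    exact ⟨i', hi'⟩

theorem turn_pow_label (j : ℕ) {e e' : E} {x y x' y' : GaussLetter} (h : X.letter e = some x)
    (h' : X.letter e' = some y) (hxy : x.label = y.label)
    (h1 : X.letter ((X.turn ^ j) e) = some x') (h2 : X.letter ((X.turn ^ j) e') = some y') :
    x'.label = y'.label := by
  induction j generalizing x' y' with
  | zero =>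
    rw [pow_zero, Equiv.Perm.one_apply] at h1 h2
    rw [h] at h1; rw [h'] at h2
    cases h1; cases h2; exact hxy
  | succ j ih =>
    obtain ⟨i, hi⟩ := turn_pow_letter j h
    obtain ⟨i', hi'⟩ := turn_pow_letter j h'
    rw [pow_succ', Equiv.Perm.mul_apply] at h1 h2
    exact X.turn_label _ _ _ _ _ _ hi hi' (ih hi hi') h1 h2

theorem turn_pow_mod (j : ℕ) : X.turn ^ (j % q) = X.turn ^ j := by
  conv_rhs => rw [← Nat.mod_add_div j q, pow_add, pow_mul, X.turn_pow, one_pow, mul_one]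

theorem sheet_turn_pow (j : ℕ) (e : E) : X.sheet ((X.turn ^ j) e) = X.sheet e + j := by
  induction j with
  | zero => simp
  | succ j ih => rw [pow_succ', Equiv.Perm.mul_apply, X.sheet_turn, ih]; push_cast; ring

/-- A periodic Gauss diagram with finitely many points that moves up by one sheet from each point
to the next is realized by the closure of a power of a virtual braid. -/
theorem exists_braidWord_of_sheet_next [Finite E] [Nonempty E] (hq : 1 ≤ q)
    (hX : ∀ e, X.sheet (X.next e) = X.sheet e + 1) {R : List E} (hR : X.next.IsTransversal R) :
    ∃ (k : ℕ) (w : BraidWord k) (F : ℕ → ℕ), Set.InjOn F X.labels ∧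
      Rearranged (R.map fun r => (X.word r).map (relabel F)) (w.power q).closureCode := by
  classical
  have : NeZero q := ⟨by omega⟩
  -- the strands of the braid
  obtain ⟨k, ⟨ε⟩⟩ := Finite.exists_equiv_fin {x : E // X.sheet x = 0}
  set st : Fin k → E := fun p => (ε.symm p).1 with hst
  have hst0 : ∀ p, X.sheet (st p) = 0 := fun p => (ε.symm p).2
  have hinj : Function.Injective st := Subtype.val_injective.comp ε.symm.injective
  -- Turning a point back by its sheet leads to sheet 0, so every point is a turned strand.
  have hsurj : ∀ e, ∃ p, st p = (X.turn ^ (-((X.sheet e).val : ℤ))) e := by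
    intro e
    refine ⟨ε ⟨_, ?_⟩, by simp only [hst, Equiv.symm_apply_apply]; rfl⟩
    have h1 := sheet_turn_pow (X := X) (X.sheet e).val ((X.turn ^ (-((X.sheet e).val : ℤ))) e)
    rw [← zpow_natCast, ← Equiv.Perm.mul_apply, ← zpow_add, add_neg_cancel, zpow_zero,
      Equiv.Perm.one_apply, ZMod.natCast_zmod_val] at h1
    simpa using h1.symm
  have hsurj' : ∀ e, ∃ p, (X.turn ^ (X.sheet e).val) (st p) = e := by
    intro e
    obtain ⟨p, hp⟩ := hsurj e
    refine ⟨p, ?_⟩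
    rw [hp, ← zpow_natCast, ← Equiv.Perm.mul_apply, ← zpow_add, add_neg_cancel, zpow_zero,
      Equiv.Perm.one_apply]
  have hsurj0 : ∀ e, X.sheet e = 0 → ∃ p, st p = e := by
    intro e he
    obtain ⟨p, hp⟩ := hsurj' e
    refine ⟨p, ?_⟩
    simpa [he] using hp
  have : Nonempty (Fin k) := ⟨(hsurj (Classical.arbitrary E)).choose⟩
  -- the permutation of the strands
  obtain ⟨π, hπ⟩ : ∃ π : Equiv.Perm (Fin k), ∀ p, X.turn (st (π p)) = X.next (st p) := by
    have h1 : ∀ p, ∃ p', X.turn (st p') = X.next (st p) := by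
      intro p
      obtain ⟨p', hp'⟩ := hsurj0 (X.turn.symm (X.next (st p))) (by
        have := X.sheet_turn (X.turn.symm (X.next (st p)))
        rw [Equiv.apply_symm_apply, hX, hst0] at this
        simpa using this.symm)
      exact ⟨p', by rw [hp', Equiv.apply_symm_apply]⟩
    choose f hf using h1
    have hfi : Function.Injective f := by
      intro a b hab
      apply hinj
      apply X.next.injective
      rw [← hf, ← hf, hab]
    exact ⟨Equiv.ofBijective f (Finite.injective_iff_bijective.1 hfi), hf⟩
  -- Each step leads one sheet up, and `turn` commutes with `next`; so after `i` steps the point is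
  -- `i` turns away from sheet 0, over the strand given by the `i`-th power of `π`.
  have hpow : ∀ (i : ℕ) p, (X.next ^ i) (st p) = (X.turn ^ i) (st ((π ^ i) p)) := by
    intro i p
    induction i with
    | zero => rfl
    | succ i ih =>
      rw [pow_succ', Equiv.Perm.mul_apply, ih, ← Equiv.Perm.mul_apply,
        (X.commute.pow_right i).eq, Equiv.Perm.mul_apply, ← hπ, ← Equiv.Perm.mul_apply, ← pow_succ,
        ← Equiv.Perm.mul_apply, ← pow_succ']
  -- the crossings
  have hI : ∀ i, (∃ p x, X.letter (st p) = some x ∧ x.label = i) → ∃ (o u : Fin k) (s : Bool),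
      X.letter (st o) = some ⟨true, i, s⟩ ∧ X.letter (st u) = some ⟨false, i, s⟩ := by
    rintro i ⟨p, x, hx, rfl⟩
    obtain ⟨e, he⟩ := X.partner _ _ hx
    obtain ⟨p', rfl⟩ := hsurj0 e (by rw [X.sheet_eq _ _ _ _ he hx rfl, hst0])
    rcases x with ⟨o, i, s⟩
    cases o
    · exact ⟨p', p, s, he, hx⟩
    · exact ⟨p, p', s, hx, he⟩
  choose! o u s ho hu using hI
  set I₀ : Set ℕ := {i | ∃ p x, X.letter (st p) = some x ∧ x.label = i} with hI₀
  have hfin : I₀.Finite := by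
    have : I₀ ⊆ Set.range fun p => ((X.letter (st p)).map GaussLetter.label).getD 0 := by
      rintro i ⟨p, x, hx, rfl⟩
      exact ⟨p, by simp [hx]⟩
    exact (Set.finite_range _).subset this
  obtain ⟨G, pos, hpos, hposinj, hG, hGs⟩ := BraidWord.exists_crossings_word hfin.toFinset o u s
    (by
      intro i hi j hj hij
      rw [Set.Finite.coe_toFinset] at hi hj
      have := ho i hi
      rw [hij, ho j hj] at this
      injection this with this
      injection this with _ this
      exact this.symm)
    (by
      intro i hi j hj hij
      rw [Set.Finite.coe_toFinset] at hi hj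
      have := hu i hi
      rw [hij, hu j hj] at this
      injection this with this
      injection this with _ this
      exact this.symm)
    (by
      intro i hi j hj hij
      rw [Set.Finite.mem_toFinset] at hi hj
      have := ho i hi
      rw [hij, hu j hj] at this
      simp at this)
  obtain ⟨Q, hQ, hQ'⟩ := BraidWord.exists_virtual_word π
  -- All crossings of one sheet come first, on a pure braid; then virtual crossings permute the
  -- strands by `π`.
  set w : BraidWord k := G ++ Q with hw
  have hwπ : w.exitPerm = π := by rw [hw, BraidWord.exitPerm_append, hG, hQ, mul_one]
  have hwL : ∀ i ∈ I₀, pos i < w.length := by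
    intro i hi
    have := hpos i (hfin.mem_toFinset.2 hi)
    rw [hw, List.length_append]; omega
  have hws : ∀ a p, w.strandWord a p =
      (X.letter (st p)).toList.map (relabel fun i => a + pos i) := by
    intro a p
    rw [hw, BraidWord.strandWord_append, BraidWord.strandWord_of_tau _ hQ', List.append_nil]
    obtain ⟨h1, h2, h3⟩ := hGs a
    rcases hx : X.letter (st p) with _ | x
    · rw [h3]; · rfl
      intro i hi
      rw [Set.Finite.mem_toFinset] at hi
      constructor
      · rintro rfl; rw [ho i hi] at hx; cases hx
      · rintro rfl; rw [hu i hi] at hx; cases hx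
    · have hi : x.label ∈ I₀ := ⟨p, x, hx, rfl⟩
      rcases x with ⟨b, i, t⟩
      cases b
      · have hp : p = u i := hinj (X.letter_inj _ _ _ _ hx (hu i hi) rfl rfl)
        subst hp
        rw [hu i hi] at hx
        cases hx
        rw [h2 i (hfin.mem_toFinset.2 hi)]
        rfl
      · have hp : p = o i := hinj (X.letter_inj _ _ _ _ hx (ho i hi) rfl rfl)
        subst hp
        rw [ho i hi] at hx
        cases hx
        rw [h1 i (hfin.mem_toFinset.2 hi)]
        rfl
  -- the new numbers of the crossings
  have hback : ∀ i ∈ X.labels, ∃ (j : ℕ) (p : Fin k) (x y : GaussLetter), j < q ∧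
      X.letter (st p) = some x ∧ X.letter ((X.turn ^ j) (st p)) = some y ∧ y.label = i := by
    rintro i ⟨e, y, hy, rfl⟩
    obtain ⟨p, hp⟩ := hsurj' e
    have h1 : (X.turn ^ (q - (X.sheet e).val)) e = st p := by
      have hlt := (ZMod.val_lt (X.sheet e)).le
      generalize (X.sheet e).val = j at hp hlt
      subst hp
      rw [← Equiv.Perm.mul_apply, ← pow_add, Nat.sub_add_cancel hlt, X.turn_pow,
        Equiv.Perm.one_apply]
    obtain ⟨i', hi'⟩ := turn_pow_letter (q - (X.sheet e).val) hy
    rw [h1] at hi'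
    exact ⟨(X.sheet e).val, p, _, y, ZMod.val_lt _, hi', by rw [hp]; exact hy, rfl⟩
  have : Nonempty GaussLetter := ⟨⟨true, 0, true⟩⟩
  choose! jj pp xx yy hjj hxx hyy hyi using hback
  -- A crossing is the `jj i`-fold turn of a crossing of sheet 0; in the stacked word it therefore
  -- lies in copy `jj i`, at the place of that crossing in `w`.
  set F : ℕ → ℕ := fun i => jj i * w.length + pos (xx i).label with hF
  have hFkey : ∀ (j : ℕ) (p : Fin k) x y, X.letter (st p) = some x →
      X.letter ((X.turn ^ j) (st p)) = some y →
      F y.label = j % q * w.length + pos x.label := by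
    intro j p x y hx hy
    rw [← turn_pow_mod] at hy
    have hj : j % q < q := Nat.mod_lt _ hq
    set j' := j % q
    have hi : y.label ∈ X.labels := ⟨_, y, hy, rfl⟩
    have h1 := X.sheet_eq _ _ _ _ hy (hyy _ hi) (hyi _ hi).symm
    rw [sheet_turn_pow, sheet_turn_pow, hst0, hst0, zero_add, zero_add] at h1
    -- Both ends of the chord lie in the same sheet, so the number of turns is determined modulo
    -- `q`, hence exactly, being less than `q`.
    have h2 : jj y.label = j' := by
      rw [← ZMod.val_cast_of_lt hj, h1, ZMod.val_cast_of_lt (hjj _ hi)]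
    have h3 := hyy _ hi
    rw [h2] at h3
    have h4 : ∀ p, (X.turn ^ (q - j')) ((X.turn ^ j') (st p)) = st p := by
      intro p
      rw [← Equiv.Perm.mul_apply, ← pow_add, Nat.sub_add_cancel hj.le, X.turn_pow,
        Equiv.Perm.one_apply]
    have h5 := turn_pow_label (q - j') hy h3 (hyi _ hi).symm (by rw [h4]; exact hx)
      (by rw [h4]; exact hxx _ hi)
    rw [hF]
    dsimp only
    rw [h2, ← h5]
  have hFinj : Set.InjOn F X.labels := by
    intro a ha b hb hab
    have h1 := hwL (xx a).label ⟨_, _, hxx a ha, rfl⟩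
    have h2 := hwL (xx b).label ⟨_, _, hxx b hb, rfl⟩
    have h3 : jj a = jj b := by
      have := congrArg (· / w.length) hab
      simp only [hF] at this
      rwa [mul_comm, Nat.mul_add_div (by omega), mul_comm, Nat.mul_add_div (by omega),
        Nat.div_eq_of_lt h1, Nat.div_eq_of_lt h2, add_zero, add_zero] at this
    have h4 : pos (xx a).label = pos (xx b).label := by
      simp only [hF, h3] at hab
      omega
    have h5 : (xx a).label = (xx b).label := hposinj (by
      rw [Set.Finite.coe_toFinset]; exact ⟨_, _, hxx a ha, rfl⟩) (by
      rw [Set.Finite.coe_toFinset]; exact ⟨_, _, hxx b hb, rfl⟩) h4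
    have h6 := hyy a ha
    rw [h3] at h6
    have := turn_pow_label (jj b) (hxx a ha) (hxx b hb) h5 h6 (hyy b hb)
    rwa [hyi a ha, hyi b hb] at this
  have hletter : ∀ (j : ℕ) p, (X.letter ((X.turn ^ j) (st p))).toList.map (relabel F) =
      w.strandWord (j % q * w.length) p := by
    intro j p
    rw [hws]
    rcases hx : X.letter (st p) with _ | x
    · rcases hy : X.letter ((X.turn ^ j) (st p)) with _ | y
      · rfl
      -- With `j * (q - 1)` more turns a multiple of `q` is reached, and the letter would come back
      -- to `st p`, which has none.
      · obtain ⟨i, hi⟩ := turn_pow_letter (j * (q - 1)) hy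
        rw [← Equiv.Perm.mul_apply, ← pow_add, show j * (q - 1) + j = q * j by
          obtain ⟨r, rfl⟩ : ∃ r, q = r + 1 := ⟨q - 1, by omega⟩
          simp; ring, pow_mul, X.turn_pow, one_pow, Equiv.Perm.one_apply, hx] at hi
        cases hi
    · obtain ⟨i, hi⟩ := turn_pow_letter j hx
      have := hFkey j p _ _ hx hi
      rw [hi]
      simp only [Option.toList_some, List.map_cons, List.map_nil, relabel] at this ⊢
      rw [this]
  -- the words
  have hper : ∀ (n : ℕ) p p', (X.next ^ n) (st p) = st p' ↔ q ∣ n ∧ (π ^ n) p = p' := by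
    intro n p p'
    rw [hpow]
    constructor
    · intro h
      have h1 := congrArg X.sheet h
      rw [sheet_turn_pow, hst0, hst0, zero_add, ZMod.natCast_eq_zero_iff] at h1
      refine ⟨h1, hinj ?_⟩
      obtain ⟨m, rfl⟩ := h1
      rwa [pow_mul X.turn, X.turn_pow, one_pow, Equiv.Perm.one_apply] at h
    · rintro ⟨⟨m, rfl⟩, rfl⟩
      rw [pow_mul X.turn, X.turn_pow, one_pow, Equiv.Perm.one_apply]
  have hmin : ∀ p, Function.minimalPeriod X.next (st p) =
      Function.minimalPeriod (π ^ q : Equiv.Perm (Fin k)) p * q := by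
    intro p
    refine Nat.dvd_antisymm ?_ ?_
    · apply Function.IsPeriodicPt.minimalPeriod_dvd
      change X.next^[_] (st p) = st p
      rw [← Equiv.Perm.coe_pow, hper]
      refine ⟨dvd_mul_left _ _, ?_⟩
      rw [mul_comm, pow_mul]
      exact Equiv.Perm.pow_minimalPeriod p
    · obtain ⟨h1, h2⟩ := (hper _ _ _).1 (Equiv.Perm.pow_minimalPeriod (N := X.next) (st p))
      obtain ⟨m, hm⟩ := h1
      rw [hm, mul_comm q m]
      refine Nat.mul_dvd_mul_right ?_ q
      apply Function.IsPeriodicPt.minimalPeriod_dvd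
      change (π ^ q : Equiv.Perm (Fin k))^[_] p = p
      rw [← Equiv.Perm.coe_pow, ← pow_mul, ← hm, h2]
  have hword : ∀ p, (X.word (st p)).map (relabel F) = (w.power q).componentWord p := by
    intro p
    rw [BraidWord.componentWord_power, word, Equiv.Perm.map_cycleWord, Equiv.Perm.cycleWord, hmin,
      hwπ]
    refine List.flatMap_congr fun i _ => ?_
    rw [hpow, hletter]
  refine ⟨k, w, F, hFinj, ?_⟩
  have hρ : (w.power q).exitPerm = π ^ q := by rw [BraidWord.exitPerm_power, hwπ]
  have hT := BraidWord.isTransversal_least (π ^ q)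
  have hT' : X.next.IsTransversal
      (((List.finRange k).filter fun p => ∀ x, (π ^ q).SameCycle p x → p ≤ x).map st) := by
    constructor
    · intro e
      obtain ⟨p, hp⟩ := hsurj0 ((X.next ^ (q - (X.sheet e).val)) e) (by
        have : ∀ n : ℕ, X.sheet ((X.next ^ n) e) = X.sheet e + n := by
          intro n
          induction n with
          | zero => simp
          | succ n ih => rw [pow_succ', Equiv.Perm.mul_apply, hX, ih]; push_cast; ring
        rw [this, Nat.cast_sub (ZMod.val_lt _).le]
        simp)
      obtain ⟨r, hr, hrp⟩ := hT.1 p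
      refine ⟨st r, List.mem_map_of_mem hr, ?_⟩
      obtain ⟨i, -, -, hi⟩ := hrp.exists_pow_eq''
      rw [← pow_mul] at hi
      have h1 := (hper (q * i) r p).2 ⟨dvd_mul_right _ _, hi⟩
      have h2 : X.next.SameCycle (st r) (st p) := ⟨(q * i : ℕ), h1⟩
      have h3 : X.next.SameCycle e (st p) := ⟨(q - (X.sheet e).val : ℕ), hp.symm⟩
      exact h2.trans h3.symm
    · rw [List.pairwise_map]
      refine hT.2.imp fun {a b} hab h => hab ?_
      obtain ⟨i, -, -, hi⟩ := h.exists_pow_eq''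
      obtain ⟨⟨m, rfl⟩, h2⟩ := (hper _ _ _).1 hi
      exact ⟨m, by rw [zpow_natCast, ← pow_mul]; exact h2⟩
  have hre := hR.rearranged hT' fun e => (X.letter e).toList.map (relabel F)
  rw [List.map_map, show (X.next.cycleWord fun e => (X.letter e).toList.map (relabel F)) =
    fun e => (X.word e).map (relabel F) from
      funext fun e => (Equiv.Perm.map_cycleWord _ _ _).symm] at hre
  have hcode : (w.power q).closureCode =
      ((List.finRange k).filter fun p => ∀ x, (π ^ q).SameCycle p x → p ≤ x).map
        (w.power q).componentWord := by
    simp only [BraidWord.closureCode, hρ]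
  rw [hcode]
  convert hre using 2
  exact funext fun p => (hword p).symm

end PeriodicGaussDiagram

/-! ### Suspension of a permutation: further points inserted on its cycles. -/

namespace Equiv.Perm

variable {E : Type*} (N : Equiv.Perm E) {d : E → ℕ}

theorem finite_suspension [Finite E] (d : E → ℕ) : Finite {x : E × ℕ // x.2 < d x.1} := by
  obtain ⟨n, hn⟩ : ∃ n, ∀ e, d e ≤ n := by
    obtain ⟨n, hn⟩ := (Set.finite_range d).bddAbove
    exact ⟨n, fun e => hn ⟨e, rfl⟩⟩
  refine Set.Finite.to_subtype (s := {x : E × ℕ | x.2 < d x.1})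
    (((Set.finite_univ (α := E)).prod (Set.finite_Iio n)).subset ?_)
  exact fun x hx => ⟨trivial, lt_of_lt_of_le hx (hn x.1)⟩

/-- The time needed to run through `e` and the following `n - 1` points. -/
def suspensionTime (N : Equiv.Perm E) (d : E → ℕ) (e : E) : ℕ → ℕ
  | 0 => 0
  | n + 1 => suspensionTime N d e n + d ((N ^ n) e)

theorem exists_suspensionTime_le {N : Equiv.Perm E} (hd : ∀ e, 0 < d e) (e : E) (i : ℕ) :
    ∃ n s, i = suspensionTime N d e n + s ∧ s < d ((N ^ n) e) := by
  induction i with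
  | zero => exact ⟨0, 0, rfl, hd _⟩
  | succ i ih =>
    obtain ⟨n, s, h1, h2⟩ := ih
    by_cases h : s + 1 < d ((N ^ n) e)
    · exact ⟨n, s + 1, by omega, h⟩
    · exact ⟨n + 1, 0, by rw [suspensionTime]; omega, hd _⟩

theorem suspensionTime_strictMono {N : Equiv.Perm E} (hd : ∀ e, 0 < d e) (e : E) : StrictMono (suspensionTime N d e) :=
  strictMono_nat_of_lt_succ fun n => by
    rw [suspensionTime]; have := hd ((N ^ n) e); omega

variable [Finite E]

/-- Each point `e` is replaced by `d e` points, which are run through one after the other. -/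
noncomputable def suspension (hd : ∀ e, 0 < d e) : Equiv.Perm {x : E × ℕ // x.2 < d x.1} :=
  haveI := finite_suspension d
  Equiv.ofBijective
    (fun x => if h : x.1.2 + 1 < d x.1.1 then ⟨(x.1.1, x.1.2 + 1), h⟩ else ⟨(N x.1.1, 0), hd _⟩)
    (Finite.injective_iff_bijective.1 (by
      rintro ⟨⟨e, s⟩, hs⟩ ⟨⟨e', s'⟩, hs'⟩ h
      dsimp only at hs hs' h
      split_ifs at h with h1 h2 h2
      · simpa using h
      · simp at h
      · simp at h
      · simp only [Subtype.mk.injEq, Prod.mk.injEq, EmbeddingLike.apply_eq_iff_eq, and_true] at h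
        subst h
        simp only [Subtype.mk.injEq, Prod.mk.injEq, true_and]
        omega))

variable {N} (hd : ∀ e, 0 < d e)

theorem suspension_apply (x : {x : E × ℕ // x.2 < d x.1}) : N.suspension hd x =
    if h : x.1.2 + 1 < d x.1.1 then ⟨(x.1.1, x.1.2 + 1), h⟩ else ⟨(N x.1.1, 0), hd _⟩ := rfl

theorem suspension_pow_of_lt (e : E) (s : ℕ) (hs : s < d e) :
    (N.suspension hd ^ s) ⟨(e, 0), hd e⟩ = ⟨(e, s), hs⟩ := by
  induction s with
  | zero => rfl
  | succ s ih =>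
    rw [pow_succ', Equiv.Perm.mul_apply, ih (by omega), suspension_apply, dif_pos hs]

theorem suspension_pow_self (e : E) :
    (N.suspension hd ^ d e) ⟨(e, 0), hd e⟩ = ⟨(N e, 0), hd _⟩ := by
  have := hd e
  obtain ⟨s, hs⟩ : ∃ s, d e = s + 1 := ⟨d e - 1, by omega⟩
  rw [hs, pow_succ', Equiv.Perm.mul_apply, suspension_pow_of_lt hd e s (by omega),
    suspension_apply, dif_neg (by simp [hs])]

theorem suspension_pow_time (e : E) (n : ℕ) :
    (N.suspension hd ^ suspensionTime N d e n) ⟨(e, 0), hd e⟩ = ⟨((N ^ n) e, 0), hd _⟩ := by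
  induction n with
  | zero => rfl
  | succ n ih =>
    rw [suspensionTime, add_comm, pow_add, Equiv.Perm.mul_apply, ih, suspension_pow_self]
    simp only [pow_succ', Equiv.Perm.mul_apply]

/-- The points at level 0 are met exactly at the suspension times, so the first return to `(e, 0)`
takes the time of one full cycle of `N`. -/
theorem minimalPeriod_suspension (e : E) :
    Function.minimalPeriod (N.suspension hd) ⟨(e, 0), hd e⟩ =
      suspensionTime N d e (Function.minimalPeriod N e) := by
  have := finite_suspension d
  have h0 := minimalPeriod_pos_of_finite (N := N) e
  apply le_antisymm
  · apply Function.IsPeriodicPt.minimalPeriod_le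
    · exact suspensionTime_strictMono hd e h0
    · change (N.suspension hd)^[_] _ = _
      rw [← Equiv.Perm.coe_pow, suspension_pow_time]
      simp only [pow_minimalPeriod]
  · obtain ⟨n, s, h1, h2⟩ := exists_suspensionTime_le (N := N) hd e
      (Function.minimalPeriod (N.suspension hd) ⟨(e, 0), hd e⟩)
    have h3 := pow_minimalPeriod (N := N.suspension hd) ⟨(e, 0), hd e⟩
    rw [h1, add_comm, pow_add, Equiv.Perm.mul_apply, suspension_pow_time,
      suspension_pow_of_lt hd _ s h2] at h3
    simp only [Subtype.mk.injEq, Prod.mk.injEq] at h3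
    rw [h1]
    refine le_trans ((suspensionTime_strictMono hd e).monotone ?_) (Nat.le_add_right _ _)
    refine Function.IsPeriodicPt.minimalPeriod_le (Nat.pos_of_ne_zero ?_) ?_
    · rintro rfl
      have := minimalPeriod_pos_of_finite (N := N.suspension hd) ⟨(e, 0), hd e⟩
      rw [h1, h3.2] at this
      exact absurd this (lt_irrefl _)
    · change N^[n] e = e
      rw [← Equiv.Perm.coe_pow]
      exact h3.1

/-- The inserted points carry no letters, so the words along the cycles do not change. -/
theorem cycleWord_suspension {α : Type*} (f : E → List α) (e : E) :
    (N.suspension hd).cycleWord (fun x => if x.1.2 = 0 then f x.1.1 else []) ⟨(e, 0), hd e⟩ =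
      N.cycleWord f e := by
  rw [cycleWord, minimalPeriod_suspension, cycleWord]
  generalize Function.minimalPeriod N e = n
  induction n with
  | zero => rfl
  | succ n ih =>
    rw [suspensionTime, List.range_add, List.flatMap_append, ih, List.flatMap_map,
      List.range_succ, List.flatMap_append, List.flatMap_singleton]
    congr 1
    have h : ∀ (s : ℕ) (hs : s < d ((N ^ n) e)), (N.suspension hd ^ (suspensionTime N d e n + s)) ⟨(e, 0), hd e⟩ =
        ⟨((N ^ n) e, s), hs⟩ := by
      intro s hs
      rw [add_comm, pow_add, Equiv.Perm.mul_apply, suspension_pow_time, suspension_pow_of_lt]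
    obtain ⟨m, hm⟩ : ∃ m, d ((N ^ n) e) = m + 1 :=
      ⟨d ((N ^ n) e) - 1, by have := hd ((N ^ n) e); omega⟩
    rw [hm, List.flatMap_range_succ, h 0 (hd _), if_pos rfl]
    convert List.append_nil _
    rw [List.flatMap_eq_nil_iff]
    intro s hs
    rw [h (s + 1) (by have := List.mem_range.1 hs; omega)]
    rfl

theorem IsTransversal.suspension {R : List E} (hR : N.IsTransversal R) :
    (N.suspension hd).IsTransversal (R.map fun e => ⟨(e, 0), hd e⟩) := by
  constructor
  · rintro ⟨⟨e, s⟩, hs⟩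
    obtain ⟨r, hr, hre⟩ := hR.1 e
    refine ⟨_, List.mem_map_of_mem hr, ?_⟩
    obtain ⟨n, -, -, rfl⟩ := hre.exists_pow_eq''
    refine ⟨(s + suspensionTime N d r n : ℕ), ?_⟩
    rw [zpow_natCast, pow_add, Equiv.Perm.mul_apply, suspension_pow_time,
      suspension_pow_of_lt hd _ s hs]
  · rw [List.pairwise_map]
    refine hR.2.imp fun {a b} hab h => hab ?_
    have := finite_suspension d
    obtain ⟨i, -, -, hi⟩ := h.exists_pow_eq''
    obtain ⟨n, s, rfl, h2⟩ := exists_suspensionTime_le (N := N) hd a i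
    rw [add_comm, pow_add, Equiv.Perm.mul_apply, suspension_pow_time,
      suspension_pow_of_lt hd _ s h2] at hi
    simp only [Subtype.mk.injEq, Prod.mk.injEq] at hi
    exact ⟨n, by rw [zpow_natCast]; exact hi.1⟩

end Equiv.Perm

/-! ### Suspension of a periodic Gauss diagram, and braiding in general. -/

namespace PeriodicGaussDiagram

variable {q : ℕ} {E : Type*} (X : PeriodicGaussDiagram q E)

/-- The number of sheets through which one passes from `e` to the next point. -/
def height (e : E) : ℕ :=
  -- Two consecutive points in the same sheet are joined by a full turn of `q` sheets: a height must
  -- be positive, and only its residue modulo `q` is prescribed.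
  if (X.sheet (X.next e) - X.sheet e).val = 0 then q else (X.sheet (X.next e) - X.sheet e).val

theorem height_pos [NeZero q] (e : E) : 0 < X.height e := by
  unfold height
  split_ifs with h
  · exact Nat.pos_of_ne_zero (NeZero.ne q)
  · exact Nat.pos_of_ne_zero h

theorem cast_height [NeZero q] (e : E) :
    (X.height e : ZMod q) = X.sheet (X.next e) - X.sheet e := by
  unfold height
  split_ifs with h
  · rw [(ZMod.val_eq_zero _).1 h, ZMod.natCast_self]
  · rw [ZMod.natCast_zmod_val]

/-- Turning raises the sheets of both neighbours by one; so the action lifts to the inserted points.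
-/
theorem height_turn (e : E) : X.height (X.turn e) = X.height e := by
  have : X.next (X.turn e) = X.turn (X.next e) := DFunLike.congr_fun X.commute.eq e
  rw [height, height, this, X.sheet_turn, X.sheet_turn, add_sub_add_right_eq_sub]

/-- The rotation of the suspension. -/
def suspensionTurn : Equiv.Perm {x : E × ℕ // x.2 < X.height x.1} where
  toFun x := ⟨(X.turn x.1.1, x.1.2), by rw [X.height_turn]; exact x.2⟩
  invFun x := ⟨(X.turn.symm x.1.1, x.1.2), by
    rw [← X.height_turn, Equiv.apply_symm_apply]; exact x.2⟩
  left_inv x := by simp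
  right_inv x := by simp

theorem suspensionTurn_pow (n : ℕ) (x : {x : E × ℕ // x.2 < X.height x.1}) :
    ((X.suspensionTurn ^ n) x).1 = ((X.turn ^ n) x.1.1, x.1.2) := by
  induction n with
  | zero => rfl
  | succ n ih =>
    have : ((X.suspensionTurn ^ (n + 1)) x).1 =
        (X.turn ((X.suspensionTurn ^ n) x).1.1, ((X.suspensionTurn ^ n) x).1.2) := by
      rw [pow_succ']; rfl
    rw [this, ih, pow_succ']
    rfl

variable [Finite E]

/-- Further points are inserted, so that each point is followed by one in the next sheet. -/
noncomputable def suspension [NeZero q] :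
    PeriodicGaussDiagram q {x : E × ℕ // x.2 < X.height x.1} where
  next := X.next.suspension X.height_pos
  turn := X.suspensionTurn
  sheet x := X.sheet x.1.1 + x.1.2
  letter x := if x.1.2 = 0 then X.letter x.1.1 else none
  commute := by
    ext1 ⟨⟨e, s⟩, hs⟩
    have hT : ∀ e s (hs : s < X.height e), X.suspensionTurn ⟨(e, s), hs⟩ =
        ⟨(X.turn e, s), by rw [X.height_turn]; exact hs⟩ := fun _ _ _ => rfl
    have hN : X.next (X.turn e) = X.turn (X.next e) := DFunLike.congr_fun X.commute.eq e
    rw [Equiv.Perm.mul_apply, Equiv.Perm.mul_apply, hT]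
    by_cases h : s + 1 < X.height e
    · rw [Equiv.Perm.suspension_apply, dif_pos (h.trans_eq (X.height_turn e).symm),
        Equiv.Perm.suspension_apply, dif_pos h, hT]
    · rw [Equiv.Perm.suspension_apply, dif_neg (fun h1 => h (h1.trans_eq (X.height_turn e))),
        Equiv.Perm.suspension_apply, dif_neg h, hT]
      simp only [hN]
  turn_pow := by
    ext1 x
    apply Subtype.ext
    rw [suspensionTurn_pow, X.turn_pow]
    rfl
  sheet_turn := by
    rintro ⟨⟨e, s⟩, hs⟩
    simp [suspensionTurn, X.sheet_turn]
    ring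
  partner := by
    rintro ⟨⟨e, s⟩, hs⟩ x h
    dsimp only at h
    split_ifs at h
    obtain ⟨e', he'⟩ := X.partner e x h
    exact ⟨⟨(e', 0), X.height_pos _⟩, by simpa using he'⟩
  letter_inj := by
    rintro ⟨⟨e, s⟩, hs⟩ ⟨⟨e', s'⟩, hs'⟩ x y h h' h1 h2
    dsimp only at h h'
    split_ifs at h h' with h3 h4
    simp only [Subtype.mk.injEq, Prod.mk.injEq]
    exact ⟨X.letter_inj _ _ _ _ h h' h1 h2, h3.trans h4.symm⟩
  sheet_eq := by
    rintro ⟨⟨e, s⟩, hs⟩ ⟨⟨e', s'⟩, hs'⟩ x y h h' h1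
    dsimp only at h h' ⊢
    split_ifs at h h' with h3 h4
    rw [h3, h4, X.sheet_eq _ _ _ _ h h' h1]
  turn_letter := by
    rintro ⟨⟨e, s⟩, hs⟩ x h
    dsimp only at h
    split_ifs at h with h3
    obtain ⟨i, hi⟩ := X.turn_letter _ _ h
    exact ⟨i, by simpa [suspensionTurn, h3] using hi⟩
  turn_label := by
    rintro ⟨⟨e, s⟩, hs⟩ ⟨⟨e', s'⟩, hs'⟩ x y x' y' h h' h1 h2 h3
    dsimp only at h h'
    split_ifs at h h' with h4 h5
    exact X.turn_label _ _ _ _ _ _ h h' h1 (by simpa [suspensionTurn, h4] using h2)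
      (by simpa [suspensionTurn, h5] using h3)

/-- Inside a column the level grows by one; at its top, `height` steps have bridged exactly the
difference of the sheets of `e` and `X.next e`. -/
theorem sheet_next_suspension [NeZero q] (x : {x : E × ℕ // x.2 < X.height x.1}) :
    X.suspension.sheet (X.suspension.next x) = X.suspension.sheet x + 1 := by
  obtain ⟨⟨e, s⟩, hs⟩ := x
  simp only [suspension, Equiv.Perm.suspension_apply]
  dsimp only at hs
  split_ifs with h
  · push_cast; ring
  · have : (X.height e : ZMod q) = (s : ZMod q) + 1 := by
      rw [show X.height e = s + 1 by omega]; push_cast; ring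
    rw [X.cast_height] at this
    rw [Nat.cast_zero, add_zero, add_assoc, ← this]; ring

/-- A periodic Gauss diagram is realized by the closure of a power of a virtual braid. -/
theorem exists_braidWord [Nonempty E] (hq : 1 ≤ q) {R : List E} (hR : X.next.IsTransversal R) :
    ∃ (k : ℕ) (w : BraidWord k), Same (R.map X.word) (w.power q).closureCode := by
  have : NeZero q := ⟨by omega⟩
  have := Equiv.Perm.finite_suspension X.height
  have : Nonempty {x : E × ℕ // x.2 < X.height x.1} :=
    ⟨⟨(Classical.arbitrary E, 0), X.height_pos _⟩⟩
  obtain ⟨k, w, F, hF, h⟩ := X.suspension.exists_braidWord_of_sheet_next hq X.sheet_next_suspension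
    (hR.suspension X.height_pos)
  have hword : ∀ e, X.suspension.word ⟨(e, 0), X.height_pos e⟩ = X.word e := by
    intro e
    rw [word, word, ← Equiv.Perm.cycleWord_suspension X.height_pos]
    congr 1
    ext1 x
    simp only [suspension]
    split_ifs <;> rfl
  have hlab : X.labels ⊆ X.suspension.labels := by
    rintro i ⟨e, x, h, rfl⟩
    exact ⟨⟨(e, 0), X.height_pos e⟩, x, by simpa [suspension] using h, rfl⟩
  have hfin : X.labels.Finite := by
    have : X.labels ⊆ Set.range fun e => ((X.letter e).map GaussLetter.label).getD 0 := by
      rintro i ⟨p, x, hx, rfl⟩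
      exact ⟨p, by simp [hx]⟩
    exact (Set.finite_range _).subset this
  -- The renumbering is injective only on the numbers in use, while `Same` asks for a permutation of
  -- ℕ.
  obtain ⟨σ, hσ⟩ := exists_perm_eqOn hfin (hF.mono hlab)
  refine ⟨k, w, σ, ?_⟩
  convert h using 1
  rw [List.map_map, List.map_map]
  refine List.map_congr_left fun e _ => ?_
  simp only [Function.comp, hword]
  refine List.map_congr_left fun x hx => ?_
  simp only [word, Equiv.Perm.cycleWord, List.mem_flatMap, Option.mem_toList] at hx
  obtain ⟨i, _, hi⟩ := hx
  simp only [relabel, hσ ⟨_, x, hi, rfl⟩]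

end PeriodicGaussDiagram

/-! ### Periodic words -/

theorem List.eq_of_countP_le_one {α : Type*} {l : List α} {p : α → Bool} (h : l.countP p ≤ 1)
    {i j : ℕ} (hi : i < l.length) (hj : j < l.length) (hpi : p l[i]) (hpj : p l[j]) : i = j := by
  wlog hij : i ≤ j generalizing i j
  · exact (this hj hi hpj hpi (by omega)).symm
  by_contra hne
  rw [← List.take_append_drop j l, List.countP_append] at h
  have h1 : 0 < (l.take j).countP p :=
    List.countP_pos_iff.2 ⟨l[i], List.mem_take_iff_getElem.2 ⟨i, by omega, rfl⟩, hpi⟩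
  have h2 : 0 < (l.drop j).countP p :=
    List.countP_pos_iff.2 ⟨l[j], List.mem_drop_iff_getElem.2 ⟨0, by omega, by simp⟩, hpj⟩
  omega

theorem Equiv.addRight_pow_apply {A : Type*} [AddGroup A] (a e : A) (n : ℕ) :
    ((Equiv.addRight a : Equiv.Perm A) ^ n) e = e + n • a := by
  induction n with
  | zero => simp
  | succ n ih => rw [pow_succ', Equiv.Perm.mul_apply, ih, succ_nsmul, ← add_assoc]; rfl

namespace GaussCode

theorem Same.refl (C : GaussCode) : Same C C := by
  refine ⟨1, ?_⟩
  have : List.map (List.map (relabel (1 : Equiv.Perm ℕ))) C = C := by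
    have : List.map (relabel (1 : Equiv.Perm ℕ)) = id := List.map_id_fun
    rw [this, List.map_id]
  rw [this]
  exact Rearranged.of_perm (List.Perm.refl _)

variable {u : List GaussLetter}

theorem Valid.partner_mem (h : Valid [u]) {x : GaussLetter} (hx : x ∈ u) :
    (⟨!x.isOver, x.label, x.pos⟩ : GaussLetter) ∈ u := by
  obtain ⟨s, hs⟩ := h x (by simpa using hx)
  rw [List.flatten_singleton] at hs
  have hx' : x ∈ [(⟨true, x.label, s⟩ : GaussLetter), ⟨false, x.label, s⟩] :=
    hs.mem_iff.1 (by simpa using hx)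
  rcases x with ⟨o, i, t⟩
  have hs' : t = s ∧ (⟨!o, i, s⟩ : GaussLetter) ∈ [(⟨true, i, s⟩ : GaussLetter), ⟨false, i, s⟩] := by
    cases o <;> simpa using hx'
  obtain ⟨rfl, h1⟩ := hs'
  exact List.mem_of_mem_filter (hs.mem_iff.2 h1)

theorem Valid.eq_of_label_eq (h : Valid [u]) {i j : ℕ} (hi : i < u.length) (hj : j < u.length)
    (ho : u[i].isOver = u[j].isOver) (hl : u[i].label = u[j].label) : i = j := by
  obtain ⟨s, hs⟩ := h u[i] (by simp)
  rw [List.flatten_singleton] at hs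
  have h1 := hs.countP_eq fun y => y.isOver == u[i].isOver
  rw [List.countP_filter] at h1
  refine List.eq_of_countP_le_one (p := fun y => y.isOver == u[i].isOver &&
    decide (y.label = u[i].label)) ?_ hi hj (by simp) (by simp [ho, hl])
  rw [h1]
  cases u[i].isOver <;> simp

/-! ### The periodic Gauss diagram of a periodic word, with `ZMod (q * m)` as the circle. -/

section Word

variable {q m : ℕ} {f : ℕ → ℕ}

/-- The letter at a position of a cyclic word. -/
def cyclicLetter (u : List GaussLetter) (e : ZMod (q * m)) : Option GaussLetter := u[e.val]?

theorem val_add_shift (e : ZMod (q * m)) [NeZero (q * m)] :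
    (e + (m : ZMod (q * m))).val = (e.val + m) % (q * m) := by
  rw [ZMod.val_add, ZMod.val_natCast, Nat.add_mod_mod]

theorem cyclicLetter_add [NeZero (q * m)] (hlen : u.length = q * m)
    (hu : u.rotate m = u.map (relabel f)) (e : ZMod (q * m)) :
    cyclicLetter u (e + (m : ZMod (q * m))) = (cyclicLetter u e).map (relabel f) := by
  have he : e.val < u.length := (ZMod.val_lt e).trans_eq hlen.symm
  have h1 : (u.rotate m)[e.val]? = (u.map (relabel f))[e.val]? := by rw [hu]
  rw [List.getElem?_rotate he, List.getElem?_map] at h1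
  rw [cyclicLetter, cyclicLetter, val_add_shift, ← h1, hlen]

theorem cyclicLetter_eq_some {e : ZMod (q * m)} {x : GaussLetter}
    (h : cyclicLetter u e = some x) : ∃ h : e.val < u.length, u[e.val] = x :=
  List.getElem?_eq_some_iff.1 h

theorem exists_cyclicLetter [NeZero (q * m)] (hlen : u.length = q * m) {x : GaussLetter}
    (hx : x ∈ u) : ∃ e : ZMod (q * m), cyclicLetter u e = some x := by
  obtain ⟨i, hi, rfl⟩ := List.mem_iff_getElem.1 hx
  refine ⟨(i : ZMod (q * m)), ?_⟩
  rw [cyclicLetter, ZMod.val_cast_of_lt (hlen ▸ hi), List.getElem?_eq_getElem hi]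

theorem cyclicLetter_inj [NeZero (q * m)] (hV : Valid [u]) {e e' : ZMod (q * m)}
    {x y : GaussLetter} (h : cyclicLetter u e = some x) (h' : cyclicLetter u e' = some y)
    (ho : x.isOver = y.isOver) (hl : x.label = y.label) : e = e' := by
  obtain ⟨h1, rfl⟩ := cyclicLetter_eq_some h
  obtain ⟨h2, rfl⟩ := cyclicLetter_eq_some h'
  exact ZMod.val_injective _ (hV.eq_of_label_eq h1 h2 ho hl)

/-- This provides the overpass by which the sheet of both ends of a chord is defined; validity of
the code guarantees it. -/
theorem exists_over [NeZero (q * m)] (hV : Valid [u]) (hlen : u.length = q * m)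
    (e : ZMod (q * m)) : ∃ (o : ZMod (q * m)) (x y : GaussLetter), cyclicLetter u e = some x ∧
      cyclicLetter u o = some y ∧ y.isOver = true ∧ y.label = x.label := by
  have he : e.val < u.length := (ZMod.val_lt e).trans_eq hlen.symm
  have h1 : cyclicLetter u e = some u[e.val] := List.getElem?_eq_getElem he
  rcases hb : u[e.val].isOver with _ | _
  · obtain ⟨o, ho⟩ := exists_cyclicLetter hlen (hV.partner_mem (List.getElem_mem he))
    exact ⟨o, _, _, h1, ho, by simp [hb], rfl⟩
  · exact ⟨e, _, _, h1, h1, hb, rfl⟩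

/-- The periodic Gauss diagram of a periodic word.  The sheet of a point is the block that contains
the overpass of its crossing. -/
noncomputable def ofWord [NeZero (q * m)] (hV : Valid [u]) (hlen : u.length = q * m)
    (hu : u.rotate m = u.map (relabel f)) : PeriodicGaussDiagram q (ZMod (q * m)) where
  next := Equiv.addRight 1
  turn := Equiv.addRight (m : ZMod (q * m))
  sheet e := (((exists_over hV hlen e).choose.val / m : ℕ) : ZMod q)
  letter := cyclicLetter u
  commute := by ext1 e; simp [add_right_comm]
  turn_pow := by
    ext1 e
    rw [Equiv.addRight_pow_apply, nsmul_eq_mul, ← Nat.cast_mul, ZMod.natCast_self, add_zero]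
    rfl
  sheet_turn e := by
    obtain ⟨x, y, h1, h2, h3, h4⟩ := (exists_over hV hlen e).choose_spec
    obtain ⟨x', y', h1', h2', h3', h4'⟩ :=
      (exists_over hV hlen (Equiv.addRight (m : ZMod (q * m)) e)).choose_spec
    have hm : 0 < m := Nat.pos_of_ne_zero fun h => NeZero.ne (q * m) (by simp [h])
    -- The shift carries the overpass of a crossing to the overpass of the shifted crossing, because
    -- both ends are renumbered by the same `f`.
    have h5 : (exists_over hV hlen (Equiv.addRight (m : ZMod (q * m)) e)).choose =
        (exists_over hV hlen e).choose + m := by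
      rw [Equiv.coe_addRight, cyclicLetter_add hlen hu, h1] at h1'
      cases h1'
      refine cyclicLetter_inj hV h2' (by rw [cyclicLetter_add hlen hu, h2]; rfl) ?_ ?_
      · rw [h3']; exact h3.symm
      · rw [h4']; exact (congrArg f h4).symm
    -- Reducing a position modulo `q * m` changes its block number only modulo `q`.
    rw [h5, val_add_shift, Nat.mod_mul_left_div_self, Nat.add_div_right _ hm, ZMod.natCast_mod]
    push_cast
    rfl
  partner e x h := by
    obtain ⟨h1, rfl⟩ := cyclicLetter_eq_some h
    exact exists_cyclicLetter hlen (hV.partner_mem (List.getElem_mem h1))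
  letter_inj e e' x y h h' h1 h2 := cyclicLetter_inj hV h h' h1 h2
  sheet_eq e e' x y h h' hxy := by
    obtain ⟨x₁, y₁, h1, h2, h3, h4⟩ := (exists_over hV hlen e).choose_spec
    obtain ⟨x₂, y₂, h1', h2', h3', h4'⟩ := (exists_over hV hlen e').choose_spec
    rw [h] at h1; cases h1
    rw [h'] at h1'; cases h1'
    rw [cyclicLetter_inj hV h2 h2' (h3.trans h3'.symm) (by rw [h4, h4', hxy])]
  turn_letter e x h := by
    rw [Equiv.coe_addRight, cyclicLetter_add hlen hu, h]
    exact ⟨_, rfl⟩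
  turn_label e e' x y x' y' h h' hxy h1 h2 := by
    rw [Equiv.coe_addRight, cyclicLetter_add hlen hu, h] at h1
    rw [Equiv.coe_addRight, cyclicLetter_add hlen hu, h'] at h2
    cases h1; cases h2
    exact congrArg f hxy

end Word

/-- A periodic Gauss code of a knot is the Gauss code of the closure of a power of a virtual
braid. -/
theorem IsPeriodicWord.exists_braidWord {q : ℕ} (hq : 1 ≤ q) (h : IsPeriodicWord q u)
    (hV : Valid [u]) : ∃ (k : ℕ) (w : BraidWord k), Same [u] (w.power q).closureCode := by
  obtain ⟨m, f, hlen, hu⟩ := h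
  rcases Nat.eq_zero_or_pos m with rfl | hm
  -- Empty blocks leave no points to work with; the circle without crossings is the closure of the
  -- trivial braid on one strand.
  · obtain rfl : u = [] := List.length_eq_zero_iff.1 (by simpa using hlen)
    refine ⟨1, [], ?_⟩
    convert Same.refl _
    simp [BraidWord.power, BraidWord.closureCode, BraidWord.componentWord, BraidWord.strandWord,
      List.finRange_succ]
  · have : NeZero (q * m) := ⟨by positivity⟩
    have hpow : ∀ i : ℕ, ((ofWord hV hlen hu).next ^ i) 0 = (i : ZMod (q * m)) := by
      intro i
      simp [ofWord]
    have hT : (ofWord hV hlen hu).next.IsTransversal [0] := by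
      refine ⟨fun e => ⟨0, by simp, (e.val : ℕ), ?_⟩, by simp⟩
      rw [zpow_natCast, hpow, ZMod.natCast_zmod_val]
    obtain ⟨k, w, hw⟩ := (ofWord hV hlen hu).exists_braidWord hq hT
    refine ⟨k, w, ?_⟩
    convert hw
    rw [List.map_singleton, PeriodicGaussDiagram.word, Equiv.Perm.cycleWord]
    have hmin : Function.minimalPeriod (ofWord hV hlen hu).next 0 = q * m := by
      refine Nat.dvd_antisymm ?_ ?_
      · apply Function.IsPeriodicPt.minimalPeriod_dvd
        change (ofWord hV hlen hu).next^[_] 0 = 0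
        rw [← Equiv.Perm.coe_pow, hpow, ZMod.natCast_self]
      · have := Equiv.Perm.pow_minimalPeriod (N := (ofWord hV hlen hu).next) 0
        rwa [hpow, ZMod.natCast_eq_zero_iff] at this
    rw [hmin]
    congr 1
    have h1 : ∀ i ∈ List.range (q * m),
        ((ofWord hV hlen hu).letter (((ofWord hV hlen hu).next ^ i) 0)).toList =
          (u[i]?).toList := by
      intro i hi
      rw [hpow]
      change (u[ZMod.val _]?).toList = _
      rw [ZMod.val_cast_of_lt (List.mem_range.1 hi)]
    rw [List.flatMap_congr h1, ← hlen]
    clear h1 hmin hw hT hpow hu hV hlen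
    induction u with
    | nil => rfl
    | cons x u ih => simp [List.flatMap_range_succ, ← ih]

end GaussCode

/-! ### Marked points on circles -/

/-- `y` is the first point of `S` after `t`. -/
def IsNext (S : Set ℝ) (t y : ℝ) : Prop := t < y ∧ y ∈ S ∧ ∀ s ∈ S, t < s → y ≤ s

theorem IsNext.unique {S : Set ℝ} {t y y' : ℝ} (h : IsNext S t y) (h' : IsNext S t y') : y = y' :=
  le_antisymm (h.2.2 _ h'.2.1 h'.1) (h'.2.2 _ h.2.1 h.1)

theorem IsNext.map {S S' : Set ℝ} {t y : ℝ} (h : IsNext S t y) {φ : ℝ → ℝ} (hφ : StrictMono φ)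
    (hsurj : φ.Surjective) (hS : ∀ s, φ s ∈ S' ↔ s ∈ S) : IsNext S' (φ t) (φ y) := by
  refine ⟨hφ h.1, (hS y).2 h.2.1, fun s hs hts => ?_⟩
  obtain ⟨s, rfl⟩ := hsurj s
  exact hφ.monotone (h.2.2 s ((hS s).1 hs) (hφ.lt_iff_lt.1 hts))

/-- A finite nonempty set of points on each of `n` circles `ℝ / ℤ`. -/
structure MarkedCircles (n : ℕ) where
  S : Fin n → Set ℝ
  add_one : ∀ c t, t + 1 ∈ S c ↔ t ∈ S c
  finite : ∀ c, {t | t ∈ Set.Ico (0 : ℝ) 1 ∧ t ∈ S c}.Finite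
  nonempty : ∀ c, (S c).Nonempty

namespace MarkedCircles

variable {n : ℕ} (A : MarkedCircles n) (c : Fin n)

theorem add_int (m : ℤ) (t : ℝ) : t + m ∈ A.S c ↔ t ∈ A.S c :=
  ListsFrom.mem_add_int (A.add_one c) m t

theorem fract_mem (t : ℝ) : Int.fract t ∈ A.S c ↔ t ∈ A.S c := by
  rw [← A.add_int c ⌊t⌋ (Int.fract t), Int.fract_add_floor]

theorem finite_Ioc (t : ℝ) : {s | s ∈ Set.Ioc t (t + 1) ∧ s ∈ A.S c}.Finite := by
  refine Set.Finite.of_injOn (f := Int.fract) (fun s hs => ?_) ?_ (A.finite c)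
  · exact ⟨⟨Int.fract_nonneg s, Int.fract_lt_one s⟩, (A.fract_mem c s).2 hs.2⟩
  · rintro x ⟨⟨h1, h2⟩, -⟩ y ⟨⟨h3, h4⟩, -⟩ h
    obtain ⟨z, hz⟩ := Int.fract_eq_fract.1 h
    have h5 : (z : ℝ) < 1 := by linarith
    have h6 : (-1 : ℝ) < z := by linarith
    have : z = 0 := by
      have : z < 1 := by exact_mod_cast h5
      have : -1 < z := by exact_mod_cast h6
      omega
    rw [this, Int.cast_zero] at hz
    linarith

theorem exists_next (t : ℝ) : ∃ y, IsNext (A.S c) t y := by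
  obtain ⟨s, hs⟩ := A.nonempty c
  have hne : {s | s ∈ Set.Ioc t (t + 1) ∧ s ∈ A.S c}.Nonempty := by
    refine ⟨s + (⌊t - s⌋ + 1 : ℤ), ⟨?_, ?_⟩, (A.add_int c _ s).2 hs⟩
    · have := Int.lt_floor_add_one (t - s); push_cast; linarith
    · have := Int.floor_le (t - s); push_cast; linarith
  obtain ⟨y, hy, hmin⟩ := Set.exists_min_image _ id (A.finite_Ioc c t) hne
  refine ⟨y, hy.1.1, hy.2, fun s hs hts => ?_⟩
  by_cases h : s ≤ t + 1
  · exact hmin s ⟨⟨hts, h⟩, hs⟩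
  · linarith [hy.1.2]

/-- The first marked point after `t`. -/
noncomputable def nxt (t : ℝ) : ℝ := (A.exists_next c t).choose

theorem isNext_nxt (t : ℝ) : IsNext (A.S c) t (A.nxt c t) := (A.exists_next c t).choose_spec

theorem nxt_add_int (t : ℝ) (m : ℤ) : A.nxt c (t + m) = A.nxt c t + m :=
  (A.isNext_nxt c (t + m)).unique ((A.isNext_nxt c t).map (φ := (· + (m : ℝ)))
    (fun _ _ h => by simpa using h) (fun s => ⟨s - m, by simp⟩) (A.add_int c m))

theorem fract_nxt_fract (t : ℝ) : Int.fract (A.nxt c (Int.fract t)) = Int.fract (A.nxt c t) := by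
  conv_rhs => rw [← Int.fract_add_floor t, A.nxt_add_int, Int.fract_add_intCast]

theorem nxt_injOn : Set.InjOn (A.nxt c) (A.S c) := by
  intro s hs t ht h
  rcases lt_trichotomy s t with h1 | h1 | h1
  · have := (A.isNext_nxt c s).2.2 t ht h1
    have := (A.isNext_nxt c t).1
    linarith
  · exact h1
  · have := (A.isNext_nxt c t).2.2 s hs h1
    have := (A.isNext_nxt c s).1
    linarith

theorem strictMono_iterate_nxt (t : ℝ) : StrictMono fun i => (A.nxt c)^[i] t :=
  strictMono_nat_of_lt_succ fun i => by
    rw [Function.iterate_succ_apply']; exact (A.isNext_nxt c _).1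

theorem iterate_nxt_mem {t : ℝ} (ht : t ∈ A.S c) (i : ℕ) : (A.nxt c)^[i] t ∈ A.S c := by
  cases i with
  | zero => exact ht
  | succ i => rw [Function.iterate_succ_apply']; exact (A.isNext_nxt c _).2.1

/-- Iteration of `nxt` skips no marked point. -/
theorem exists_iterate_nxt {t s : ℝ} (hs : s ∈ A.S c) (h : t ≤ s) {i : ℕ}
    (hi : s < (A.nxt c)^[i] t) : ∃ j < i, (A.nxt c)^[j] t = s := by
  induction i with
  | zero => exact absurd hi (not_lt.2 h)
  | succ i ih =>
    by_cases h1 : s < (A.nxt c)^[i] t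
    · obtain ⟨j, hj, hjs⟩ := ih h1
      exact ⟨j, by omega, hjs⟩
    · rcases (not_lt.1 h1).eq_or_lt with h2 | h2
      · exact ⟨i, by omega, h2⟩
      · rw [Function.iterate_succ_apply'] at hi
        exact absurd ((A.isNext_nxt c _).2.2 s hs h2) (not_le.2 hi)

/-- After finitely many steps one returns to the point from which one started. -/
theorem exists_iterate_nxt_eq_add_one {t : ℝ} (ht : t ∈ A.S c) :
    ∃ m, 0 < m ∧ (A.nxt c)^[m] t = t + 1 := by
  obtain ⟨i, hi⟩ : ∃ i, t + 1 < (A.nxt c)^[i + 1] t := by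
    by_contra! h
    refine Set.infinite_of_injective_forall_mem (f := fun i => (A.nxt c)^[i + 1] t)
      ((A.strictMono_iterate_nxt c t).injective.comp (add_left_injective 1))
      (s := {s | s ∈ Set.Ioc t (t + 1) ∧ s ∈ A.S c})
      (fun i => ⟨⟨?_, h i⟩, A.iterate_nxt_mem c ht _⟩) (A.finite_Ioc c t)
    exact A.strictMono_iterate_nxt c t (Nat.succ_pos i)
  obtain ⟨m, -, hm⟩ := A.exists_iterate_nxt c ((A.add_one c t).2 ht) (by linarith) hi
  refine ⟨m, Nat.pos_of_ne_zero ?_, hm⟩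
  rintro rfl
  simp at hm

/-- The marked points. -/
abbrev Point : Type := {x : Fin n × ℝ // x.2 ∈ Set.Ico (0 : ℝ) 1 ∧ x.2 ∈ A.S x.1}

instance : Finite A.Point := by
  have : {x : Fin n × ℝ | x.2 ∈ Set.Ico (0 : ℝ) 1 ∧ x.2 ∈ A.S x.1} ⊆
      ⋃ c, (Prod.mk c) '' {t | t ∈ Set.Ico (0 : ℝ) 1 ∧ t ∈ A.S c} := by
    rintro ⟨c, t⟩ h
    exact Set.mem_iUnion.2 ⟨c, t, h, rfl⟩
  exact ((Set.finite_iUnion fun c => (A.finite c).image _).subset this).to_subtype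

variable {A c}

/-- The marked point on the circle `c` with lift `t`. -/
noncomputable def mkPoint {c : Fin n} {t : ℝ} (h : t ∈ A.S c) : A.Point :=
  ⟨(c, Int.fract t), ⟨Int.fract_nonneg t, Int.fract_lt_one t⟩, (A.fract_mem c t).2 h⟩

theorem mkPoint_eq_iff {c c' : Fin n} {t t' : ℝ} (h : t ∈ A.S c) (h' : t' ∈ A.S c') :
    mkPoint h = mkPoint h' ↔ c = c' ∧ ∃ m : ℤ, t' = t + m := by
  simp only [mkPoint, Subtype.mk.injEq, Prod.mk.injEq]
  refine and_congr_right fun _ => ?_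
  rw [eq_comm, Int.fract_eq_fract]
  exact exists_congr fun z => ⟨fun h => by linarith, fun h => by linarith⟩

theorem mkPoint_self (x : A.Point) : mkPoint x.2.2 = x := by
  apply Subtype.ext
  exact Prod.ext rfl (Int.fract_eq_self.2 x.2.1)

theorem exists_mkPoint (x : A.Point) : ∃ (c : Fin n) (t : ℝ) (h : t ∈ A.S c), x = mkPoint h :=
  ⟨x.1.1, x.1.2, x.2.2, (mkPoint_self x).symm⟩

variable (A)

/-- Passing from each marked point to the next one on its circle. -/
noncomputable def nextPerm : Equiv.Perm A.Point :=
  Equiv.ofBijective (fun x => mkPoint (A.isNext_nxt x.1.1 x.1.2).2.1)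
    (Finite.injective_iff_bijective.1 (by
      rintro ⟨⟨c, t⟩, h1, h2⟩ ⟨⟨c', t'⟩, h1', h2'⟩ h
      obtain ⟨h3, m, h4⟩ := (mkPoint_eq_iff _ _).1 h
      dsimp only at h3 h4
      subst h3
      rw [← A.nxt_add_int] at h4
      have h5 := A.nxt_injOn c h2' ((A.add_int c m t).2 h2) h4
      have := (mkPoint_eq_iff h2 h2').2 ⟨rfl, m, h5⟩
      rwa [mkPoint_self ⟨(c, t), h1, h2⟩, mkPoint_self ⟨(c, t'), h1', h2'⟩] at this))

variable {A}

theorem nextPerm_mkPoint {t : ℝ} (h : t ∈ A.S c) :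
    A.nextPerm (mkPoint h) = mkPoint (A.isNext_nxt c t).2.1 := by
  apply Subtype.ext
  exact Prod.ext rfl (A.fract_nxt_fract c t)

theorem nextPerm_pow_mkPoint {t : ℝ} (h : t ∈ A.S c) (i : ℕ) :
    (A.nextPerm ^ i) (mkPoint h) = mkPoint (A.iterate_nxt_mem c h i) := by
  induction i with
  | zero => rfl
  | succ i ih =>
    rw [pow_succ', Equiv.Perm.mul_apply, ih, nextPerm_mkPoint]
    apply Subtype.ext
    refine Prod.ext rfl ?_
    simp only [mkPoint, Function.iterate_succ_apply']

/-- A return on the circle advances the lift by a positive integer, hence by at least 1; the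
translate `t + 1` is itself marked and is not skipped. -/
theorem iterate_minimalPeriod {t : ℝ} (h : t ∈ A.S c) :
    (A.nxt c)^[Function.minimalPeriod A.nextPerm (mkPoint h)] t = t + 1 := by
  obtain ⟨m, hm, hmt⟩ := A.exists_iterate_nxt_eq_add_one c h
  have h1 := Equiv.Perm.pow_minimalPeriod (N := A.nextPerm) (mkPoint h)
  have h2 := Equiv.Perm.minimalPeriod_pos_of_finite (N := A.nextPerm) (mkPoint h)
  suffices Function.minimalPeriod A.nextPerm (mkPoint h) = m by rw [this, hmt]
  apply le_antisymm
  · apply Function.IsPeriodicPt.minimalPeriod_le hm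
    change A.nextPerm^[m] _ = _
    rw [← Equiv.Perm.coe_pow, nextPerm_pow_mkPoint, mkPoint_eq_iff]
    exact ⟨rfl, -1, by rw [hmt]; push_cast; ring⟩
  · rw [nextPerm_pow_mkPoint, mkPoint_eq_iff] at h1
    obtain ⟨-, z, hz⟩ := h1
    have h3 := A.strictMono_iterate_nxt c t h2
    simp only [Function.iterate_zero, id] at h3
    have h4 : (z : ℝ) < 0 := by linarith
    have h5 : z ≤ -1 := by
      have : z < 0 := by exact_mod_cast h4
      omega
    have h6 : (z : ℝ) ≤ -1 := by exact_mod_cast h5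
    refine (A.strictMono_iterate_nxt c t).le_iff_le.1 ?_
    rw [hmt]; linarith

/-- The marked points in `[t, t + 1)`. -/
theorem listsFrom {t : ℝ} (h : t ∈ A.S c) : ListsFrom (A.S c) t
    ((List.range (Function.minimalPeriod A.nextPerm (mkPoint h))).map fun i =>
      (A.nxt c)^[i] t) := by
  have hm := iterate_minimalPeriod h
  have hmono := A.strictMono_iterate_nxt c t
  constructor
  · rw [List.pairwise_map]
    exact List.pairwise_lt_range.imp fun h => hmono h
  · intro s
    simp only [List.mem_map, List.mem_range, Set.mem_Ico]
    constructor
    · rintro ⟨i, hi, rfl⟩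
      refine ⟨⟨?_, ?_⟩, A.iterate_nxt_mem c h i⟩
      · exact hmono.monotone (Nat.zero_le i)
      · rw [← hm]; exact hmono hi
    · rintro ⟨⟨h1, h2⟩, h3⟩
      rw [← hm] at h2
      exact A.exists_iterate_nxt c h3 h1 h2

theorem pow_apply_fst (i : ℕ) (x : A.Point) : ((A.nextPerm ^ i) x).1.1 = x.1.1 := by
  obtain ⟨c, t, h, rfl⟩ := exists_mkPoint x
  rw [nextPerm_pow_mkPoint]
  rfl

/-- The cycles of `nextPerm` are the circles: it never leaves a circle and reaches every marked
point on it. -/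
theorem isTransversal {b : Fin n → ℝ} (hb : ∀ c, b c ∈ A.S c) :
    A.nextPerm.IsTransversal ((List.finRange n).map fun c => mkPoint (hb c)) := by
  constructor
  · intro x
    obtain ⟨c, t, h, rfl⟩ := exists_mkPoint x
    refine ⟨mkPoint (hb c), List.mem_map_of_mem (List.mem_finRange c), ?_⟩
    have h1 := Int.floor_le (t - b c)
    have h2 := Int.lt_floor_add_one (t - b c)
    obtain ⟨i, -, hi⟩ := List.mem_map.1 (((listsFrom (hb c)).2 (t + (-⌊t - b c⌋ : ℤ))).2
      ⟨⟨by push_cast; linarith, by push_cast; linarith⟩, (A.add_int c _ t).2 h⟩)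
    refine ⟨(i : ℕ), ?_⟩
    rw [zpow_natCast, nextPerm_pow_mkPoint, mkPoint_eq_iff]
    exact ⟨rfl, ⌊t - b c⌋, by rw [hi]; push_cast; ring⟩
  · rw [List.pairwise_map]
    refine (List.nodup_finRange n).imp fun {a b} hab h => hab ?_
    obtain ⟨i, -, -, hi⟩ := h.exists_pow_eq''
    have := congrArg (fun x : A.Point => x.1.1) hi
    rw [pow_apply_fst] at this
    exact this

/-- A homeomorphism of the circles that permutes the marked points. -/
noncomputable def turnPerm (π : Equiv.Perm (Fin n)) (φ : Fin n → ℝ → ℝ)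
    (hφ : ∀ c, StrictMono (φ c)) (hφ1 : ∀ c (t : ℝ) (m : ℤ), φ c (t + m) = φ c t + m)
    (hS : ∀ c t, φ c t ∈ A.S (π c) ↔ t ∈ A.S c) : Equiv.Perm A.Point :=
  Equiv.ofBijective (fun x => mkPoint ((hS x.1.1 x.1.2).2 x.2.2))
    (Finite.injective_iff_bijective.1 (by
      rintro ⟨⟨c, t⟩, h1, h2⟩ ⟨⟨c', t'⟩, h1', h2'⟩ h
      obtain ⟨h3, m, h4⟩ := (mkPoint_eq_iff _ _).1 h
      dsimp only at h3 h4
      obtain rfl := π.injective h3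
      rw [← hφ1] at h4
      have := (mkPoint_eq_iff h2 h2').2 ⟨rfl, m, (hφ c).injective h4⟩
      rwa [mkPoint_self ⟨(c, t), h1, h2⟩, mkPoint_self ⟨(c, t'), h1', h2'⟩] at this))

section Turn

variable {π : Equiv.Perm (Fin n)} {φ : Fin n → ℝ → ℝ}
    (hφ : ∀ c, StrictMono (φ c)) (hφ1 : ∀ c (t : ℝ) (m : ℤ), φ c (t + m) = φ c t + m)
    (hS : ∀ c t, φ c t ∈ A.S (π c) ↔ t ∈ A.S c)

theorem turnPerm_mkPoint {t : ℝ} (h : t ∈ A.S c) :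
    turnPerm π φ hφ hφ1 hS (mkPoint h) = mkPoint ((hS c t).2 h) := by
  refine (mkPoint_eq_iff ((hS c (Int.fract t)).2 ((A.fract_mem c t).2 h)) _).2 ⟨rfl, ⌊t⌋, ?_⟩
  rw [← hφ1, Int.fract_add_floor]

/-- An increasing bijection that respects the marked points carries the next point to the next
point. -/
theorem commute_turnPerm (hsurj : ∀ c, (φ c).Surjective) :
    Commute A.nextPerm (turnPerm π φ hφ hφ1 hS) := by
  ext1 x
  obtain ⟨c, t, h, rfl⟩ := exists_mkPoint x
  rw [Equiv.Perm.mul_apply, Equiv.Perm.mul_apply, turnPerm_mkPoint, nextPerm_mkPoint,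
    nextPerm_mkPoint, turnPerm_mkPoint, mkPoint_eq_iff]
  refine ⟨rfl, 0, ?_⟩
  rw [Int.cast_zero, add_zero]
  exact ((A.isNext_nxt c t).map (hφ c) (hsurj c) (hS c)).unique (A.isNext_nxt _ _)

end Turn

end MarkedCircles

/-! ### Periodic diagrams -/

/-- The rotation by `2π/q`. -/
noncomputable abbrev rotationFactor (q : ℕ) : ℂ := Complex.exp (2 * Real.pi * Complex.I / q)

theorem rotationFactor_pow {q : ℕ} (hq : 1 ≤ q) : rotationFactor q ^ q = 1 := by
  have : (q : ℂ) ≠ 0 := by exact_mod_cast (by omega : q ≠ 0)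
  rw [rotationFactor, ← Complex.exp_nat_mul, mul_div_cancel₀ _ this, Complex.exp_two_pi_mul_I]

theorem planeCross_smul (x y : ℝ) (z w : ℂ) :
    planeCross (x * z) (y * w) = x * y * planeCross z w := by
  simp [planeCross]; ring

theorem planeCross_mul_left (a z w : ℂ) :
    planeCross (a * z) (a * w) = Complex.normSq a * planeCross z w := by
  simp [planeCross, Complex.normSq_apply]; ring

/-- The sector of the plane in which a point lies. -/
noncomputable def sector (q : ℕ) (z : ℂ) : ZMod q :=
  ((⌊q * Complex.arg z / (2 * Real.pi)⌋ : ℤ) : ZMod q)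

/-- The argument grows by 2π/q up to a multiple m of 2π. Measured in units of 2π/q it grows by 1 + q
* m, which is 1 modulo q whatever the branch of the argument. -/
theorem sector_rotate {q : ℕ} (hq : 1 ≤ q) {z : ℂ} (hz : z ≠ 0) :
    sector q (rotationFactor q * z) = sector q z + 1 := by
  have hq' : (q : ℝ) ≠ 0 := by exact_mod_cast (by omega : q ≠ 0)
  have hqc : (q : ℂ) ≠ 0 := by exact_mod_cast (by omega : q ≠ 0)
  have hnorm : ‖rotationFactor q‖ = 1 := by
    have : rotationFactor q = Complex.exp ((2 * Real.pi / q : ℝ) * Complex.I) := by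
      rw [rotationFactor]; congr 1; push_cast; ring
    rw [this, Complex.norm_exp_ofReal_mul_I]
  obtain ⟨m, hm⟩ : ∃ m : ℤ, Complex.arg (rotationFactor q * z) =
      Complex.arg z + 2 * Real.pi / q + m * (2 * Real.pi) := by
    have h1 := Complex.norm_mul_exp_arg_mul_I (rotationFactor q * z)
    have h2 := Complex.norm_mul_exp_arg_mul_I z
    rw [norm_mul, hnorm, one_mul] at h1
    nth_rewrite 3 [← h2] at h1
    rw [mul_left_comm] at h1
    have h3 := mul_left_cancel₀ (by exact_mod_cast norm_ne_zero_iff.2 hz) h1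
    rw [rotationFactor, ← Complex.exp_add, Complex.exp_eq_exp_iff_exists_int] at h3
    obtain ⟨m, hm⟩ := h3
    refine ⟨m, ?_⟩
    have h4 := congrArg Complex.im hm
    have e1 : 2 * (Real.pi : ℂ) * Complex.I / q = ((2 * Real.pi / q : ℝ) : ℂ) * Complex.I := by
      push_cast; ring
    have e2 : (m : ℂ) * (2 * Real.pi * Complex.I) = ((m * (2 * Real.pi) : ℝ) : ℂ) * Complex.I := by
      push_cast; ring
    rw [← rotationFactor, e1, e2] at h4
    simp only [Complex.add_im, Complex.im_ofReal_mul, Complex.I_im, mul_one] at h4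
    linarith
  have : q * Complex.arg (rotationFactor q * z) / (2 * Real.pi) =
      q * Complex.arg z / (2 * Real.pi) + ((1 + q * m : ℤ) : ℝ) := by
    rw [hm]
    push_cast
    have := Real.pi_ne_zero
    field_simp
    ring
  rw [sector, this, Int.floor_add_intCast, sector]
  push_cast
  simp

theorem finite_pow_mem {q : ℕ} (hq : 1 ≤ q) {Z : Set ℂ} (hZ : Z.Finite) :
    {z : ℂ | z ^ q ∈ Z}.Finite := by
  classical
  refine hZ.preimage' (f := fun z : ℂ => z ^ q) fun a _ => ?_
  refine (Polynomial.nthRoots q a).toFinset.finite_toSet.subset fun z hz => ?_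
  simpa [Polynomial.mem_nthRoots hq] using hz

namespace VirtualLinkDiagram

variable {D : VirtualLinkDiagram}

theorem exists_regular (c : Fin D.n) : ∃ t, D.mark c t = Mark.regular := by
  by_contra! h
  refine (Set.Ico_infinite (zero_lt_one' ℝ)) ((D.finite_crossings c).subset fun t ht => ⟨ht, h t⟩)

theorem letterAt_add_int {ν : Fin D.n → ℝ → ℕ} (hν : D.IsNumbering ν) (c : Fin D.n) (t : ℝ)
    (ht : D.IsClassical c t) (m : ℤ) : D.letterAt ν c (t + m) = D.letterAt ν c t :=
  ListsFrom.apply_add_int (S := {t | D.IsClassical c t}) (isClassical_add_one c)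
    (fun t ht => letterAt_add_one hν c t ht) m t ht

/-- The classical crossings and the points in the rotation orbits of the points `r c`. -/
noncomputable def markedCircles (q : ℕ) (hq : 1 ≤ q) (r : Fin D.n → ℝ)
    (hr : ∀ c, D.mark c (r c) = Mark.regular) : MarkedCircles D.n where
  -- The regular points give a marked point also on circles without classical crossings. Membership
  -- is tested on q-th powers, which the rotation preserves; virtual crossings are excluded so that
  -- image and mark determine the source point.
  S c := {t | D.IsClassical c t ∨
    (D.mark c t = Mark.regular ∧ D.γ c t ^ q ∈ Set.range fun c => D.γ c (r c) ^ q)}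
  add_one c t := by
    simp only [Set.mem_ofPred_eq, isClassical_add_one, D.mark_periodic c t, D.γ_periodic c t]
  finite c := by
    have h1 : {t | t ∈ Set.Ico (0 : ℝ) 1 ∧ (D.mark c t = Mark.regular ∧
        D.γ c t ^ q ∈ Set.range fun c => D.γ c (r c) ^ q)}.Finite := by
      refine Set.Finite.of_injOn (f := D.γ c) (fun t ht => ht.2.2) ?_
        (finite_pow_mem hq (Set.finite_range _))
      rintro t ⟨⟨h1, h2⟩, h3, -⟩ t' ⟨⟨h1', h2'⟩, -⟩ h
      obtain ⟨-, m, rfl⟩ := (D.regular_iff c t).1 h3 c t' h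
      have h3 : (m : ℝ) < 1 := by linarith
      have h4 : (-1 : ℝ) < m := by linarith
      have : m = 0 := by
        have : m < 1 := by exact_mod_cast h3
        have : -1 < m := by exact_mod_cast h4
        omega
      simp [this]
    refine ((D.finite_crossings c).union h1).subset ?_
    rintro t ⟨h2, h3 | h3⟩
    · refine Or.inl ⟨h2, fun h4 => ?_⟩
      rcases h3 with h | h <;> rw [h] at h4 <;> cases h4
    · exact Or.inr ⟨h2, h3⟩
  nonempty c := ⟨r c, Or.inr ⟨hr c, c, rfl⟩⟩

/-! ### Derivatives and crossing signs under the rotation. -/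

section Rotation

variable {q : ℕ} {π : Equiv.Perm (Fin D.n)} {φ : Fin D.n → ℝ → ℝ}

theorem deriv_rotate (hφ : ∀ c, ContDiff ℝ ∞ (φ c) ∧ (∀ t, 0 < deriv (φ c) t) ∧
      ∀ t, φ c (t + 1) = φ c t + 1)
    (h : ∀ c t, D.γ (π c) (φ c t) = rotationFactor q * D.γ c t ∧
      D.mark (π c) (φ c t) = D.mark c t) (c : Fin D.n) (t : ℝ) :
    rotationFactor q * deriv (D.γ c) t =
      ((deriv (φ c) t : ℝ) : ℂ) * deriv (D.γ (π c)) (φ c t) := by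
  have h1 : HasDerivAt (D.γ c) (deriv (D.γ c) t) t :=
    ((D.smooth c).differentiable (by simp)).differentiableAt.hasDerivAt
  have h2 : HasDerivAt (D.γ (π c)) (deriv (D.γ (π c)) (φ c t)) (φ c t) :=
    ((D.smooth _).differentiable (by simp)).differentiableAt.hasDerivAt
  have h3 : HasDerivAt (φ c) (deriv (φ c) t) t :=
    (((hφ c).1).differentiable (by simp)).differentiableAt.hasDerivAt
  have h4 := h2.scomp t h3
  have h5 := h1.const_mul (rotationFactor q)
  have h6 : D.γ (π c) ∘ φ c = fun s => rotationFactor q * D.γ c s := funext fun s => (h c s).1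
  rw [h6] at h4
  rw [h5.unique h4, Complex.real_smul]

/-- The rotation multiplies the cross product by the positive squared modulus of its factor, and the
reparametrizations change it by positive derivatives. -/
theorem planeCross_rotate (hφ : ∀ c, ContDiff ℝ ∞ (φ c) ∧ (∀ t, 0 < deriv (φ c) t) ∧
      ∀ t, φ c (t + 1) = φ c t + 1)
    (h : ∀ c t, D.γ (π c) (φ c t) = rotationFactor q * D.γ c t ∧
      D.mark (π c) (φ c t) = D.mark c t) (c c' : Fin D.n) (t t' : ℝ) :
    0 < planeCross (deriv (D.γ (π c)) (φ c t)) (deriv (D.γ (π c')) (φ c' t')) ↔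
      0 < planeCross (deriv (D.γ c) t) (deriv (D.γ c') t') := by
  have h1 := planeCross_mul_left (rotationFactor q) (deriv (D.γ c) t) (deriv (D.γ c') t')
  rw [deriv_rotate hφ h, deriv_rotate hφ h, planeCross_smul] at h1
  have h2 : 0 < Complex.normSq (rotationFactor q) := Complex.normSq_pos.2 (Complex.exp_ne_zero _)
  have h3 := mul_pos ((hφ c).2.1 t) ((hφ c').2.1 t')
  rw [← mul_pos_iff_of_pos_left h3, h1, mul_pos_iff_of_pos_left h2]

theorem lift_add_int (hφ : ∀ t, φ c (t + 1) = φ c t + 1) (t : ℝ) (m : ℤ) :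
    φ c (t + m) = φ c t + m := by
  induction m using Int.induction_on generalizing t with
  | zero => simp
  | succ m ih => push_cast at ih ⊢; rw [← add_assoc, hφ, ih]; ring
  | pred m ih =>
    push_cast at ih ⊢
    have := hφ (t + (-(m : ℝ) - 1))
    rw [show t + (-(m : ℝ) - 1) + 1 = t + -m by ring, ih] at this
    linarith

theorem lift_surjective (hφc : Continuous (φ c)) (hφ : ∀ t, φ c (t + 1) = φ c t + 1) :
    (φ c).Surjective := by
  intro y
  refine mem_range_of_exists_le_of_exists_ge hφc ⟨0 + (⌊y - φ c 0⌋ : ℤ), ?_⟩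
    ⟨0 + (⌊y - φ c 0⌋ + 1 : ℤ), ?_⟩
  · rw [lift_add_int hφ]
    have := Int.floor_le (y - φ c 0); linarith
  · rw [lift_add_int hφ]
    have := Int.lt_floor_add_one (y - φ c 0); push_cast; linarith

theorem isPositive_rotate (hφ : ∀ c, ContDiff ℝ ∞ (φ c) ∧ (∀ t, 0 < deriv (φ c) t) ∧
      ∀ t, φ c (t + 1) = φ c t + 1)
    (h : ∀ c t, D.γ (π c) (φ c t) = rotationFactor q * D.γ c t ∧
      D.mark (π c) (φ c t) = D.mark c t) (c : Fin D.n) (t : ℝ) :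
    D.IsPositive (π c) (φ c t) ↔ D.IsPositive c t := by
  have key : ∀ c' t', (D.γ (π c) (φ c t) = D.γ (π c') (φ c' t') ↔ D.γ c t = D.γ c' t') := by
    intro c' t'
    rw [(h c t).1, (h c' t').1]
    exact mul_right_inj' (Complex.exp_ne_zero _)
  constructor
  · rintro ⟨c', t', h1, h2⟩
    obtain ⟨c', rfl⟩ := π.surjective c'
    obtain ⟨t', rfl⟩ := lift_surjective (hφ c').1.continuous (hφ c').2.2 t'
    refine ⟨c', t', (key c' t').1 h1, ?_⟩
    rwa [(h c t).2, (h c' t').2, planeCross_rotate hφ h, planeCross_rotate hφ h] at h2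
  · rintro ⟨c', t', h1, h2⟩
    refine ⟨π c', φ c' t', (key c' t').2 h1, ?_⟩
    rwa [(h c t).2, (h c' t').2, planeCross_rotate hφ h, planeCross_rotate hφ h]

end Rotation

/-- A periodic diagram has the Gauss code of the closure of a power of a virtual braid. -/
theorem IsPeriodic.exists_braidWord {q : ℕ} (hq : 1 ≤ q) (h : D.IsPeriodic q) {C : GaussCode}
    (hC : D.HasGaussCode C) :
    ∃ (k : ℕ) (w : BraidWord k), D.HasGaussCode (w.power q).closureCode := by
  classical
  obtain ⟨h0, π, φ, hφ, h⟩ := h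
  rw [hasGaussCode_iff] at hC
  obtain ⟨ν, -, -, hν, -, -⟩ := hC
  choose r hr using exists_regular (D := D)
  set A := D.markedCircles q hq r hr with hA
  have hcl : ∀ c t, D.IsClassical (π c) (φ c t) ↔ D.IsClassical c t := by
    intro c t; simp only [IsClassical, (h c t).2]
  have hS : ∀ c t, φ c t ∈ A.S (π c) ↔ t ∈ A.S c := by
    intro c t
    change _ ∨ _ ↔ _ ∨ _
    rw [hcl, (h c t).2, (h c t).1, mul_pow, rotationFactor_pow hq, one_mul]
  have hmono : ∀ c, StrictMono (φ c) := fun c => strictMono_of_deriv_pos (hφ c).2.1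
  have hφ1 : ∀ c (t : ℝ) (m : ℤ), φ c (t + m) = φ c t + m := fun c =>
    lift_add_int (hφ c).2.2
  have hsurj : ∀ c, (φ c).Surjective := fun c =>
    lift_surjective (hφ c).1.continuous (hφ c).2.2
  have hvirt : ∀ {c t}, t ∈ A.S c → D.mark c t ≠ Mark.virt := by
    rintro c t (h1 | h1) h2
    · rcases h1 with h1 | h1 <;> rw [h1] at h2 <;> cases h2
    · rw [h1.1] at h2; cases h2
  have hrot : ∀ c t c' t', D.γ (π c) (φ c t) = D.γ (π c') (φ c' t') ↔ D.γ c t = D.γ c' t' := by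
    intro c t c' t'
    rw [(h c t).1, (h c' t').1]
    exact mul_right_inj' (Complex.exp_ne_zero _)
  set letter : A.Point → Option GaussLetter := fun x =>
    if D.IsClassical x.1.1 x.1.2 then some (D.letterAt ν x.1.1 x.1.2) else none with hletter
  have hl : ∀ {c t} (ht : t ∈ A.S c), letter (MarkedCircles.mkPoint ht) =
      if D.IsClassical c t then some (D.letterAt ν c t) else none := by
    intro c t ht
    have h1 : D.IsClassical c (Int.fract t) ↔ D.IsClassical c t := by
      rw [← isClassical_add_int c (Int.fract t) ⌊t⌋, Int.fract_add_floor]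
    simp only [hletter, MarkedCircles.mkPoint, h1]
    split_ifs with h2
    · rw [← letterAt_add_int hν c _ (h1.2 h2) ⌊t⌋, Int.fract_add_floor]
    · rfl
  have hl' : ∀ {c t} (ht : t ∈ A.S c) {x}, letter (MarkedCircles.mkPoint ht) = some x ↔
      D.IsClassical c t ∧ D.letterAt ν c t = x := by
    intro c t ht x
    rw [hl ht]
    split_ifs with h1 <;> simp [h1]
  have hγ : ∀ {c t} (ht : t ∈ A.S c), D.γ (MarkedCircles.mkPoint ht).1.1
      (MarkedCircles.mkPoint ht).1.2 = D.γ c t := by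
    intro c t ht
    conv_rhs => rw [← Int.fract_add_floor t, γ_add_int]
    rfl
  have hm : ∀ {c t} (ht : t ∈ A.S c), D.mark (MarkedCircles.mkPoint ht).1.1
      (MarkedCircles.mkPoint ht).1.2 = D.mark c t := by
    intro c t ht
    conv_rhs => rw [← Int.fract_add_floor t, mark_add_int]
    rfl
  set T := MarkedCircles.turnPerm π φ hmono hφ1 hS with hT
  have hTm : ∀ {c t} (ht : t ∈ A.S c), T (MarkedCircles.mkPoint ht) =
      MarkedCircles.mkPoint ((hS c t).2 ht) := fun ht =>
    MarkedCircles.turnPerm_mkPoint hmono hφ1 hS ht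
  have hmem : ∀ {c t}, D.IsClassical c t → t ∈ A.S c := fun h => Or.inl h
  let X : PeriodicGaussDiagram q A.Point :=
    { next := A.nextPerm
      turn := T
      sheet := fun x => sector q (D.γ x.1.1 x.1.2)
      letter := letter
      commute := MarkedCircles.commute_turnPerm hmono hφ1 hS hsurj
      turn_pow := by
        -- The q-th power of `T` preserves image and mark; at points that are not virtual crossings
        -- these determine the point.
        have hpow : ∀ (i : ℕ) (x : A.Point), D.γ ((T ^ i) x).1.1 ((T ^ i) x).1.2 =
            rotationFactor q ^ i * D.γ x.1.1 x.1.2 ∧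
            D.mark ((T ^ i) x).1.1 ((T ^ i) x).1.2 = D.mark x.1.1 x.1.2 := by
          intro i x
          induction i with
          | zero => simp
          | succ i ih =>
            rw [pow_succ', Equiv.Perm.mul_apply, ← ih.2, pow_succ', mul_assoc, ← ih.1]
            obtain ⟨c, t, ht, hx⟩ := MarkedCircles.exists_mkPoint ((T ^ i) x)
            rw [hx, hTm, hγ, hm, hγ, hm]
            exact h c t
        ext1 x
        obtain ⟨h1, h2⟩ := hpow q x
        rw [rotationFactor_pow hq, one_mul] at h1
        obtain ⟨h3, m, h4⟩ := eq_of_mark_eq h1 h2 (hvirt ((T ^ q) x).2.2)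
        rw [← MarkedCircles.mkPoint_self ((T ^ q) x), Equiv.Perm.one_apply,
          ← MarkedCircles.mkPoint_self x, MarkedCircles.mkPoint_eq_iff]
        rw [MarkedCircles.mkPoint_self x]
        exact ⟨h3, m, h4⟩
      sheet_turn := by
        intro x
        obtain ⟨c, t, ht, rfl⟩ := MarkedCircles.exists_mkPoint x
        rw [hTm, hγ, hγ, (h c t).1, sector_rotate hq (h0 c t)]
      partner := by
        intro x l hx
        obtain ⟨c, t, ht, rfl⟩ := MarkedCircles.exists_mkPoint x
        obtain ⟨h1, rfl⟩ := (hl' ht).1 hx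
        obtain ⟨c', t', h2, h3, h4, -⟩ := h1.exists_partner
        exact ⟨MarkedCircles.mkPoint (hmem h4), (hl' _).2 ⟨h4, letterAt_partner hν h2 h1 h4 h3⟩⟩
      letter_inj := by
        intro x x' l l' hx hx' ho hlab
        obtain ⟨c, t, ht, rfl⟩ := MarkedCircles.exists_mkPoint x
        obtain ⟨c', t', ht', rfl⟩ := MarkedCircles.exists_mkPoint x'
        obtain ⟨h1, rfl⟩ := (hl' ht).1 hx
        obtain ⟨h2, rfl⟩ := (hl' ht').1 hx'
        rw [MarkedCircles.mkPoint_eq_iff]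
        refine eq_of_mark_eq ((hν _ _ _ _ h1 h2).1 hlab) ?_ (hvirt ht)
        simp only [letterAt, decide_eq_decide] at ho
        rcases h1 with h1 | h1 <;> rcases h2 with h2 | h2 <;> simp [h1, h2] at ho ⊢
      sheet_eq := by
        intro x x' l l' hx hx' hlab
        obtain ⟨c, t, ht, rfl⟩ := MarkedCircles.exists_mkPoint x
        obtain ⟨c', t', ht', rfl⟩ := MarkedCircles.exists_mkPoint x'
        obtain ⟨h1, rfl⟩ := (hl' ht).1 hx
        obtain ⟨h2, rfl⟩ := (hl' ht').1 hx'
        -- The two ends of a chord are the same point of the plane, so they lie in the same sector.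
        rw [hγ, hγ, (hν _ _ _ _ h1 h2).1 hlab]
      turn_letter := by
        intro x l hx
        obtain ⟨c, t, ht, rfl⟩ := MarkedCircles.exists_mkPoint x
        obtain ⟨h1, rfl⟩ := (hl' ht).1 hx
        refine ⟨ν (π c) (φ c t), ?_⟩
        rw [hTm, hl']
        refine ⟨(hcl c t).2 h1, ?_⟩
        simp only [letterAt, (h c t).2, decide_eq_decide.2 (isPositive_rotate hφ h c t)]
      turn_label := by
        intro x x' l l' m m' hx hx' hlab hm1 hm2
        obtain ⟨c, t, ht, rfl⟩ := MarkedCircles.exists_mkPoint x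
        obtain ⟨c', t', ht', rfl⟩ := MarkedCircles.exists_mkPoint x'
        obtain ⟨h1, rfl⟩ := (hl' ht).1 hx
        obtain ⟨h2, rfl⟩ := (hl' ht').1 hx'
        rw [hTm, hl'] at hm1 hm2
        obtain ⟨h3, rfl⟩ := hm1
        obtain ⟨h4, rfl⟩ := hm2
        exact (hν _ _ _ _ h3 h4).2 ((hrot _ _ _ _).2 ((hν _ _ _ _ h1 h2).1 hlab)) }
  have hrS : ∀ c, r c ∈ A.S c := fun c => Or.inr ⟨hr c, c, rfl⟩
  have hne : Nonempty A.Point := ⟨MarkedCircles.mkPoint (hrS ⟨0, D.n_pos⟩)⟩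
  obtain ⟨k, w, hw⟩ := X.exists_braidWord hq (MarkedCircles.isTransversal hrS)
  -- Each component is read from its regular point `r c`; the auxiliary regular points are filtered
  -- out and carry no letter in `X`.
  refine ⟨k, w, HasGaussCode.of_same (hasGaussCode_iff.2 ⟨ν, r, fun c =>
    ((List.range (Function.minimalPeriod A.nextPerm (MarkedCircles.mkPoint (hrS c)))).map fun i =>
      (A.nxt c)^[i] (r c)).filter fun t => D.IsClassical c t, hν, fun c => ?_, ?_⟩) hw⟩
  · have hL := MarkedCircles.listsFrom (hrS c)
    refine ⟨hL.1.filter _, fun t => ?_⟩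
    rw [List.mem_filter, hL.2, decide_eq_true_eq, and_assoc]
    exact and_congr_right fun _ => ⟨fun h => h.2, fun h => ⟨hmem h, h⟩⟩
  · refine List.Perm.of_eq ?_
    rw [List.ofFn_eq_map, List.map_map]
    refine List.map_congr_left fun c _ => ?_
    simp only [Function.comp, PeriodicGaussDiagram.word, Equiv.Perm.cycleWord]
    generalize List.range (Function.minimalPeriod A.nextPerm (MarkedCircles.mkPoint (hrS c))) = L
    induction L with
    | nil => rfl
    | cons i L ih =>
      rw [List.flatMap_cons, ih, List.map_cons, List.filter_cons]
      change (letter ((A.nextPerm ^ i) _)).toList ++ _ = _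
      rw [MarkedCircles.nextPerm_pow_mkPoint, hl]
      split_ifs with h1 h2 h2
      · rfl
      · simp [h1] at h2
      · simp [h1] at h2
      · rfl

end VirtualLinkDiagram

/-! ### Smooth interpolation -/

theorem expNegInvGlue_of_pos {x : ℝ} (hx : 0 < x) : expNegInvGlue x = Real.exp (-x⁻¹) :=
  if_neg (not_le.2 hx)

theorem hasDerivAt_expNegInvGlue {x : ℝ} (hx : 0 < x) :
    HasDerivAt expNegInvGlue (expNegInvGlue x * (x ^ 2)⁻¹) x := by
  have h1 : HasDerivAt (fun x : ℝ => Real.exp (-x⁻¹)) (Real.exp (-x⁻¹) * (x ^ 2)⁻¹) x := by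
    have := ((hasDerivAt_inv hx.ne').neg).exp
    simpa using this
  rw [expNegInvGlue_of_pos hx]
  refine h1.congr_of_eventuallyEq ?_
  filter_upwards [lt_mem_nhds hx] with y hy using expNegInvGlue_of_pos hy

namespace Real.smoothTransition

theorem half : smoothTransition (1 / 2) = 1 / 2 := by
  have := expNegInvGlue.pos_of_pos (x := 1 / 2) (by norm_num)
  rw [smoothTransition, show (1 : ℝ) - 1 / 2 = 1 / 2 by norm_num]
  field_simp
  norm_num

/-- The value 1/2 means that the glue functions at `x` and `1 - x` agree, and these are injective on
positive numbers. Exchanged strands thus meet only once in their layer. -/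
theorem eq_half {x : ℝ} (h : smoothTransition x = 1 / 2) : x = 1 / 2 := by
  have h0 : 0 < x := by
    by_contra h1
    rw [zero_of_nonpos (not_lt.1 h1)] at h
    norm_num at h
  have h1 : x < 1 := by
    by_contra h1
    rw [one_of_one_le (not_lt.1 h1)] at h
    norm_num at h
  have h2 := expNegInvGlue.pos_of_pos h0
  have h3 := expNegInvGlue.pos_of_pos (sub_pos.2 h1)
  rw [smoothTransition, div_eq_div_iff (by positivity) (by norm_num)] at h
  have h4 : expNegInvGlue x = expNegInvGlue (1 - x) := by linarith
  rw [expNegInvGlue_of_pos h0, expNegInvGlue_of_pos (sub_pos.2 h1)] at h4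
  have h5 := inv_injective (neg_injective (Real.exp_injective h4))
  linarith

/-- The derivative at the midpoint. -/
theorem exists_hasDerivAt_half : ∃ s : ℝ, 0 < s ∧ HasDerivAt smoothTransition s (1 / 2) := by
  have hp := expNegInvGlue.pos_of_pos (x := 1 / 2) (by norm_num)
  have h1 := hasDerivAt_expNegInvGlue (x := 1 / 2) (by norm_num)
  have h2 : HasDerivAt (fun x : ℝ => expNegInvGlue (1 - x))
      (-(expNegInvGlue (1 / 2) * ((1 / 2) ^ 2)⁻¹)) (1 / 2) := by
    have h3 : HasDerivAt (fun x : ℝ => 1 - x) (-1) (1 / 2) := by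
      simpa using (hasDerivAt_id (1 / 2 : ℝ)).const_sub 1
    have h4 : HasDerivAt expNegInvGlue (expNegInvGlue (1 / 2) * ((1 / 2) ^ 2)⁻¹)
      (1 - 1 / 2 : ℝ) := by norm_num at h1 ⊢; exact h1
    have := h4.comp (1 / 2 : ℝ) h3
    rwa [mul_neg_one] at this
  have hne : expNegInvGlue (1 / 2) + expNegInvGlue (1 - 1 / 2) ≠ 0 := by
    rw [show (1 : ℝ) - 1 / 2 = 1 / 2 by norm_num]; positivity
  refine ⟨_, ?_, h1.div (h1.add h2) hne⟩
  simp only [show (1 : ℝ) - 1 / 2 = 1 / 2 by norm_num]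
  rw [add_neg_cancel, mul_zero, sub_zero]
  positivity

end Real.smoothTransition

/-- A smooth function with given values at the integers, locally constant to infinite order
there. -/
noncomputable def smoothInterp (a : ℤ → ℝ) (x : ℝ) : ℝ :=
  a ⌊x⌋ + (a (⌊x⌋ + 1) - a ⌊x⌋) * Real.smoothTransition (x - ⌊x⌋)

/-- To the left of `n` the second transition is still 0, to the right the first is already 1. One
smooth expression thus covers a neighbourhood of `n`, where the floor jumps. -/
theorem smoothInterp_eq (a : ℤ → ℝ) (n : ℤ) {x : ℝ} (h1 : (n : ℝ) - 1 < x) (h2 : x < n + 1) :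
    smoothInterp a x = a (n - 1) + (a n - a (n - 1)) * Real.smoothTransition (x - n + 1) +
      (a (n + 1) - a n) * Real.smoothTransition (x - n) := by
  rcases lt_or_ge x n with h | h
  · have hf : ⌊x⌋ = n - 1 := by rw [Int.floor_eq_iff]; push_cast; constructor <;> linarith
    rw [smoothInterp, hf, Real.smoothTransition.zero_of_nonpos (by linarith : x - n ≤ 0)]
    push_cast
    rw [sub_add_cancel, mul_zero, add_zero]
    congr 3; ring
  · have hf : ⌊x⌋ = n := by rw [Int.floor_eq_iff]; constructor <;> linarith
    rw [smoothInterp, hf, Real.smoothTransition.one_of_one_le (by linarith : 1 ≤ x - n + 1)]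
    ring

theorem contDiff_smoothInterp (a : ℤ → ℝ) : ContDiff ℝ ∞ (smoothInterp a) := by
  rw [contDiff_iff_contDiffAt]
  intro x
  have h1 := Int.floor_le x
  have h2 := Int.lt_floor_add_one x
  set n := ⌊x⌋
  have h3 : ContDiffAt ℝ ∞ (fun x : ℝ => a (n - 1) + (a n - a (n - 1)) *
      Real.smoothTransition (x - n + 1) + (a (n + 1) - a n) * Real.smoothTransition (x - n)) x := by
    refine ContDiff.contDiffAt ?_
    refine (contDiff_const.add (contDiff_const.mul ?_)).add (contDiff_const.mul ?_)
    · simp only [sub_add]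
      exact Real.smoothTransition.contDiff.comp (contDiff_id.sub contDiff_const)
    · exact Real.smoothTransition.contDiff.comp (contDiff_id.sub contDiff_const)
  refine h3.congr_of_eventuallyEq ?_
  filter_upwards [Ioo_mem_nhds (by linarith : (n : ℝ) - 1 < x) h2] with y hy
  exact smoothInterp_eq a n hy.1 hy.2

theorem smoothInterp_half (a : ℤ → ℝ) (n : ℤ) :
    smoothInterp a (n + 1 / 2) = (a n + a (n + 1)) / 2 := by
  have hf : ⌊(n : ℝ) + 1 / 2⌋ = n := by rw [Int.floor_eq_iff]; constructor <;> linarith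
  rw [smoothInterp, hf, add_sub_cancel_left, Real.smoothTransition.half]
  ring

/-- The slope `s` is the same for all sequences and layers, so two exchanged strands cross with
opposite nonzero slopes. -/
theorem exists_deriv_smoothInterp_half : ∃ s : ℝ, 0 < s ∧ ∀ (a : ℤ → ℝ) (n : ℤ),
    HasDerivAt (smoothInterp a) ((a (n + 1) - a n) * s) (n + 1 / 2) := by
  obtain ⟨s, hs, h⟩ := Real.smoothTransition.exists_hasDerivAt_half
  refine ⟨s, hs, fun a n => ?_⟩
  have h1 : HasDerivAt (fun x : ℝ => a n + (a (n + 1) - a n) * Real.smoothTransition (x - n))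
      ((a (n + 1) - a n) * s) (n + 1 / 2) := by
    have h2 : HasDerivAt (fun x : ℝ => Real.smoothTransition (x - n)) s (n + 1 / 2) :=
      HasDerivAt.comp_sub_const _ _ (by rwa [add_sub_cancel_left])
    exact (h2.const_mul _).const_add _
  refine h1.congr_of_eventuallyEq ?_
  filter_upwards [Ioo_mem_nhds (by linarith : (n : ℝ) < n + 1 / 2)
    (by linarith : (n : ℝ) + 1 / 2 < n + 1)] with y hy
  have hf : ⌊y⌋ = n := by rw [Int.floor_eq_iff]; exact ⟨hy.1.le, hy.2⟩
  rw [smoothInterp, hf]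

/-! ### The closed virtual braid diagram in the plane -/

namespace BraidWord

variable {k : ℕ} (w : BraidWord k)

/-- The number of horizontal layers of a braid word. -/
def layers : ℕ := max w.length 1

/-- The empty word is given one empty layer, so that a full turn always takes positive time. -/
theorem layers_pos : 0 < w.layers := lt_max_of_lt_right one_pos

/-- The letter in the layer `n` of the bi-infinite repetition of a braid word. -/
def slot (n : ℤ) : Option (VBGen k × Bool) := w[(n % w.layers).toNat]?

/-- The effect of a letter on the positions. -/
def slotMove : Option (VBGen k × Bool) → Equiv.Perm (Fin k)
  | none => 1
  | some x => x.1.move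

/-- The position above the layer `n` of the strand that starts at a given position above the
layer `0`. -/
def posAt (n : ℤ) : Equiv.Perm (Fin k) :=
  exitPerm (w.take (n % w.layers).toNat) * exitPerm w ^ (n / w.layers)

theorem exitPerm_take_succ (i : ℕ) :
    exitPerm (w.take (i + 1)) = slotMove w[i]? * exitPerm (w.take i) := by
  rw [List.take_add_one, exitPerm_append]
  rcases w[i]? with _ | ⟨g, e⟩
  · rfl
  · simp [exitPerm, slotMove]

theorem posAt_add_layers (n j : ℤ) :
    w.posAt (n + w.layers * j) = w.posAt n * exitPerm w ^ j := by
  have : (w.layers : ℤ) ≠ 0 := by exact_mod_cast w.layers_pos.ne'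
  rw [posAt, posAt, Int.add_mul_emod_self_left, Int.add_mul_ediv_left _ _ this, zpow_add, mul_assoc]

theorem slot_add_layers (n j : ℤ) : w.slot (n + w.layers * j) = w.slot n := by
  rw [slot, slot, Int.add_mul_emod_self_left]

theorem posAt_zero : w.posAt 0 = 1 := by
  simp [posAt, exitPerm]

theorem posAt_succ_of_lt (i : ℕ) (hi : i < w.layers) :
    w.posAt ((i : ℤ) + 1) = slotMove (w.slot i) * w.posAt i := by
  have h0 : ((i : ℤ) % w.layers).toNat = i := by
    rw [← Int.natCast_emod, Int.toNat_natCast, Nat.mod_eq_of_lt hi]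
  have h1 : (i : ℤ) / w.layers = 0 := by exact_mod_cast Nat.div_eq_of_lt hi
  have h2 : w.posAt i = exitPerm (w.take i) := by rw [posAt, h0, h1, zpow_zero, mul_one]
  rw [slot, h0, h2, ← exitPerm_take_succ]
  rcases Nat.lt_or_ge (i + 1) w.layers with h | h
  · have h3 : (((i + 1 : ℕ) : ℤ) % w.layers).toNat = i + 1 := by
      rw [← Int.natCast_emod, Int.toNat_natCast, Nat.mod_eq_of_lt h]
    have h4 : ((i + 1 : ℕ) : ℤ) / w.layers = 0 := by exact_mod_cast Nat.div_eq_of_lt h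
    rw [show (i : ℤ) + 1 = ((i + 1 : ℕ) : ℤ) by push_cast; rfl, posAt, h3, h4, zpow_zero, mul_one]
  -- At the end of the word the remainder returns to 0, and the quotient contributes a factor
  -- `exitPerm w`.
  · have h3 : i + 1 = w.layers := by omega
    have h4 := w.posAt_add_layers 0 1
    rw [mul_one, zero_add, posAt_zero, one_mul, zpow_one] at h4
    rw [show (i : ℤ) + 1 = w.layers by exact_mod_cast h3, h4, List.take_of_length_le]
    rw [h3]; exact le_max_left _ _

theorem posAt_succ (n : ℤ) : w.posAt (n + 1) = slotMove (w.slot n) * w.posAt n := by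
  have h0 : 0 < (w.layers : ℤ) := by exact_mod_cast w.layers_pos
  have h1 := Int.emod_add_mul_ediv n w.layers
  obtain ⟨i, hi⟩ := Int.eq_ofNat_of_zero_le (Int.emod_nonneg n h0.ne')
  have h2 : i < w.layers := by exact_mod_cast hi ▸ Int.emod_lt_of_pos n h0
  rw [hi] at h1
  rw [← h1, add_right_comm, posAt_add_layers, posAt_add_layers, slot_add_layers,
    posAt_succ_of_lt _ _ h2, mul_assoc]

/-- The height of the strand that starts at position `p`, at the time `x`. -/
noncomputable def strandHeight (p : Fin k) : ℝ → ℝ :=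
  smoothInterp fun n => ((w.posAt n p).val : ℝ)

/-- After `j` copies of `w` the strand from `p` continues as the strand from the position it has
reached. -/
theorem strandHeight_add_layers (p : Fin k) (x : ℝ) (j : ℤ) :
    w.strandHeight p (x + w.layers * j) = w.strandHeight ((exitPerm w ^ j) p) x := by
  have hf : ⌊x + w.layers * j⌋ = ⌊x⌋ + w.layers * j := by
    rw [← Int.floor_add_intCast]; push_cast; rfl
  have h1 : x + w.layers * j - ((⌊x⌋ + w.layers * j : ℤ) : ℝ) = x - ⌊x⌋ := by push_cast; ring
  simp only [strandHeight, smoothInterp]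
  rw [hf, h1, add_right_comm, posAt_add_layers, posAt_add_layers]
  rfl

theorem left_ne_right (g : VBGen k) : g.left ≠ g.right := by
  intro h; have := congrArg Fin.val h; simp [VBGen.left, VBGen.right] at this

theorem right_val (g : VBGen k) : g.right.val = g.left.val + 1 := rfl

theorem posAt_succ_left {n : ℤ} {g : VBGen k} {e : Bool} {p : Fin k}
    (h : w.slot n = some (g, e)) (hp : w.posAt n p = g.left) : w.posAt (n + 1) p = g.right := by
  rw [posAt_succ, h, Equiv.Perm.mul_apply, hp]
  exact Equiv.swap_apply_left _ _

theorem posAt_succ_right {n : ℤ} {g : VBGen k} {e : Bool} {p : Fin k}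
    (h : w.slot n = some (g, e)) (hp : w.posAt n p = g.right) : w.posAt (n + 1) p = g.left := by
  rw [posAt_succ, h, Equiv.Perm.mul_apply, hp]
  exact Equiv.swap_apply_right _ _

theorem strandHeight_half {n : ℤ} {g : VBGen k} {e : Bool} {p : Fin k}
    (h : w.slot n = some (g, e)) (hp : w.posAt n p = g.left ∨ w.posAt n p = g.right) :
    w.strandHeight p (n + 1 / 2) = g.left.val + 1 / 2 := by
  rw [strandHeight, smoothInterp_half]
  rcases hp with hp | hp
  · rw [hp, posAt_succ_left w h hp, right_val]; push_cast; ring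
  · rw [hp, posAt_succ_right w h hp, right_val]; push_cast; ring

/-- Two strands meet exactly in the middle of the layers in which they are exchanged. -/
theorem exists_of_strandHeight_eq {p p' : Fin k} (hne : p ≠ p') {x : ℝ}
    (h : w.strandHeight p x = w.strandHeight p' x) :
    ∃ (n : ℤ) (g : VBGen k) (e : Bool), x = n + 1 / 2 ∧ w.slot n = some (g, e) ∧
      ((w.posAt n p = g.left ∧ w.posAt n p' = g.right) ∨
        (w.posAt n p = g.right ∧ w.posAt n p' = g.left)) := by
  wlog hle : w.posAt ⌊x⌋ p < w.posAt ⌊x⌋ p' generalizing p p'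
  · have hlt : w.posAt ⌊x⌋ p' < w.posAt ⌊x⌋ p :=
      lt_of_le_of_ne (not_lt.1 hle) fun h => hne ((w.posAt _).injective h.symm)
    obtain ⟨n, g, e, h1, h2, h3⟩ := this hne.symm h.symm hlt
    exact ⟨n, g, e, h1, h2, h3.symm.imp And.symm And.symm⟩
  have hs0 := Real.smoothTransition.nonneg (x - ⌊x⌋)
  have hs1 : Real.smoothTransition (x - ⌊x⌋) < 1 :=
    Real.smoothTransition.lt_one_of_lt_one (by linarith [Int.lt_floor_add_one x])
  have hlt : (w.posAt ⌊x⌋ p).val < (w.posAt ⌊x⌋ p').val := hle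
  simp only [strandHeight, smoothInterp] at h
  have hhalf : Real.smoothTransition (x - ⌊x⌋) = 1 / 2 → x = ⌊x⌋ + 1 / 2 := fun h => by
    have := Real.smoothTransition.eq_half h; linarith
  rcases hg : w.slot ⌊x⌋ with _ | ⟨g, e⟩
  · rw [posAt_succ, hg] at h
    simp only [slotMove, one_mul, sub_self, zero_mul, add_zero, Nat.cast_inj] at h
    omega
  · rw [posAt_succ, hg] at h
    simp only [slotMove, Equiv.Perm.mul_apply] at h
    suffices hmain : Real.smoothTransition (x - ⌊x⌋) = 1 / 2 ∧ w.posAt ⌊x⌋ p = g.left ∧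
        w.posAt ⌊x⌋ p' = g.right from
      ⟨⌊x⌋, g, e, hhalf hmain.1, hg, Or.inl hmain.2⟩
    clear hhalf
    generalize w.posAt ⌊x⌋ p = a at h hlt ⊢
    generalize w.posAt ⌊x⌋ p' = b at h hlt ⊢
    generalize Real.smoothTransition (x - ⌊x⌋) = s at *
    have hmove : ∀ c, c ≠ g.left → c ≠ g.right → g.move c = c := fun c h1 h2 =>
      Equiv.swap_apply_of_ne_of_ne h1 h2
    have hl : g.move g.left = g.right := Equiv.swap_apply_left _ _
    have hr : g.move g.right = g.left := Equiv.swap_apply_right _ _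
    have hrv := right_val g
    have hrv' : (g.right.val : ℝ) = g.left.val + 1 := by rw [hrv]; push_cast; rfl
    have hlt' : (a.val : ℝ) + 1 ≤ b.val := by exact_mod_cast hlt
    -- A strand moving towards an unmoved one starts at distance at least 2 and covers less than 1.
    -- So only the exchanged pair can meet, and its distance `1 - 2 * s` vanishes at `s = 1 / 2`.
    by_cases ha : a = g.left
    · subst ha
      by_cases hb : b = g.right
      · subst hb
        rw [hl, hr, hrv'] at h
        exact ⟨by linarith, rfl, rfl⟩
      · rw [hl, hmove b (by rintro rfl; omega) hb, hrv'] at h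
        linarith
    · by_cases ha' : a = g.right
      · subst ha'
        rw [hr, hmove b (by rintro rfl; omega) (by rintro rfl; omega), hrv'] at h
        linarith
      · rw [hmove a ha ha'] at h
        by_cases hb : b = g.left
        · subst hb
          rw [hl, hrv'] at h
          linarith
        · by_cases hb' : b = g.right
          · subst hb'
            have h1 : a.val ≠ g.left.val := fun h => ha (Fin.ext h)
            have h2 : a.val + 1 ≤ g.left.val := by omega
            have h3 : (a.val : ℝ) + 1 ≤ g.left.val := by exact_mod_cast h2
            rw [hr, hrv'] at h
            linarith
          · rw [hmove b hb hb'] at h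
            linarith

/-- The mark at a letter of the strand in the position `p`. -/
def slotMark : Option (VBGen k × Bool) → Fin k → Mark
  | none, _ => Mark.regular
  | some (VBGen.tau i, _), p =>
      if p = (VBGen.tau i).left ∨ p = (VBGen.tau i).right then Mark.virt else Mark.regular
  | some (VBGen.sigma i, e), p =>
      if p = (VBGen.sigma i).left then (if e then Mark.overpass else Mark.underpass)
      else if p = (VBGen.sigma i).right then (if e then Mark.underpass else Mark.overpass)
      else Mark.regular

/-- The mark of the strand that starts at position `p`, at the time `x`. -/
noncomputable def strandMark (p : Fin k) (x : ℝ) : Mark :=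
  if x = ⌊x⌋ + 1 / 2 then slotMark (w.slot ⌊x⌋) (w.posAt ⌊x⌋ p) else Mark.regular

theorem floor_half (n : ℤ) : ⌊(n : ℝ) + 1 / 2⌋ = n := by
  rw [Int.floor_eq_iff]; constructor <;> linarith

theorem strandMark_half (p : Fin k) (n : ℤ) :
    w.strandMark p (n + 1 / 2) = slotMark (w.slot n) (w.posAt n p) := by
  rw [strandMark, floor_half, if_pos rfl]

theorem strandMark_add_layers (p : Fin k) (x : ℝ) (j : ℤ) :
    w.strandMark p (x + w.layers * j) = w.strandMark ((exitPerm w ^ j) p) x := by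
  have hf : ⌊x + w.layers * j⌋ = ⌊x⌋ + w.layers * j := by
    rw [← Int.floor_add_intCast]; push_cast; rfl
  have h1 : x + w.layers * j = ((⌊x⌋ + w.layers * j : ℤ) : ℝ) + 1 / 2 ↔ x = ⌊x⌋ + 1 / 2 := by
    push_cast
    constructor <;> intro h <;> linarith
  rw [strandMark, strandMark, hf, posAt_add_layers, slot_add_layers]
  simp only [h1]
  rfl

theorem slotMark_ne_regular {s : Option (VBGen k × Bool)} {p : Fin k} :
    slotMark s p ≠ Mark.regular ↔ ∃ g e, s = some (g, e) ∧ (p = g.left ∨ p = g.right) := by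
  rcases s with _ | ⟨i | i, e⟩
  · simp [slotMark]
  · rw [slotMark]
    split_ifs with h1 h2 h3 h4 <;> simp_all
  · rw [slotMark]
    split_ifs with h1 <;> simp_all

theorem strandMark_ne_regular {p : Fin k} {x : ℝ} :
    w.strandMark p x ≠ Mark.regular ↔ ∃ (n : ℤ) (g : VBGen k) (e : Bool), x = n + 1 / 2 ∧
      w.slot n = some (g, e) ∧ (w.posAt n p = g.left ∨ w.posAt n p = g.right) := by
  constructor
  · intro h
    rw [strandMark] at h
    split_ifs at h with h1
    · obtain ⟨g, e, h2, h3⟩ := slotMark_ne_regular.1 h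
      exact ⟨⌊x⌋, g, e, h1, h2, h3⟩
    · exact absurd rfl h
  · rintro ⟨n, g, e, rfl, h1, h2⟩
    rw [strandMark_half]
    exact slotMark_ne_regular.2 ⟨g, e, h1, h2⟩

theorem strandMark_eq_regular_iff {p : Fin k} {x : ℝ} : w.strandMark p x = Mark.regular ↔
    ∀ p', w.strandHeight p x = w.strandHeight p' x → p = p' := by
  rw [← not_iff_not, ← ne_eq, strandMark_ne_regular]
  push Not
  constructor
  · rintro ⟨n, g, e, rfl, h1, h2 | h2⟩
    · refine ⟨(w.posAt n).symm g.right, ?_, ?_⟩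
      · rw [strandHeight_half w h1 (Or.inl h2),
          strandHeight_half w h1 (Or.inr (Equiv.apply_symm_apply _ _))]
      · rintro rfl
        rw [Equiv.apply_symm_apply] at h2
        exact left_ne_right g h2.symm
    · refine ⟨(w.posAt n).symm g.left, ?_, ?_⟩
      · rw [strandHeight_half w h1 (Or.inr h2),
          strandHeight_half w h1 (Or.inl (Equiv.apply_symm_apply _ _))]
      · rintro rfl
        rw [Equiv.apply_symm_apply] at h2
        exact left_ne_right g h2
  · rintro ⟨p', h1, h2⟩
    obtain ⟨n, g, e, h3, h4, h5⟩ := w.exists_of_strandHeight_eq h2 h1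
    exact ⟨n, g, e, h3, h4, h5.imp And.left And.left⟩

theorem strandMark_crossing {p p' : Fin k} {x : ℝ} (hne : p ≠ p')
    (h : w.strandHeight p x = w.strandHeight p' x) :
    (w.strandMark p x = Mark.overpass ∧ w.strandMark p' x = Mark.underpass) ∨
      (w.strandMark p x = Mark.underpass ∧ w.strandMark p' x = Mark.overpass) ∨
      (w.strandMark p x = Mark.virt ∧ w.strandMark p' x = Mark.virt) := by
  obtain ⟨n, g, e, rfl, h1, h2⟩ := w.exists_of_strandHeight_eq hne h
  have h3 := (left_ne_right g).symm
  rw [strandMark_half, strandMark_half, h1]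
  rcases g with i | i
  · rcases h2 with ⟨h4, h5⟩ | ⟨h4, h5⟩ <;> cases e <;> simp [slotMark, h4, h5, h3]
  · rcases h2 with ⟨h4, h5⟩ | ⟨h4, h5⟩ <;> simp [slotMark, h4, h5]

/-- Two strands that are one at an overpass and the other at an underpass of the same layer
meet. -/
theorem strandHeight_eq_of_mark {p p' : Fin k} {x : ℝ} (h : w.strandMark p x ≠ Mark.regular)
    (h' : w.strandMark p' x ≠ Mark.regular) : w.strandHeight p x = w.strandHeight p' x := by
  obtain ⟨n, g, e, rfl, h1, h2⟩ := w.strandMark_ne_regular.1 h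
  obtain ⟨n', g', e', h3, h4, h5⟩ := w.strandMark_ne_regular.1 h'
  obtain rfl : n = n' := by
    have : (n : ℝ) = n' := by linarith
    exact_mod_cast this
  rw [h1] at h4
  cases h4
  rw [strandHeight_half w h1 h2, strandHeight_half w h1 h5]

/-- The point of the annulus at the time `x` on the strand that starts at position `p`, if there
are `Q` layers in a full turn. -/
noncomputable def strandPoint (Q : ℝ) (p : Fin k) (x : ℝ) : ℂ :=
  Complex.exp (-(w.strandHeight p x : ℂ) + (2 * Real.pi / Q * x : ℝ) * Complex.I)

theorem contDiff_strandHeight (p : Fin k) : ContDiff ℝ ∞ (w.strandHeight p) :=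
  contDiff_smoothInterp _

theorem contDiff_strandPoint (Q : ℝ) (p : Fin k) : ContDiff ℝ ∞ (w.strandPoint Q p) := by
  refine ContDiff.cexp ?_
  have h1 : ContDiff ℝ ∞ fun x => (w.strandHeight p x : ℂ) :=
    Complex.ofRealCLM.contDiff.comp (w.contDiff_strandHeight p)
  have h2 : ContDiff ℝ ∞ fun x : ℝ => ((2 * Real.pi / Q * x : ℝ) : ℂ) :=
    Complex.ofRealCLM.contDiff.comp (contDiff_const.mul contDiff_id)
  exact h1.neg.add (h2.mul contDiff_const)

theorem hasDerivAt_strandPoint (Q : ℝ) (p : Fin k) {x h : ℝ}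
    (hh : HasDerivAt (w.strandHeight p) h x) : HasDerivAt (w.strandPoint Q p)
      (w.strandPoint Q p x * (-(h : ℂ) + (2 * Real.pi / Q : ℝ) * Complex.I)) x := by
  refine HasDerivAt.cexp ?_
  have h1 : HasDerivAt (fun x : ℝ => ((2 * Real.pi / Q * x : ℝ) : ℂ))
      ((2 * Real.pi / Q : ℝ) : ℂ) x := by
    refine HasDerivAt.ofReal_comp ?_
    simpa using (hasDerivAt_id x).const_mul (2 * Real.pi / Q)
  exact hh.ofReal_comp.neg.add (h1.mul_const Complex.I)

theorem deriv_strandPoint_ne_zero {Q : ℝ} (hQ : 0 < Q) (p : Fin k) (x : ℝ) :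
    deriv (w.strandPoint Q p) x ≠ 0 := by
  have hh : HasDerivAt (w.strandHeight p) (deriv (w.strandHeight p) x) x :=
    (((w.contDiff_strandHeight p).differentiable (by simp)) x).hasDerivAt
  rw [(w.hasDerivAt_strandPoint Q p hh).deriv]
  refine mul_ne_zero (Complex.exp_ne_zero _) fun h => ?_
  have := congrArg Complex.im h
  simp only [Complex.add_im, Complex.neg_im, Complex.ofReal_im, neg_zero, Complex.im_ofReal_mul,
    Complex.I_im, mul_one, zero_add, Complex.zero_im] at this
  have h2 : 0 < 2 * Real.pi / Q := by have := Real.pi_pos; positivity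
  exact h2.ne' this

/-- The modulus of the point determines the height, its argument the time up to full turns. -/
theorem strandPoint_eq_iff {Q : ℝ} (hQ : 0 < Q) {p p' : Fin k} {x x' : ℝ} :
    w.strandPoint Q p x = w.strandPoint Q p' x' ↔
      w.strandHeight p x = w.strandHeight p' x' ∧ ∃ j : ℤ, x' = x + Q * j := by
  have hpi := Real.pi_pos
  rw [strandPoint, strandPoint, Complex.exp_eq_exp_iff_exists_int]
  constructor
  · rintro ⟨j, hj⟩
    have h1 := congrArg Complex.re hj
    have h2 := congrArg Complex.im hj
    have e : (j : ℂ) * (2 * Real.pi * Complex.I) = ((j * (2 * Real.pi) : ℝ) : ℂ) * Complex.I := by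
      push_cast; ring
    rw [e] at h1 h2
    simp only [Complex.add_im, Complex.neg_im, Complex.ofReal_im, neg_zero, Complex.im_ofReal_mul,
      Complex.I_im, mul_one, zero_add, Complex.add_re, Complex.neg_re, Complex.ofReal_re,
      Complex.re_ofReal_mul, Complex.I_re, mul_zero, add_zero] at h1 h2
    refine ⟨by linarith, -j, ?_⟩
    push_cast
    field_simp at h2
    linarith
  · rintro ⟨h1, j, rfl⟩
    refine ⟨-j, ?_⟩
    rw [h1]
    have : (Q : ℂ) ≠ 0 := by exact_mod_cast hQ.ne'
    push_cast
    field_simp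
    ring

/-- At a crossing the strand from left to right turns clockwise with respect to the other one. -/
theorem planeCross_strandPoint {Q : ℝ} (hQ : 0 < Q) {n : ℤ} {g : VBGen k} {e : Bool} {p p' : Fin k}
    (h : w.slot n = some (g, e)) (hp : w.posAt n p = g.left) (hp' : w.posAt n p' = g.right) :
    planeCross (deriv (w.strandPoint Q p) (n + 1 / 2))
        (deriv (w.strandPoint Q p') (n + 1 / 2)) < 0 ∧
      0 < planeCross (deriv (w.strandPoint Q p') (n + 1 / 2))
        (deriv (w.strandPoint Q p) (n + 1 / 2)) := by
  obtain ⟨s, hs, hd⟩ := exists_deriv_smoothInterp_half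
  have h1 : HasDerivAt (w.strandHeight p) s (n + 1 / 2) := by
    have := hd (fun n => ((w.posAt n p).val : ℝ)) n
    rw [posAt_succ_left w h hp, hp, right_val] at this
    push_cast at this
    rwa [add_sub_cancel_left, one_mul] at this
  have h2 : HasDerivAt (w.strandHeight p') (-s) (n + 1 / 2) := by
    have := hd (fun n => ((w.posAt n p').val : ℝ)) n
    rw [posAt_succ_right w h hp', hp', right_val] at this
    push_cast at this
    rwa [sub_add_cancel_left, neg_one_mul] at this
  -- Both velocities are the common image point times vectors with real parts `-s` and `s` and the
  -- same positive imaginary part; the common factor contributes only its squared modulus.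
  have heq : w.strandPoint Q p' (n + 1 / 2) = w.strandPoint Q p (n + 1 / 2) := by
    rw [strandPoint, strandPoint, strandHeight_half w h (Or.inl hp),
      strandHeight_half w h (Or.inr hp')]
  rw [(w.hasDerivAt_strandPoint Q p h1).deriv, (w.hasDerivAt_strandPoint Q p' h2).deriv, heq,
    planeCross_mul_left, planeCross_mul_left]
  have h3 : 0 < Complex.normSq (w.strandPoint Q p (n + 1 / 2)) :=
    Complex.normSq_pos.2 (Complex.exp_ne_zero _)
  have h4 : 0 < 2 * Real.pi / Q := by have := Real.pi_pos; positivity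
  set c := 2 * Real.pi / Q
  have h5 : planeCross (-(s : ℂ) + (c : ℝ) * Complex.I) (-((-s : ℝ) : ℂ) + (c : ℝ) * Complex.I) =
      -(2 * (s * c)) := by
    simp [planeCross]; ring
  have h6 : planeCross (-((-s : ℝ) : ℂ) + (c : ℝ) * Complex.I) (-(s : ℂ) + (c : ℝ) * Complex.I) =
      2 * (s * c) := by
    simp [planeCross]; ring
  rw [h5, h6]
  have h7 := mul_pos hs h4
  exact ⟨mul_neg_of_pos_of_neg h3 (by linarith), mul_pos h3 (by linarith)⟩

theorem planeCross_strandPoint_ne_zero {Q : ℝ} (hQ : 0 < Q) {p p' : Fin k} {x : ℝ} (hne : p ≠ p')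
    (h : w.strandHeight p x = w.strandHeight p' x) :
    planeCross (deriv (w.strandPoint Q p) x) (deriv (w.strandPoint Q p') x) ≠ 0 := by
  obtain ⟨n, g, e, rfl, h1, ⟨h2, h3⟩ | ⟨h2, h3⟩⟩ := w.exists_of_strandHeight_eq hne h
  · exact (w.planeCross_strandPoint hQ h1 h2 h3).1.ne
  · exact (w.planeCross_strandPoint hQ h1 h3 h2).2.ne'

/-- The sign of a classical crossing. -/
theorem planeCross_pos_iff {Q : ℝ} (hQ : 0 < Q) {n : ℤ} {i : Fin (k - 1)} {e : Bool} {p p' : Fin k}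
    (h : w.slot n = some (VBGen.sigma i, e))
    (hp : w.strandMark p (n + 1 / 2) = Mark.overpass)
    (hp' : w.strandMark p' (n + 1 / 2) = Mark.underpass) :
    0 < planeCross (deriv (w.strandPoint Q p) (n + 1 / 2))
      (deriv (w.strandPoint Q p') (n + 1 / 2)) ↔ e = false := by
  have hlr := left_ne_right (VBGen.sigma i)
  rw [strandMark_half, h, slotMark] at hp hp'
  cases e
  · have h1 : w.posAt n p = (VBGen.sigma i).right := by
      split_ifs at hp <;> simp_all
    have h2 : w.posAt n p' = (VBGen.sigma i).left := by
      split_ifs at hp' <;> simp_all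
    exact iff_of_true (w.planeCross_strandPoint hQ h h2 h1).2 rfl
  · have h1 : w.posAt n p = (VBGen.sigma i).left := by
      split_ifs at hp <;> simp_all
    have h2 : w.posAt n p' = (VBGen.sigma i).right := by
      split_ifs at hp' <;> simp_all
    exact iff_of_false (w.planeCross_strandPoint hQ h h1 h2).1.le.not_gt (by simp)

end BraidWord

/-! ### The closure of a power as a periodic diagram in an annulus. -/

namespace BraidWord

variable {k : ℕ} (w : BraidWord k) (q : ℕ)

/-- The number of layers of the closure of `w.power q`. -/
def turnLayers : ℕ := q * w.layers

theorem turnLayers_pos {q : ℕ} (hq : 1 ≤ q) : 0 < w.turnLayers q :=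
  Nat.mul_pos hq w.layers_pos

theorem turnLayers_cast_pos {q : ℕ} (hq : 1 ≤ q) : (0 : ℝ) < w.turnLayers q := by
  exact_mod_cast w.turnLayers_pos hq

theorem strandHeight_add_turn (p : Fin k) (x : ℝ) (j : ℤ) :
    w.strandHeight p (x + w.turnLayers q * j) =
      w.strandHeight (((exitPerm w ^ q) ^ j) p) x := by
  have := w.strandHeight_add_layers p x (q * j)
  rw [zpow_mul, zpow_natCast] at this
  rw [← this, turnLayers]
  push_cast
  congr 1; ring

theorem strandMark_add_turn (p : Fin k) (x : ℝ) (j : ℤ) :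
    w.strandMark p (x + w.turnLayers q * j) = w.strandMark (((exitPerm w ^ q) ^ j) p) x := by
  have := w.strandMark_add_layers p x (q * j)
  rw [zpow_mul, zpow_natCast] at this
  rw [← this, turnLayers]
  push_cast
  congr 1; ring

theorem strandPoint_add_turn {q : ℕ} (hq : 1 ≤ q) (p : Fin k) (x : ℝ) (j : ℤ) :
    w.strandPoint (w.turnLayers q) p (x + w.turnLayers q * j) =
      w.strandPoint (w.turnLayers q) (((exitPerm w ^ q) ^ j) p) x :=
  ((w.strandPoint_eq_iff (w.turnLayers_cast_pos hq)).2
    ⟨(w.strandHeight_add_turn q p x j).symm, j, rfl⟩).symm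

/-- The number of turns of the component of the closure of `w.power q` through `p`. -/
noncomputable def turns (p : Fin k) : ℕ :=
  Function.minimalPeriod (exitPerm w ^ q : Equiv.Perm (Fin k)) p

theorem turns_pos (p : Fin k) : 0 < w.turns q p := Equiv.Perm.minimalPeriod_pos_of_finite _

/-- The number of layers met along the component through `p`. -/
noncomputable def speed (p : Fin k) : ℝ := w.turnLayers q * w.turns q p

theorem speed_pos {q : ℕ} (hq : 1 ≤ q) (p : Fin k) : 0 < w.speed q p :=
  mul_pos (w.turnLayers_cast_pos hq) (by exact_mod_cast w.turns_pos q p)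

theorem zpow_turns_apply_iff (p : Fin k) (j : ℤ) :
    ((exitPerm w ^ q) ^ j) p = p ↔ (w.turns q p : ℤ) ∣ j := by
  have h := MulAction.zpow_smul_eq_iff_minimalPeriod_dvd (a := exitPerm w ^ q) (b := p) (n := j)
  exact h

/-- The point `t` of the component that starts at the position `p` is the point at the time `x`
of the strand `p'`. -/
def IsOver (p : Fin k) (t x : ℝ) (p' : Fin k) : Prop :=
  ∃ j : ℤ, w.speed q p * t = x + w.turnLayers q * j ∧ p' = ((exitPerm w ^ q) ^ j) p

theorem isOver_self (p : Fin k) (t : ℝ) : w.IsOver q p t (w.speed q p * t) p :=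
  ⟨0, by simp, by simp⟩

/-- The curve of the component that starts at the position `p`. -/
noncomputable def curve (p : Fin k) (t : ℝ) : ℂ :=
  w.strandPoint (w.turnLayers q) p (w.speed q p * t)

variable {w q}

theorem IsOver.curve_eq (hq : 1 ≤ q) {p p' : Fin k} {t x : ℝ} (h : w.IsOver q p t x p') :
    w.curve q p t = w.strandPoint (w.turnLayers q) p' x := by
  obtain ⟨j, h1, rfl⟩ := h
  rw [curve, h1, strandPoint_add_turn w hq]

theorem IsOver.mark_eq {p p' : Fin k} {t x : ℝ} (h : w.IsOver q p t x p') :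
    w.strandMark p (w.speed q p * t) = w.strandMark p' x := by
  obtain ⟨j, h1, rfl⟩ := h
  rw [h1, strandMark_add_turn]

theorem IsOver.deriv_eq (hq : 1 ≤ q) {p p' : Fin k} {t x : ℝ} (h : w.IsOver q p t x p') :
    deriv (w.curve q p) t =
      ((w.speed q p : ℝ) : ℂ) * deriv (w.strandPoint (w.turnLayers q) p') x := by
  obtain ⟨j, h1, rfl⟩ := h
  have hd : ∀ p x, HasDerivAt (w.strandPoint (w.turnLayers q) p)
      (deriv (w.strandPoint (w.turnLayers q) p) x) x := fun p x =>
    ((w.contDiff_strandPoint _ p).differentiable (by simp)).differentiableAt.hasDerivAt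
  have h2 : HasDerivAt (fun t : ℝ => w.speed q p * t) (w.speed q p) t := by
    simpa using (hasDerivAt_id t).const_mul (w.speed q p)
  have h3 := (hd p (w.speed q p * t)).scomp t h2
  have h4 : deriv (w.strandPoint (w.turnLayers q) p) (w.speed q p * t) =
      deriv (w.strandPoint (w.turnLayers q) (((exitPerm w ^ q) ^ j) p)) x := by
    rw [h1, ← deriv_comp_add_const]
    congr 1
    ext y
    exact strandPoint_add_turn w hq p y j
  rw [← h4, ← Complex.real_smul]
  exact h3.deriv

/-- Points with the same image differ in time by full turns; a shift brings both to the time `x`,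
and coincidences in the plane become equal heights of strands at one time. -/
theorem IsOver.exists_of_curve_eq (hq : 1 ≤ q) {p₀ p p' : Fin k} {t t' x : ℝ}
    (h : w.IsOver q p₀ t x p) (hc : w.curve q p₀ t = w.curve q p' t') :
    ∃ p₁, w.IsOver q p' t' x p₁ ∧ w.strandHeight p x = w.strandHeight p₁ x := by
  rw [h.curve_eq hq, curve, strandPoint_eq_iff w (w.turnLayers_cast_pos hq)] at hc
  obtain ⟨h1, j, h2⟩ := hc
  refine ⟨_, ⟨j, h2, rfl⟩, ?_⟩
  rw [h1, h2, strandHeight_add_turn]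

theorem exists_isOver (hq : 1 ≤ q) {R : List (Fin k)} (hR : (exitPerm w ^ q).IsTransversal R)
    (p : Fin k) (x : ℝ) : ∃ (c : Fin R.length) (t : ℝ), w.IsOver q (R.get c) t x p := by
  obtain ⟨r, hr, j, hj⟩ := hR.1 p
  obtain ⟨c, rfl⟩ := List.get_of_mem hr
  refine ⟨c, (x + w.turnLayers q * j) / w.speed q (R.get c), j, ?_, hj.symm⟩
  rw [mul_div_cancel₀ _ (w.speed_pos hq _).ne']

theorem transversal_eq {R : List (Fin k)} (hR : (exitPerm w ^ q).IsTransversal R)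
    {c c' : Fin R.length} (h : (exitPerm w ^ q).SameCycle (R.get c) (R.get c')) : c = c' := by
  have h1 := List.pairwise_iff_get.1 hR.2
  rcases lt_trichotomy c c' with h2 | h2 | h2
  · exact absurd h (h1 _ _ h2)
  · exact h2
  · exact absurd h.symm (h1 _ _ h2)

/-- At a fixed time, the strand is a faithful coordinate for points of the source: its cycle gives
the component, and the number of turns is determined up to the length of the cycle, that is, `t` up
to integers. -/
theorem IsOver.eq_iff (hq : 1 ≤ q) {R : List (Fin k)} (hR : (exitPerm w ^ q).IsTransversal R)
    {c c' : Fin R.length} {t t' x : ℝ} {p p' : Fin k} (h : w.IsOver q (R.get c) t x p)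
    (h' : w.IsOver q (R.get c') t' x p') : p = p' ↔ c = c' ∧ ∃ m : ℤ, t' = t + m := by
  obtain ⟨j, h1, rfl⟩ := h
  obtain ⟨j', h2, rfl⟩ := h'
  have hQ := w.turnLayers_cast_pos hq
  constructor
  · intro h3
    obtain rfl : c = c' := by
      refine transversal_eq hR ?_
      exact Equiv.Perm.SameCycle.trans ⟨j, h3⟩ (Equiv.Perm.SameCycle.symm ⟨j', rfl⟩)
    refine ⟨rfl, ?_⟩
    have h4 : ((exitPerm w ^ q) ^ (j' - j)) (R.get c) = R.get c := by
      rw [sub_eq_neg_add, zpow_add, Equiv.Perm.mul_apply, ← h3, ← Equiv.Perm.mul_apply, ← zpow_add,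
        neg_add_cancel, zpow_zero, Equiv.Perm.one_apply]
    rw [zpow_turns_apply_iff] at h4
    obtain ⟨m, hm⟩ := h4
    refine ⟨m, ?_⟩
    have hm' : (j' : ℝ) - j = w.turns q (R.get c) * m := by exact_mod_cast hm
    have h5 : w.speed q (R.get c) * t' = w.speed q (R.get c) * (t + m) := by
      rw [mul_add, h1, h2, speed]
      linear_combination (w.turnLayers q : ℝ) * hm'
    exact mul_left_cancel₀ (w.speed_pos hq _).ne' h5
  · rintro ⟨rfl, m, rfl⟩
    have h3 : (w.turnLayers q : ℝ) * j' = w.turnLayers q * (j + w.turns q (R.get c) * m) := by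
      rw [mul_add, h1, speed] at h2
      linear_combination -h2
    have h4 : j' = j + w.turns q (R.get c) * m := by
      exact_mod_cast mul_left_cancel₀ hQ.ne' h3
    rw [h4, zpow_add, Equiv.Perm.mul_apply, (zpow_turns_apply_iff w q _ _).2 (dvd_mul_right _ _)]

theorem curve_add_one (hq : 1 ≤ q) (p : Fin k) (t : ℝ) :
    w.curve q p (t + 1) = w.curve q p t := by
  have : w.IsOver q p (t + 1) (w.speed q p * t) p := by
    refine ⟨w.turns q p, ?_, ((zpow_turns_apply_iff w q p _).2 dvd_rfl).symm⟩
    rw [mul_add, mul_one, speed]; push_cast; ring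
  rw [this.curve_eq hq, curve]

theorem mark_add_one (p : Fin k) (t : ℝ) :
    w.strandMark p (w.speed q p * (t + 1)) = w.strandMark p (w.speed q p * t) := by
  have : w.IsOver q p (t + 1) (w.speed q p * t) p := by
    refine ⟨w.turns q p, ?_, ((zpow_turns_apply_iff w q p _).2 dvd_rfl).symm⟩
    rw [mul_add, mul_one, speed]; push_cast; ring
  exact this.mark_eq

variable (w)

/-- The closure of `w.power q`, drawn in an annulus around the origin. -/
noncomputable def closureDiagram (hq : 1 ≤ q) (R : List (Fin k))
    (hR : (exitPerm w ^ q).IsTransversal R) (hn : 0 < R.length) : VirtualLinkDiagram where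
  n := R.length
  n_pos := hn
  γ c := w.curve q (R.get c)
  mark c t := w.strandMark (R.get c) (w.speed q (R.get c) * t)
  γ_periodic c t := curve_add_one hq _ t
  mark_periodic c t := mark_add_one _ t
  smooth c := (w.contDiff_strandPoint _ _).comp (contDiff_const.mul contDiff_id)
  immersion c t := by
    rw [(w.isOver_self q (R.get c) t).deriv_eq hq]
    exact mul_ne_zero (by exact_mod_cast (w.speed_pos hq _).ne')
      (w.deriv_strandPoint_ne_zero (w.turnLayers_cast_pos hq) _ _)
  double c₁ t₁ c₂ t₂ c₃ t₃ h12 h23 := by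
    have o1 := w.isOver_self q (R.get c₁) t₁
    obtain ⟨p₂, o2, h2⟩ := o1.exists_of_curve_eq hq h12
    obtain ⟨p₃, o3, h3⟩ := o1.exists_of_curve_eq hq (h12.trans h23)
    rw [← o1.eq_iff hq hR o2, ← o1.eq_iff hq hR o3, ← o2.eq_iff hq hR o3]
    -- Three distinct strands would meet in the middle of one layer; but the second and the third
    -- would both be at the position that is exchanged with that of the first.
    by_contra! h
    obtain ⟨n, g, e, hn, hs, hp⟩ := w.exists_of_strandHeight_eq h.1 h2
    obtain ⟨n', g', e', hn', hs', hp'⟩ := w.exists_of_strandHeight_eq h.2.1 h3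
    obtain rfl : n = n' := by
      have : (n : ℝ) = n' := by linarith
      exact_mod_cast this
    rw [hs] at hs'
    cases hs'
    apply h.2.2
    apply (w.posAt n).injective
    rcases hp with ⟨h4, h5⟩ | ⟨h4, h5⟩ <;> rcases hp' with ⟨h6, h7⟩ | ⟨h6, h7⟩
    · rw [h5, h7]
    · exact absurd (h4.symm.trans h6) (left_ne_right g)
    · exact absurd (h6.symm.trans h4) (left_ne_right g)
    · rw [h5, h7]
  transverse c t c' t' h hne := by
    have o1 := w.isOver_self q (R.get c) t
    obtain ⟨p, o2, h2⟩ := o1.exists_of_curve_eq hq h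
    rw [← o1.eq_iff hq hR o2] at hne
    rw [o1.deriv_eq hq, o2.deriv_eq hq, planeCross_smul]
    exact mul_ne_zero (mul_pos (w.speed_pos hq _) (w.speed_pos hq _)).ne'
      (w.planeCross_strandPoint_ne_zero (w.turnLayers_cast_pos hq) hne h2)
  regular_iff c t := by
    have o1 := w.isOver_self q (R.get c) t
    rw [strandMark_eq_regular_iff]
    constructor
    · intro h c' t' hc
      obtain ⟨p, o2, h2⟩ := o1.exists_of_curve_eq hq hc
      exact (o1.eq_iff hq hR o2).1 (h p h2)
    · intro h p hp
      obtain ⟨c', t', o2⟩ := exists_isOver hq hR p (w.speed q (R.get c) * t)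
      refine (o1.eq_iff hq hR o2).2 (h c' t' ?_)
      rw [o1.curve_eq hq, o2.curve_eq hq, strandPoint_eq_iff w (w.turnLayers_cast_pos hq)]
      exact ⟨hp, 0, by simp⟩
  mark_crossing c t c' t' h hne := by
    have o1 := w.isOver_self q (R.get c) t
    obtain ⟨p, o2, h2⟩ := o1.exists_of_curve_eq hq h
    rw [← o1.eq_iff hq hR o2] at hne
    rw [o2.mark_eq]
    exact w.strandMark_crossing hne h2
  finite_crossings c := by
    have hv := w.speed_pos hq (R.get c)
    refine ((Set.finite_Ico (0 : ℤ) ⌈w.speed q (R.get c)⌉).image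
      fun n : ℤ => ((n : ℝ) + 1 / 2) / w.speed q (R.get c)).subset ?_
    rintro t ⟨⟨h1, h2⟩, h3⟩
    obtain ⟨n, -, -, hn, -⟩ := w.strandMark_ne_regular.1 h3
    refine ⟨n, ⟨?_, ?_⟩, ?_⟩
    · have h4 : 0 ≤ w.speed q (R.get c) * t := by positivity
      have h5 : (-1 : ℝ) < n := by linarith
      have : -1 < n := by exact_mod_cast h5
      omega
    · rw [Int.lt_ceil]
      have h4 : w.speed q (R.get c) * t < w.speed q (R.get c) * 1 :=
        mul_lt_mul_of_pos_left h2 hv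
      linarith
    · dsimp only
      rw [← hn, mul_div_cancel_left₀ _ hv.ne']

section

variable {w} (hq : 1 ≤ q) {R : List (Fin k)} (hR : (exitPerm w ^ q).IsTransversal R)
    (hn : 0 < R.length)

/-- The rotation by 2π/q adds `w.layers` to the time, one copy of `w`. At the later time the same
height and mark belong to the strand whose starting position is the preimage of the old one under
`exitPerm w`. -/
theorem isPeriodic_closureDiagram : (w.closureDiagram hq R hR hn).IsPeriodic q := by
  refine ⟨fun c t => Complex.exp_ne_zero _, ?_⟩
  have hQ := w.turnLayers_cast_pos hq
  set ρ := exitPerm w ^ q with hρ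
  have hcomm : ∀ j : ℤ, Commute (ρ ^ j) (exitPerm w)⁻¹ := fun j =>
    (((Commute.refl (exitPerm w)).inv_right).pow_left q).zpow_left j
  -- The preimage need not be a representative: it lies on the component `c'`, `j` full turns from
  -- its starting position.
  have h1 : ∀ c : Fin R.length, ∃ (c' : Fin R.length) (j : ℤ),
      (ρ ^ j) (R.get c') = (exitPerm w)⁻¹ (R.get c) := by
    intro c
    obtain ⟨r, hr, j, hj⟩ := hR.1 ((exitPerm w)⁻¹ (R.get c))
    obtain ⟨c', rfl⟩ := List.get_of_mem hr
    exact ⟨c', j, hj⟩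
  choose f j hfj using h1
  have hfi : Function.Injective f := by
    intro a b hab
    refine transversal_eq hR ?_
    refine ⟨j b - j a, ?_⟩
    apply (exitPerm w)⁻¹.injective
    rw [← Equiv.Perm.mul_apply, ← (hcomm _).eq, Equiv.Perm.mul_apply, ← hfj a, ← hfj b, ← hab,
      ← Equiv.Perm.mul_apply, ← zpow_add, sub_add_cancel]
  -- `exitPerm w` commutes with its q-th power, so it permutes cycles of equal length. Equal speeds
  -- allow `φ` to be a translation.
  have hturns : ∀ c, w.turns q (R.get (f c)) = w.turns q (R.get c) := by
    intro c
    have key : ∀ i : ℤ, (ρ ^ i) (R.get (f c)) = R.get (f c) ↔ (ρ ^ i) (R.get c) = R.get c := by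
      intro i
      rw [← (ρ ^ j c).injective.eq_iff, ← Equiv.Perm.mul_apply, ← zpow_add, add_comm, zpow_add,
        Equiv.Perm.mul_apply, hfj, ← Equiv.Perm.mul_apply, (hcomm i).eq, Equiv.Perm.mul_apply]
      exact (exitPerm w)⁻¹.injective.eq_iff
    have h2 := (zpow_turns_apply_iff w q (R.get (f c)) _).2 dvd_rfl
    have h3 := (zpow_turns_apply_iff w q (R.get c) _).2 dvd_rfl
    rw [← hρ] at h2 h3
    have h4 := (zpow_turns_apply_iff w q (R.get c) _).1 ((key _).1 h2)
    have h5 := (zpow_turns_apply_iff w q (R.get (f c)) _).1 ((key _).2 h3)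
    exact Nat.dvd_antisymm (by exact_mod_cast h5) (by exact_mod_cast h4)
  have hspeed : ∀ c, w.speed q (R.get (f c)) = w.speed q (R.get c) := fun c => by
    rw [speed, speed, hturns]
  set φ : Fin R.length → ℝ → ℝ := fun c t =>
    t + (w.layers + w.turnLayers q * j c) / w.speed q (R.get c) with hφ
  have hover : ∀ c t, w.IsOver q (R.get (f c)) (φ c t) (w.speed q (R.get c) * t + w.layers)
      ((exitPerm w)⁻¹ (R.get c)) := by
    intro c t
    refine ⟨j c, ?_, (hfj c).symm⟩
    have := (w.speed_pos hq (R.get c)).ne'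
    rw [hspeed, hφ]
    dsimp only
    rw [mul_add, mul_div_cancel₀ _ this, add_assoc]
  refine ⟨Equiv.ofBijective f (Finite.injective_iff_bijective.1 hfi), φ, fun c => ?_,
    fun c t => ⟨?_, ?_⟩⟩
  · refine ⟨contDiff_id.add contDiff_const, fun t => ?_, fun t => ?_⟩
    · have : deriv (φ c) t = 1 := by
        simp only [hφ, deriv_add_const, deriv_id'']
      rw [this]; exact one_pos
    · simp only [hφ]; ring
  · change w.curve q (R.get (f c)) (φ c t) = _ * w.curve q (R.get c) t
    rw [(hover c t).curve_eq hq, curve, strandPoint, strandPoint, ← Complex.exp_add]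
    have h2 := w.strandHeight_add_layers ((exitPerm w)⁻¹ (R.get c)) (w.speed q (R.get c) * t) 1
    rw [zpow_one, Int.cast_one, mul_one, Equiv.Perm.inv_def, Equiv.apply_symm_apply] at h2
    rw [Equiv.Perm.inv_def, h2]
    congr 1
    have h3 : (q : ℂ) ≠ 0 := by exact_mod_cast (by omega : q ≠ 0)
    have h4 : (w.layers : ℂ) ≠ 0 := by exact_mod_cast w.layers_pos.ne'
    rw [turnLayers]
    push_cast
    field_simp
    ring
  · change w.strandMark (R.get (f c)) (w.speed q (R.get (f c)) * φ c t) = _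
    rw [(hover c t).mark_eq]
    have h2 := w.strandMark_add_layers ((exitPerm w)⁻¹ (R.get c)) (w.speed q (R.get c) * t) 1
    rw [zpow_one, Int.cast_one, mul_one, Equiv.Perm.inv_def, Equiv.apply_symm_apply] at h2
    rw [Equiv.Perm.inv_def, h2]
    rfl

end

end BraidWord

/-! ### The Gauss code of the closed braid diagram. -/

theorem List.map_filter_eq_flatMap {α β : Type*} (l : List α) (P : α → Prop) [DecidablePred P]
    (f : α → β) : (l.filter fun a => P a).map f = l.flatMap fun a => if P a then [f a] else [] := by
  induction l with
  | nil => rfl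
  | cons a l ih =>
    rw [List.flatMap_cons, ← ih, List.filter_cons]
    by_cases h : P a <;> simp [h]

namespace BraidWord

variable {k : ℕ} (w : BraidWord k)

/-- The letters met at a letter of a braid word by the strand in the position `p`. -/
def slotLetters : Option (VBGen k × Bool) → ℕ → Fin k → List GaussLetter
  | none, _, _ => []
  | some (VBGen.tau _, _), _, _ => []
  | some (VBGen.sigma i, e), a, p =>
      if p = (VBGen.sigma i).left then [⟨e, a, !e⟩]
      else if p = (VBGen.sigma i).right then [⟨!e, a, !e⟩] else []

/-- Layers beyond the end of the word contribute no letter; `K` will be `w.layers`, which exceeds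
the length of the empty word. -/
theorem strandWord_eq_flatMap {K : ℕ} (hK : w.length ≤ K) (a : ℕ) (p : Fin k) :
    strandWord w a p = (List.range K).flatMap fun i =>
      slotLetters w[i]? (a + i) (exitPerm (w.take i) p) := by
  induction w generalizing K a p with
  | nil => simp [strandWord, slotLetters]
  | cons x w ih =>
    obtain ⟨g, e⟩ := x
    obtain ⟨K, rfl⟩ : ∃ K', K = K' + 1 := ⟨K - 1, by rw [List.length_cons] at hK; omega⟩
    have h1 : strandWord ((g, e) :: w) a p =
        slotLetters (some (g, e)) a p ++ strandWord w (a + 1) (g.move p) := by cases g <;> rfl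
    rw [List.flatMap_range_succ, h1, ih (K := K) (by rw [List.length_cons] at hK; omega)]
    congr 1
    · refine List.flatMap_congr fun i _ => ?_
      rw [List.getElem?_cons_succ, List.take_succ_cons, exitPerm, Equiv.Perm.mul_apply,
        add_assoc, add_comm 1 i]

theorem componentWord_power_eq_flatMap (q : ℕ) (p : Fin k) :
    componentWord (w.power q) p = (List.range (w.turns q p * w.turnLayers q)).flatMap fun i : ℕ =>
      slotLetters (w.slot i) (i % w.turnLayers q) (w.posAt i p) := by
  rw [componentWord_power, turnLayers, ← mul_assoc, List.flatMap_range_mul _ w.layers]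
  refine List.flatMap_congr fun i _ => ?_
  rw [w.strandWord_eq_flatMap (le_max_left _ _ : _ ≤ w.layers)]
  refine List.flatMap_congr fun j hj => ?_
  replace hj : j < w.layers := List.mem_range.1 hj
  have h1 : w.slot ((i * w.layers + j : ℕ) : ℤ) = w[j]? := by
    rw [slot, ← Int.natCast_emod, Int.toNat_natCast, mul_comm, Nat.mul_add_mod,
      Nat.mod_eq_of_lt hj]
  have h2 : w.posAt ((i * w.layers + j : ℕ) : ℤ) = exitPerm (w.take j) * exitPerm w ^ i := by
    rw [posAt, ← Int.natCast_emod, Int.toNat_natCast, mul_comm i, Nat.mul_add_mod,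
      Nat.mod_eq_of_lt hj, ← Int.natCast_ediv, Nat.mul_add_div w.layers_pos,
      Nat.div_eq_of_lt hj, add_zero, zpow_natCast]
  rw [h1, h2, Equiv.Perm.mul_apply]
  rcases Nat.lt_or_ge j w.length with h3 | h3
  -- A layer with a letter exists only in a nonempty word, where `layers` is the length and the two
  -- numberings of crossings agree.
  · have h4 : w.length = w.layers := by rw [layers]; omega
    rw [h4, mul_comm q, mul_comm i, Nat.mod_mul, Nat.mul_add_mod, Nat.mod_eq_of_lt hj,
      Nat.mul_add_div w.layers_pos, Nat.div_eq_of_lt hj, add_zero, mul_comm (i % q), add_comm j]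
  · rw [List.getElem?_eq_none h3]
    rfl

theorem strandMark_classical {p : Fin k} {x : ℝ}
    (h : w.strandMark p x = Mark.overpass ∨ w.strandMark p x = Mark.underpass) :
    ∃ (n : ℤ) (i : Fin (k - 1)) (e : Bool), x = n + 1 / 2 ∧ w.slot n = some (VBGen.sigma i, e) := by
  obtain ⟨n, g, e, rfl, h1, -⟩ := w.strandMark_ne_regular.1
    (show w.strandMark p x ≠ Mark.regular by rcases h with h | h <;> rw [h] <;> simp)
  rcases g with i | i
  · exact ⟨n, i, e, rfl, h1⟩
  · rw [strandMark_half, h1, slotMark] at h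
    split_ifs at h <;> simp at h

variable {w} {q : ℕ} (hq : 1 ≤ q) {R : List (Fin k)} (hR : (exitPerm w ^ q).IsTransversal R)
    (hn : 0 < R.length)

theorem closureDiagram_planeCross_pos_iff {c c' : Fin R.length} {t t' : ℝ} {n : ℤ}
    {i : Fin (k - 1)} {e : Bool} (ht : w.speed q (R.get c) * t = n + 1 / 2)
    (hs : w.slot n = some (VBGen.sigma i, e))
    (hc : (w.closureDiagram hq R hR hn).γ c t = (w.closureDiagram hq R hR hn).γ c' t') :
    ((w.closureDiagram hq R hR hn).mark c t = Mark.overpass →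
      (w.closureDiagram hq R hR hn).mark c' t' = Mark.underpass →
      (0 < planeCross (deriv ((w.closureDiagram hq R hR hn).γ c) t)
        (deriv ((w.closureDiagram hq R hR hn).γ c') t') ↔ e = false)) ∧
    ((w.closureDiagram hq R hR hn).mark c t = Mark.underpass →
      (w.closureDiagram hq R hR hn).mark c' t' = Mark.overpass →
      (0 < planeCross (deriv ((w.closureDiagram hq R hR hn).γ c') t')
        (deriv ((w.closureDiagram hq R hR hn).γ c) t) ↔ e = false)) := by
  have hQ := w.turnLayers_cast_pos hq
  have o1 := w.isOver_self q (R.get c) t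
  rw [ht] at o1
  obtain ⟨p, o2, -⟩ := o1.exists_of_curve_eq hq hc
  change (w.strandMark (R.get c) _ = _ → w.strandMark (R.get c') _ = _ →
    (0 < planeCross (deriv (w.curve q (R.get c)) t) (deriv (w.curve q (R.get c')) t') ↔ _)) ∧
    (w.strandMark (R.get c) _ = _ → w.strandMark (R.get c') _ = _ →
    (0 < planeCross (deriv (w.curve q (R.get c')) t') (deriv (w.curve q (R.get c)) t) ↔ _))
  rw [o1.mark_eq, o2.mark_eq, o1.deriv_eq hq, o2.deriv_eq hq, planeCross_smul, planeCross_smul,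
    mul_pos_iff_of_pos_left (mul_pos (w.speed_pos hq _) (w.speed_pos hq _)),
    mul_pos_iff_of_pos_left (mul_pos (w.speed_pos hq _) (w.speed_pos hq _))]
  exact ⟨fun h h' => w.planeCross_pos_iff hQ hs h h', fun h h' => w.planeCross_pos_iff hQ hs h' h⟩

theorem closureDiagram_isPositive_iff {c : Fin R.length} {t : ℝ} {n : ℤ} {i : Fin (k - 1)}
    {e : Bool} (h : (w.closureDiagram hq R hR hn).IsClassical c t)
    (ht : w.speed q (R.get c) * t = n + 1 / 2) (hs : w.slot n = some (VBGen.sigma i, e)) :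
    (w.closureDiagram hq R hR hn).IsPositive c t ↔ e = false := by
  constructor
  · rintro ⟨c', t', h1, ⟨h2, h3, h4⟩ | ⟨h2, h3, h4⟩⟩
    · exact ((closureDiagram_planeCross_pos_iff hq hR hn ht hs h1).1 h2 h3).1 h4
    · exact ((closureDiagram_planeCross_pos_iff hq hR hn ht hs h1).2 h2 h3).1 h4
  · intro he
    obtain ⟨c', t', h1, -, -, h3⟩ := h.exists_partner
    have h4 := closureDiagram_planeCross_pos_iff hq hR hn ht hs h1
    refine ⟨c', t', h1, ?_⟩
    rcases h3 with ⟨h5, h6⟩ | ⟨h5, h6⟩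
    · exact Or.inl ⟨h5, h6, (h4.1 h5 h6).2 he⟩
    · exact Or.inr ⟨h5, h6, (h4.2 h5 h6).2 he⟩

variable (w q R) in
/-- The number of the layer at a point of the closed braid diagram. -/
noncomputable def layerNumber (c : Fin R.length) (t : ℝ) : ℕ :=
  (⌊w.speed q (R.get c) * t⌋ % w.turnLayers q).toNat

theorem layerNumber_eq {c : Fin R.length} {t : ℝ} {n : ℤ}
    (h : w.speed q (R.get c) * t = n + 1 / 2) :
    w.layerNumber q R c t = (n % w.turnLayers q).toNat := by
  unfold layerNumber
  rw [h, floor_half]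

/-- A layer contains at most one crossing, so the layer modulo a full turn identifies it. -/
theorem isNumbering_layerNumber :
    (w.closureDiagram hq R hR hn).IsNumbering (w.layerNumber q R) := by
  intro c t c' t' h h'
  have hQ := w.turnLayers_cast_pos hq
  have hQ' : (0 : ℤ) < w.turnLayers q := by exact_mod_cast w.turnLayers_pos hq
  obtain ⟨n, i, e, h1, h2⟩ := w.strandMark_classical h
  obtain ⟨n', i', e', h1', h2'⟩ := w.strandMark_classical h'
  have h3 : w.layerNumber q R c t = w.layerNumber q R c' t' ↔
      n % w.turnLayers q = n' % w.turnLayers q := by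
    rw [layerNumber_eq h1, layerNumber_eq h1']
    have := Int.emod_nonneg n hQ'.ne'
    have := Int.emod_nonneg n' hQ'.ne'
    omega
  rw [h3]
  change _ ↔ w.curve q (R.get c) t = w.curve q (R.get c') t'
  have o1 := w.isOver_self q (R.get c) t
  constructor
  · intro h4
    obtain ⟨j, hj⟩ := Int.modEq_iff_dvd.1 h4
    have o2 : w.IsOver q (R.get c') t' (w.speed q (R.get c) * t)
        (((exitPerm w ^ q) ^ j) (R.get c')) := by
      refine ⟨j, ?_, rfl⟩
      have : (n' : ℝ) - n = w.turnLayers q * j := by exact_mod_cast hj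
      rw [h1, h1']; linarith
    rw [o1.curve_eq hq, o2.curve_eq hq, strandPoint_eq_iff w hQ]
    refine ⟨?_, 0, by simp⟩
    apply w.strandHeight_eq_of_mark
    · change w.strandMark _ _ = _ ∨ w.strandMark _ _ = _ at h
      rcases h with h | h <;> rw [h] <;> simp
    · change w.strandMark _ _ = _ ∨ w.strandMark _ _ = _ at h'
      rw [o2.mark_eq] at h'
      rcases h' with h | h <;> rw [h] <;> simp
  · intro h4
    obtain ⟨p, ⟨j, hj, -⟩, -⟩ := o1.exists_of_curve_eq hq h4
    rw [h1, h1'] at hj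
    have : (n' : ℝ) = n + w.turnLayers q * j := by linarith
    have : n' = n + w.turnLayers q * j := by exact_mod_cast this
    rw [this, Int.add_mul_emod_self_left]

open Classical in
variable (w q R) in
/-- The times of the classical crossings on a component of the closed braid diagram. -/
noncomputable def crossingTimes (c : Fin R.length) : List ℝ :=
  ((List.range (w.turns q (R.get c) * w.turnLayers q)).filter fun i : ℕ =>
    w.strandMark (R.get c) (i + 1 / 2) = Mark.overpass ∨
      w.strandMark (R.get c) (i + 1 / 2) = Mark.underpass).map
    fun i : ℕ => ((i : ℝ) + 1 / 2) / w.speed q (R.get c)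

theorem speed_eq (p : Fin k) : w.speed q p = ((w.turns q p * w.turnLayers q : ℕ) : ℝ) := by
  rw [speed]; push_cast; ring

theorem listsFrom_crossingTimes (c : Fin R.length) :
    ListsFrom {t | (w.closureDiagram hq R hR hn).IsClassical c t} 0
      (w.crossingTimes q R c) := by
  classical
  have hv := w.speed_pos hq (R.get c)
  constructor
  · rw [crossingTimes, List.pairwise_map]
    refine (List.pairwise_lt_range.filter _).imp fun {a b} hab => ?_
    have : (a : ℝ) < b := by exact_mod_cast hab
    gcongr
  · intro t
    simp only [crossingTimes, List.mem_map, List.mem_filter, List.mem_range, decide_eq_true_eq,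
      Set.mem_Ico, zero_add]
    constructor
    · rintro ⟨i, ⟨h1, h2⟩, rfl⟩
      have h3 : (i : ℝ) + 1 ≤ w.speed q (R.get c) := by
        rw [speed_eq]; exact_mod_cast h1
      refine ⟨⟨by positivity, ?_⟩, ?_⟩
      · rw [div_lt_one hv]; linarith
      · change w.strandMark _ (_ * _) = _ ∨ w.strandMark _ (_ * _) = _
        rwa [mul_div_cancel₀ _ hv.ne']
    · rintro ⟨⟨h1, h2⟩, h3⟩
      change w.strandMark _ _ = _ ∨ w.strandMark _ _ = _ at h3
      obtain ⟨n, i, e, h4, h5⟩ := w.strandMark_classical h3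
      have h6 : 0 ≤ w.speed q (R.get c) * t := by positivity
      have h7 : w.speed q (R.get c) * t < w.speed q (R.get c) * 1 :=
        mul_lt_mul_of_pos_left h2 hv
      have h8 : (-1 : ℝ) < n := by linarith
      have h9 : (-1 : ℤ) < n := by exact_mod_cast h8
      lift n to ℕ using by omega
      push_cast at h4
      refine ⟨n, ⟨?_, ?_⟩, ?_⟩
      · rw [speed_eq] at h7
        rw [speed_eq] at h4
        have : (n : ℝ) < ((w.turns q (R.get c) * w.turnLayers q : ℕ) : ℝ) := by linarith
        exact_mod_cast this
      · rwa [← h4]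
      · rw [← h4, mul_div_cancel_left₀ _ hv.ne']

/-- Both sides are read layer by layer, the crossing of layer `n` being met at the time `n + 1 / 2`;
the letter in the layer decides whether the point is classical and which letter it contributes. -/
theorem map_letterAt_crossingTimes (c : Fin R.length) :
    (w.crossingTimes q R c).map ((w.closureDiagram hq R hR hn).letterAt (w.layerNumber q R) c) =
      componentWord (w.power q) (R.get c) := by
  classical
  have hv := w.speed_pos hq (R.get c)
  rw [crossingTimes, List.map_map, List.map_filter_eq_flatMap, componentWord_power_eq_flatMap]
  refine List.flatMap_congr fun n _ => ?_
  have ht : w.speed q (R.get c) * (((n : ℝ) + 1 / 2) / w.speed q (R.get c)) = n + 1 / 2 :=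
    mul_div_cancel₀ _ hv.ne'
  have ht' : w.speed q (R.get c) * (((n : ℝ) + 1 / 2) / w.speed q (R.get c)) =
      ((n : ℤ) : ℝ) + 1 / 2 := by rw [ht]; push_cast; rfl
  have hm := w.strandMark_half (R.get c) n
  rw [Int.cast_natCast] at hm
  have hlabel : w.layerNumber q R c (((n : ℝ) + 1 / 2) / w.speed q (R.get c)) =
      n % w.turnLayers q := by
    rw [layerNumber_eq ht', ← Int.natCast_emod, Int.toNat_natCast]
  have hletter : (w.strandMark (R.get c) (n + 1 / 2) = Mark.overpass ∨
      w.strandMark (R.get c) (n + 1 / 2) = Mark.underpass) → ∀ i e,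
      w.slot n = some (VBGen.sigma i, e) →
      (w.closureDiagram hq R hR hn).letterAt (w.layerNumber q R) c
        (((n : ℝ) + 1 / 2) / w.speed q (R.get c)) =
      ⟨decide (w.strandMark (R.get c) (n + 1 / 2) = Mark.overpass), n % w.turnLayers q, !e⟩ := by
    intro h i e hs
    have hc : (w.closureDiagram hq R hR hn).mark c (((n : ℝ) + 1 / 2) / w.speed q (R.get c)) =
        w.strandMark (R.get c) (n + 1 / 2) := by
      change w.strandMark _ _ = _
      rw [ht]
    have h1 := closureDiagram_isPositive_iff hq hR hn
      (by unfold VirtualLinkDiagram.IsClassical; rw [hc]; exact h) ht' hs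
    unfold VirtualLinkDiagram.letterAt
    rw [hc, hlabel, GaussLetter.mk.injEq]
    refine ⟨by congr, rfl, ?_⟩
    cases e <;> simpa using h1
  simp only [Function.comp_apply]
  rcases hs : w.slot n with _ | ⟨i | i, e⟩
  · rw [hs] at hm
    rw [if_neg (by rw [hm]; simp [slotMark])]
    rfl
  · rw [hs] at hm
    have hlr := left_ne_right (VBGen.sigma i)
    split_ifs with h
    · rw [hletter h i e hs]
      rw [hm] at h ⊢
      simp only [slotLetters, slotMark] at h ⊢
      cases e <;> split_ifs at h ⊢ <;> simp_all
    · rw [hm] at h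
      simp only [slotLetters, slotMark] at h ⊢
      cases e <;> split_ifs at h ⊢ <;> simp_all
  · rw [hs] at hm
    rw [if_neg (by rw [hm, slotMark]; split_ifs <;> simp)]
    rfl

theorem hasGaussCode_closureDiagram :
    (w.closureDiagram hq R hR hn).HasGaussCode (R.map (componentWord (w.power q))) := by
  rw [VirtualLinkDiagram.hasGaussCode_iff]
  refine ⟨w.layerNumber q R, fun _ => 0, w.crossingTimes q R, isNumbering_layerNumber hq hR hn,
    listsFrom_crossingTimes hq hR hn, List.Perm.of_eq ?_⟩
  change _ = List.ofFn fun c : Fin R.length => _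
  simp only [map_letterAt_crossingTimes]
  conv_lhs => rw [← List.ofFn_get R, List.map_ofFn]
  rfl

/-- The closure of a power of a braid is drawn symmetrically around the origin. -/
theorem exists_periodic_diagram (w : BraidWord k) (hq : 1 ≤ q)
    (h : 0 < (w.power q).closureCode.length) :
    ∃ D : VirtualLinkDiagram, D.IsPeriodic q ∧ D.HasGaussCode (w.power q).closureCode := by
  classical
  have hρ := exitPerm_power w q
  simp only [closureCode, hρ, List.length_map] at h ⊢
  have hR := isTransversal_least (exitPerm w ^ q)
  exact ⟨_, isPeriodic_closureDiagram hq hR (by convert h),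
    by convert hasGaussCode_closureDiagram hq hR (by convert h)⟩

end BraidWord

/-! ### Assembly of the equivalences for diagrams and up to isotopy. -/

theorem theorem1p2 (q : ℕ) (hq : 1 ≤ q) :
    -- (i) and (ii) for diagrams
    (∀ K : VirtualLinkDiagram, K.IsKnot →
      ((∃ D : VirtualLinkDiagram, D.SameGaussDiagram K ∧ D.IsPeriodic q) ↔
        ∃ u : List GaussLetter, GaussCode.IsPeriodicWord q u ∧ K.HasGaussCode [u])) ∧
    (∀ K : VirtualLinkDiagram,
      ((∃ D : VirtualLinkDiagram, D.SameGaussDiagram K ∧ D.IsPeriodic q) ↔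
        ∃ (k : ℕ) (β : VB k) (w : BraidWord k),
          w.toVB = β ∧ K.HasGaussCode (w.power q).closureCode)) ∧
    -- (i) and (ii) for virtual knots and links, that is, up to virtual isotopy
    (∀ K : VirtualLinkDiagram, K.IsKnot →
      ((∃ D : VirtualLinkDiagram, D.VirtuallyIsotopic K ∧ D.IsPeriodic q) ↔
        ∃ u : List GaussLetter, GaussCode.Valid [u] ∧ GaussCode.IsPeriodicWord q u ∧
          K.RepresentedBy [u])) ∧
    (∀ K : VirtualLinkDiagram,
      ((∃ D : VirtualLinkDiagram, D.VirtuallyIsotopic K ∧ D.IsPeriodic q) ↔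
        ∃ (k : ℕ) (β : VB k) (w : BraidWord k),
          w.toVB = β ∧ K.RepresentedBy (w.power q).closureCode)) := by
  -- The comparison with `K` excludes the empty closure (`k = 0`), since a diagram has at least one
  -- component.
  have hrealize : ∀ {K : VirtualLinkDiagram} {k : ℕ} {w : BraidWord k} {C : GaussCode},
      K.HasGaussCode C → C.length = (w.power q).closureCode.length →
      ∃ D : VirtualLinkDiagram, D.IsPeriodic q ∧ D.HasGaussCode (w.power q).closureCode :=
    fun {K _ w _} hK h => w.exists_periodic_diagram hq (by rw [← h, hK.length_eq]; exact K.n_pos)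
  have braid_of_diagram : ∀ K : VirtualLinkDiagram,
      (∃ D : VirtualLinkDiagram, D.SameGaussDiagram K ∧ D.IsPeriodic q) →
        ∃ (k : ℕ) (w : BraidWord k), K.HasGaussCode (w.power q).closureCode := by
    rintro K ⟨D, ⟨C, hD, hK⟩, hp⟩
    obtain ⟨k, w, hw⟩ := hp.exists_braidWord hq hD
    exact ⟨k, w, hK.of_same (hD.same hw)⟩
  have diagram_of_braid : ∀ (K : VirtualLinkDiagram) {k : ℕ} (w : BraidWord k),
      K.HasGaussCode (w.power q).closureCode →
        ∃ D : VirtualLinkDiagram, D.SameGaussDiagram K ∧ D.IsPeriodic q := by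
    intro K k w hK
    obtain ⟨D, h1, h2⟩ := hrealize hK rfl
    exact ⟨D, ⟨_, h2, hK⟩, h1⟩
  -- A diagram with the code of the closure is kept: for knots it shows that this code is valid and
  -- has a single word.
  have braid_of_link : ∀ K : VirtualLinkDiagram,
      (∃ D : VirtualLinkDiagram, D.VirtuallyIsotopic K ∧ D.IsPeriodic q) →
        ∃ (k : ℕ) (w : BraidWord k), (∃ D : VirtualLinkDiagram, D.n = K.n ∧
          D.HasGaussCode (w.power q).closureCode) ∧ K.RepresentedBy (w.power q).closureCode := by
    rintro K ⟨D, ⟨C, ⟨C', hD, hC⟩, hK⟩, hp⟩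
    obtain ⟨k, w, hw⟩ := hp.exists_braidWord hq hD
    refine ⟨k, w, ⟨D, ?_, hw⟩, C, hK, ?_⟩
    · rw [← hD.length_eq, ← hK.length_eq, hC.length_eq]
    · exact (Relation.EqvGen.symm _ _ hC).trans _ _ _ (Relation.EqvGen.rel _ _ (Or.inl (hD.same hw)))
  have link_of_braid : ∀ (K : VirtualLinkDiagram) {k : ℕ} (w : BraidWord k),
      K.RepresentedBy (w.power q).closureCode →
        ∃ D : VirtualLinkDiagram, D.VirtuallyIsotopic K ∧ D.IsPeriodic q := by
    rintro K k w ⟨C, hK, hC⟩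
    obtain ⟨D, h1, h2⟩ := hrealize hK hC.length_eq
    exact ⟨D, ⟨C, ⟨_, h2, Relation.EqvGen.symm _ _ hC⟩, hK⟩, h1⟩
  refine ⟨fun K hK => ⟨fun h => ?_, ?_⟩, fun K => ⟨fun h => ?_, ?_⟩,
    fun K hK => ⟨fun h => ?_, ?_⟩, fun K => ⟨fun h => ?_, ?_⟩⟩
  · obtain ⟨k, w, hw⟩ := braid_of_diagram K h
    obtain ⟨u, hu⟩ := List.length_eq_one_iff.1 (hw.length_eq.trans hK)
    exact ⟨u, BraidWord.isPeriodicWord_of_closureCode_power hq hu, hu ▸ hw⟩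
  · rintro ⟨u, hu, hK'⟩
    obtain ⟨k, w, hw⟩ := hu.exists_braidWord hq hK'.valid
    exact diagram_of_braid K w (hK'.of_same hw)
  · obtain ⟨k, w, hw⟩ := braid_of_diagram K h
    exact ⟨k, _, w, rfl, hw⟩
  · rintro ⟨k, _, w, -, hw⟩
    exact diagram_of_braid K w hw
  · obtain ⟨k, w, ⟨D, hn, hD⟩, hw⟩ := braid_of_link K h
    obtain ⟨u, hu⟩ := List.length_eq_one_iff.1 ((hD.length_eq.trans hn).trans hK)
    exact ⟨u, hu ▸ hD.valid, BraidWord.isPeriodicWord_of_closureCode_power hq hu, hu ▸ hw⟩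
  -- Here `u` is only isotopic to a code of `K`, so validity comes from the assumption and not from
  -- a diagram.
  · rintro ⟨u, hV, hu, C, hK', hC⟩
    obtain ⟨k, w, hw⟩ := hu.exists_braidWord hq hV
    exact link_of_braid K w ⟨C, hK', hC.trans _ _ _ (Relation.EqvGen.rel _ _ (Or.inl hw))⟩
  · obtain ⟨k, w, -, hw⟩ := braid_of_link K h
    exact ⟨k, _, w, rfl, hw⟩
  · rintro ⟨k, _, w, -, hw⟩
    exact link_of_braid K w hw
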